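/- Let $-\infty\le a<b\le\infty$, $I=(a,b)$, and let $$\tau=\tfrac1{\mathrm i}\sigma_2\tfrac{d}{dx}+Q(x),\qquad Q=q_{\rm el}\mathbb 1+q_{\rm am}\sigma_1+(m+q_{\rm sc})\sigma_3,$$ where $\sigma_j$ are the Pauli matrices, $m\in[0,\infty)$ and $q_{\rm el},q_{\rm am},q_{\rm sc}\in L^1_{\rm loc}(I)$ are real-valued. Let $W_x(f,g)=f_1(x)g_2(x)-f_2(x)g_1(x)$. Let $H$ be the operator $f\mapsto\tau f$ in $\mathfrak H=L^2(I,\mathbb C^2)$ defined on all $f\in\mathfrak H\cap AC_{\rm loc}(I,\mathbb C^2)$ with $\tau f\in\mathfrak H$ that satisfy a boundary condition $W_a(u_-,f)=0$ at $a$ if $\tau$ is in the limit circle case at $a$, and $W_b(u_+,f)=0$ at $b$ if $\tau$ is in the limit circle case at $b$; here $u_\pm$ are fixed non-trivial real solutions of $\tau u=\mu_\pm u$ with $\mu_\pm\in\mathbb R$. For $c\in I$ let $H^D_{(a,c)}$ be the operator in $L^2((a,c),\mathbb C^2)$ obtained by restricting $H$ to $(a,c)$ with the Dirichlet condition $f_1(c)=0$.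 A function lies in the domain of $H$ near an endpoint if it is in $AC_{\rm loc}(I,\mathbb C^2)$, it and its image under $\tau$ are square integrable near that endpoint, and it satisfies the boundary condition (if any) there. Suppose that $H$ satisfies the following hypothesis: the spectrum of $H^D_{(a,c)}$ is purely discrete for some $c\in I$. A real entire system for $H$ is a pair $\Theta(z,x),\Phi(z,x)$ of solutions of $\tau u=zu$, $z\in\mathbb C$, which for each $x\in I$ are entire in $z$ and real for $z\in\mathbb R$, such that $W(\Theta(z),\Phi(z))=1$ and $\Phi(z,\cdot)$ is non-trivial and lies in the domain of $H$ near $a$ for every $z$. Fix such a system. The associated singular Weyl function is $M(z)=-W(\Theta(z),u_+(z))/W(\Phi(z),u_+(z))$, defined for all $z$ for which there is a non-trivial solution $u_+(z)$ of $\tau u=zu$ in the domain of $H$ near $b$ and $W(\Phi(z),u_+(z))\neq0$; put $\Psi(z,x)=\Theta(z,x)+M(z)\Phi(z,x)$ for such $z$. Let $\lambda\in\mathbb R$ and $\gamma\in[-\|\Phi(\lambda)\|^{-2},\infty)$, where $\|\Phi(\lambda)\|^{-2}=0$ if $\Phi(\lambda)\notin\mathfrak H$; if $\Phi(\lambda)\in\mathfrak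 H$, suppose also that $\lambda$ is an eigenvalue of $H$. Put $$c_\gamma(\lambda,x)=\frac1\gamma+\int_a^x\Phi(\lambda,y)^\top\Phi(\lambda,y)\,dy,\qquad \widetilde\Phi_\gamma(\lambda,x)=\frac{\Phi(\lambda,x)}{c_\gamma(\lambda,x)},$$ and let $H_\gamma$ be the Dirac operator on $I$ with differential expression $\tau_\gamma=\tau+Q_\gamma$, $$Q_\gamma=\frac{\Phi_1(\lambda,x)^2-\Phi_2(\lambda,x)^2}{c_\gamma(\lambda,x)}\sigma_1-2\,\frac{\Phi_1(\lambda,x)\Phi_2(\lambda,x)}{c_\gamma(\lambda,x)}\sigma_3,$$ and with the boundary condition $W(\widetilde\Phi_\gamma(\lambda),f)=0$ at each endpoint where $\tau_\gamma$ is in the limit circle case. For $\gamma=0$ this is read as $H_0=H$, $\widetilde\Phi_0(\lambda,\cdot)=0$. Then $H_\gamma$ is again a Dirac operator of the above kind (with the same $m$ and $q_{\rm el}$), and it has a real entire system $\Theta_\gamma,\Phi_\gamma$, so in particular $W(\Theta_\gamma(z),\Phi_\gamma(z))=1$, given for all $x\in I$ by $$\Phi_\gamma(z,x)=\Phi(z,x)-\widetilde\Phi_\gamma(\lambda,x)\int_a^x\Phi(\lambda,y)^\top\Phi(z,y)\,dy\qquad(z\in\mathbb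 C),$$ $$\Phi_\gamma(z,x)=\Phi(z,x)+\frac1{z-\lambda}\widetilde\Phi_\gamma(\lambda,x)W_x(\Phi(\lambda),\Phi(z))\qquad(z\ne\lambda),$$ $$\Theta_\gamma(z,x)=\Theta(z,x)+\frac1{z-\lambda}\Big(\widetilde\Phi_\gamma(\lambda,x)W_x(\Phi(\lambda),\Theta(z))+\gamma\,\Phi_\gamma(z,x)\Big)\qquad(z\ne\lambda),$$ and, for $z=\lambda$, with a dot denoting $\partial/\partial z$, $$\Phi_\gamma(\lambda,x)=\gamma^{-1}\widetilde\Phi_\gamma(\lambda,x)\quad(\gamma\ne0),\qquad \Theta_\gamma(\lambda,x)=\Theta(\lambda,x)+\widetilde\Phi_\gamma(\lambda,x)W_x(\Phi(\lambda),\dot\Theta(\lambda))+\gamma\,\dot\Phi_\gamma(\lambda,x).$$ Moreover $H_\gamma$ again satisfies the hypothesis: the spectrum of $(H_\gamma)^D_{(a,c)}$ is purely discrete, for every $c\in I$. Finally, for every $z\ne\lambda$ in the domain of $M$, the function $$\Psi_\gamma(z,x)=\Psi(z,x)+\frac1{z-\lambda}\widetilde\Phi_\gamma(\lambda,x)W_x(\Phi(\lambda),\Psi(z))=\Theta_\gamma(z,x)+M_\gamma(z)\Phi_\gamma(z,x),\qquad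 M_\gamma(z)=M(z)-\frac{\gamma}{z-\lambda},$$ is a non-trivial solution of $\tau_\gamma u=zu$ in the domain of $H_\gamma$ near $b$; and, away from $z=\lambda$, the singular Weyl function of $H_\gamma$ associated with $\Theta_\gamma,\Phi_\gamma$ has the same domain as $M$ and equals $M_\gamma$. -/

import Mathlib

open MeasureTheory Filter Topology Set
open scoped ENNReal

noncomputable section

namespace DiracDC

/-- Two-component spinors, `ℂ²` with its Euclidean norm. -/
abbrev C2 : Type := EuclideanSpace ℂ (Fin 2)

/-- The Hilbert space `L²(J, ℂ²)`. -/
abbrev L2 (J : Set ℝ) : Type := Lp C2 2 (volume.restrict J)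

/-- The Wronskian `W(f, g) = f₁ g₂ - f₂ g₁` of two vectors of `ℂ²`. -/
def W (f g : C2) : ℂ := f 0 * g 1 - f 1 * g 0

/-- The bilinear product `fᵀ g`. -/
def bil (f g : C2) : ℂ := f 0 * g 0 + f 1 * g 1

/-- `f` is locally absolutely continuous on the interval `J`, with derivative `f'` almost
everywhere: `f' ∈ L¹_loc(J)` and `f` is a primitive of `f'`. -/
def HasACDeriv (J : Set ℝ) (f f' : ℝ → C2) : Prop :=
  LocallyIntegrableOn f' J ∧ ∀ x ∈ J, ∀ y ∈ J, f y - f x = ∫ t in x..y, f' t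

/-! ### Unbounded operators, given by their graphs -/

section Graph

variable {E : Type*} [NormedAddCommGroup E] [NormedSpace ℂ E]

/-- `z` is in the resolvent set of the operator `T` with graph `G`: there is a bounded operator
`R`, defined everywhere, with `R = (T - z)⁻¹`. -/
def IsResolventPoint (G : Set (E × E)) (z : ℂ) : Prop :=
  ∃ R : E →L[ℂ] E, ∀ F K : E, (F, K + z • F) ∈ G ↔ F = R K

/-- The spectrum of the operator with graph `G`. -/
def spec (G : Set (E × E)) : Set ℂ := {z | ¬ IsResolventPoint G z}

/-- `z` is an eigenvalue (belongs to the point spectrum) of the operator with graph `G`. -/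
def IsEigenvalue (G : Set (E × E)) (z : ℂ) : Prop := ∃ F : E, F ≠ 0 ∧ (F, z • F) ∈ G

/-- The spectrum is purely discrete: every point of it is an isolated point of the spectrum and
an eigenvalue of finite multiplicity. -/
def PurelyDiscrete (G : Set (E × E)) : Prop :=
  ∀ z ∈ spec G, (∃ r > 0, ∀ w ∈ spec G, dist w z < r → w = z) ∧ IsEigenvalue G z ∧
    FiniteDimensional ℂ (Submodule.span ℂ {F : E | (F, z • F) ∈ G})

end Graph

/-! ### Dirac operators -/

/-- The mass and the scalar, electrostatic and anomalous magnetic potentials. -/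
structure Potential where
  m : ℝ
  qsc : ℝ → ℝ
  qel : ℝ → ℝ
  qam : ℝ → ℝ

/-- The Pauli matrix `σ₁`. -/
def sigma1 : Matrix (Fin 2) (Fin 2) ℂ := !![0, 1; 1, 0]

/-- The Pauli matrix `σ₂`. -/
def sigma2 : Matrix (Fin 2) (Fin 2) ℂ := !![0, -Complex.I; Complex.I, 0]

/-- The Pauli matrix `σ₃`. -/
def sigma3 : Matrix (Fin 2) (Fin 2) ℂ := !![1, 0; 0, -1]

namespace Potential

/-- The potential matrix `Q(x) = q_el(x) 1 + q_am(x) σ₁ + (m + q_sc(x)) σ₃`. -/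
def Q (q : Potential) (x : ℝ) : Matrix (Fin 2) (Fin 2) ℂ :=
  (q.qel x : ℂ) • (1 : Matrix (Fin 2) (Fin 2) ℂ) + (q.qam x : ℂ) • sigma1 +
    ((q.m + q.qsc x : ℝ) : ℂ) • sigma3

/-- `f ∈ AC_loc(J)` and `τ f = g` almost everywhere on `J`, where
`τ = (1/i) σ₂ d/dx + Q(x)`. -/
def Tau (q : Potential) (J : Set ℝ) (f g : ℝ → C2) : Prop :=
  ∃ f' : ℝ → C2, HasACDeriv J f f' ∧ ∀ᵐ x ∂(volume.restrict J),
    g x = Matrix.toEuclideanLin ((1 / Complex.I) • sigma2) (f' x) +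
      Matrix.toEuclideanLin (q.Q x) (f x)

end Potential

/-- The data of a Dirac operator with separated boundary conditions: an interval `(a, b)`, the
potentials, and the functions generating the boundary conditions at `a` and `b` (these are only
used at an endpoint where `τ` is in the limit circle case). -/
structure DiracOp where
  a : EReal
  b : EReal
  pot : Potential
  bcA : ℝ → C2
  bcB : ℝ → C2

namespace DiracOp

variable (H : DiracOp)

/-- The interval `I = (a, b)`. -/
def I : Set ℝ := {x : ℝ | H.a < x ∧ (x : EReal) < H.b}

/-- The interval `(a, c)`. -/
def leftOpen (c : ℝ) : Set ℝ := {x : ℝ | H.a < x ∧ x < c}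

/-- The interval `(a, c]`. -/
def leftClosed (c : ℝ) : Set ℝ := {x : ℝ | H.a < x ∧ x ≤ c}

/-- The interval `(c, b)`. -/
def rightOpen (c : ℝ) : Set ℝ := {x : ℝ | c < x ∧ (x : EReal) < H.b}

/-- The filter of `x → a`, `x ∈ (a, b)`. -/
def atA : Filter ℝ := comap (fun x : ℝ => (x : EReal)) (𝓝[>] H.a)

/-- The filter of `x → b`, `x ∈ (a, b)`. -/
def atB : Filter ℝ := comap (fun x : ℝ => (x : EReal)) (𝓝[<] H.b)

/-- `u` solves `τ u = z u` on `(a, b)`. -/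
def Sol (z : ℂ) (u : ℝ → C2) : Prop := H.pot.Tau H.I u (fun x => z • u x)

/-- Square integrability near `a`. -/
def L2NearA (f : ℝ → C2) : Prop := ∃ c ∈ H.I, MemLp f 2 (volume.restrict (H.leftOpen c))

/-- Square integrability near `b`. -/
def L2NearB (f : ℝ → C2) : Prop := ∃ c ∈ H.I, MemLp f 2 (volume.restrict (H.rightOpen c))

/-- `τ` is in the limit circle case at `a`: all solutions of `τ u = z u` are square integrable
near `a`. Otherwise `τ` is in the limit point case at `a`. -/
def LimitCircleA : Prop := ∀ (z : ℂ) (u : ℝ → C2), H.Sol z u → H.L2NearA u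

/-- `τ` is in the limit circle case at `b`. -/
def LimitCircleB : Prop := ∀ (z : ℂ) (u : ℝ → C2), H.Sol z u → H.L2NearB u

/-- The boundary condition `W_a(u₋, f) = 0`, imposed if `τ` is in the limit circle case at `a`. -/
def BCA (f : ℝ → C2) : Prop :=
  H.LimitCircleA → Tendsto (fun x => W (H.bcA x) (f x)) H.atA (𝓝 0)

/-- The boundary condition `W_b(u₊, f) = 0`, imposed if `τ` is in the limit circle case at `b`. -/
def BCB (f : ℝ → C2) : Prop :=
  H.LimitCircleB → Tendsto (fun x => W (H.bcB x) (f x)) H.atB (𝓝 0)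

/-- A function which may serve to fix a boundary condition: a non-trivial real solution of
`τ w = μ w` for some real `μ`. -/
def IsBoundaryFunction (w : ℝ → C2) : Prop :=
  (∃ μ : ℝ, H.Sol μ w) ∧ (∀ x ∈ H.I, ∀ i, (w x i).im = 0) ∧ ∃ x ∈ H.I, w x ≠ 0

/-- The standing assumptions on a Dirac operator. -/
structure IsDirac : Prop where
  lt : H.a < H.b
  m_nonneg : 0 ≤ H.pot.m
  qsc_loc : LocallyIntegrableOn H.pot.qsc H.I
  qel_loc : LocallyIntegrableOn H.pot.qel H.I
  qam_loc : LocallyIntegrableOn H.pot.qam H.I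
  bcA : H.LimitCircleA → H.IsBoundaryFunction H.bcA
  bcB : H.LimitCircleB → H.IsBoundaryFunction H.bcB

/-- The graph of the self-adjoint operator `H` in `L²((a, b), ℂ²)`. -/
def graph : Set (L2 H.I × L2 H.I) :=
  {p | ∃ f g : ℝ → C2, H.pot.Tau H.I f g ∧ H.BCA f ∧ H.BCB f ∧
    p.1 =ᵐ[volume.restrict H.I] f ∧ p.2 =ᵐ[volume.restrict H.I] g}

/-- The graph of the operator `H^D_{(a,c)}` in `L²((a, c), ℂ²)`, the restriction of `H` to
`(a, c)` with the Dirichlet boundary condition `f₁(c) = 0`. (As `c` is a regular endpoint of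
`(a, c)`, functions in the domain are absolutely continuous up to `c`.) -/
def graphDirichlet (c : ℝ) : Set (L2 (H.leftClosed c) × L2 (H.leftClosed c)) :=
  {p | ∃ f g : ℝ → C2, H.pot.Tau (H.leftClosed c) f g ∧ H.BCA f ∧ f c 0 = 0 ∧
    p.1 =ᵐ[volume.restrict (H.leftClosed c)] f ∧ p.2 =ᵐ[volume.restrict (H.leftClosed c)] g}

/-- The spectrum of `H^D_{(a,c)}` is purely discrete. -/
def DiscreteLeft (c : ℝ) : Prop := PurelyDiscrete (H.graphDirichlet c)

/-- `f` lies in the domain of `H` near `a`. -/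
def InDomA (f : ℝ → C2) : Prop :=
  ∃ g : ℝ → C2, H.pot.Tau H.I f g ∧ H.L2NearA f ∧ H.L2NearA g ∧ H.BCA f

/-- `f` lies in the domain of `H` near `b`. -/
def InDomB (f : ℝ → C2) : Prop :=
  ∃ g : ℝ → C2, H.pot.Tau H.I f g ∧ H.L2NearB f ∧ H.L2NearB g ∧ H.BCB f

/-- `F(z, x)` is a real entire solution of `τ u = z u`. -/
structure IsRealEntire (F : ℂ → ℝ → C2) : Prop where
  sol : ∀ z, H.Sol z (F z)
  entire : ∀ x ∈ H.I, Differentiable ℂ (fun z => F z x)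
  real : ∀ (r : ℝ), ∀ x ∈ H.I, ∀ i, (F (r : ℂ) x i).im = 0

/-- `Θ, Φ` is a system of real entire solutions with `W(Θ(z), Φ(z)) = 1` such that `Φ(z, ·)` is
non-trivial and lies in the domain of `H` near `a` for every `z`. -/
structure IsRealEntireSystem (Θ Φ : ℂ → ℝ → C2) : Prop where
  theta : H.IsRealEntire Θ
  phi : H.IsRealEntire Φ
  phi_nontrivial : ∀ z, ∃ x ∈ H.I, Φ z x ≠ 0
  phi_dom : ∀ z, H.InDomA (Φ z)
  wronskian : ∀ z, ∀ x ∈ H.I, W (Θ z x) (Φ z x) = 1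

/-- `u` is a Weyl solution at `b`: a non-trivial solution of `τ u = z u` in the domain of `H`
near `b`. -/
def IsWeylSolB (z : ℂ) (u : ℝ → C2) : Prop :=
  H.Sol z u ∧ H.InDomB u ∧ ∃ x ∈ H.I, u x ≠ 0

/-- `m` is the value at `z` of the singular Weyl function
`M(z) = - W(Θ(z), u₊(z)) / W(Φ(z), u₊(z))`; in particular, `z` is in its domain, that is,
`u₊(z)` exists and the denominator does not vanish. -/
def IsWeylValue (Θ Φ : ℂ → ℝ → C2) (z m : ℂ) : Prop :=
  ∃ u, H.IsWeylSolB z u ∧ ∀ x ∈ H.I, W (Φ z x) (u x) ≠ 0 ∧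
    m = - W (Θ z x) (u x) / W (Φ z x) (u x)

/-! ### Double commutation -/

/-- `‖u‖²` in `L²((a, b), ℂ²)`, equal to `∞` if `u` is not square integrable. -/
def normSq (u : ℝ → C2) : ℝ≥0∞ := ∫⁻ x in H.I, ‖u x‖ₑ ^ 2

/-- `c_γ(x) = 1/γ + ∫_a^x u(y)ᵀ u(y) dy` for `γ ≠ 0` and a real function `u`. -/
def cGamma (u : ℝ → C2) (γ x : ℝ) : ℝ :=
  1 / γ + ∫ y in H.leftOpen x, ((u y 0).re ^ 2 + (u y 1).re ^ 2)

/-- `1 / c_γ(x)`, read as `0` for `γ = 0`. -/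
def cGammaInv (u : ℝ → C2) (γ x : ℝ) : ℝ := if γ = 0 then 0 else 1 / H.cGamma u γ x

/-- `u_γ = u / c_γ`, read as `0` for `γ = 0`. -/
def uGamma (u : ℝ → C2) (γ : ℝ) : ℝ → C2 := fun x => (H.cGammaInv u γ x : ℂ) • u x

/-- The operator `H_γ` constructed from the real function `u`: the potential `Q` is replaced by
`Q + Q_γ` with `Q_γ = ((u₁² - u₂²) / c_γ) σ₁ - 2 (u₁ u₂ / c_γ) σ₃`, and the boundary conditions
(at limit circle endpoints) are those generated by `u_γ`. For `γ = 0` this is `H`. -/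
def doubleComm (u : ℝ → C2) (γ : ℝ) : DiracOp where
  a := H.a
  b := H.b
  pot :=
    { m := H.pot.m
      qsc := fun x => H.pot.qsc x - 2 * ((u x 0).re * (u x 1).re) * H.cGammaInv u γ x
      qel := H.pot.qel
      qam := fun x => H.pot.qam x + ((u x 0).re ^ 2 - (u x 1).re ^ 2) * H.cGammaInv u γ x }
  bcA := if γ = 0 then H.bcA else H.uGamma u γ
  bcB := if γ = 0 then H.bcB else H.uGamma u γ

end DiracOp

end DiracDC

end

/-! ### Scalar calculus of locally absolutely continuous functions -/

namespace DiracDC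

/-! Write `u = Φ(λ)` and let `c` be the primitive of `uᵀu` with limit `1/γ` at `a`. Everything rests
on a pointwise identity (`DC.intertwine`): if `τf = h` and `g' = uᵀf`, then `τ_γ` maps `f - (g/c)u`
to `h - ((λg - W(u,f))/c)u`. For `τf = zf` the Lagrange identity reads `W(u,f)' = (λ - z)uᵀf`, so if
`(z - λ)g = -W(u,f)`, the image solves `τ_γ v = zv`. The choices `g = ∫_a^x uᵀΦ(z)` and `g =
-W(u,f)/(z - λ)` give the two formulas for `Φ_γ`; the second also transforms `Θ` and `Ψ`. The pair
`(u/c, -1/c)` leads back from `τ_γ` to `τ` (`DC.symm`).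

Domains. Near `a`, `1/c` is bounded. Near `b` the tool is the energy identity `(|g|²/c)' = |f|² - |f
- (g/c)u|²` (`DC.energy`). For `c > 0` it bounds the norm of the image at once. For `γ < 0` one has
`c < 0` and `u` is an eigenfunction, so `g → 0` at `b`; the bound `γ ≥ -‖u‖⁻²` gives `c(x) ≤ -∫_x^b
|u|²`, and Cauchy–Schwarz yields `|g|² ≤ -c ∫_x^b |f|²`. The boundary condition reduces to `g/c →
0`. That Wronskians within one domain vanish at an endpoint follows from a form of Weyl's
alternative (`IsEnd.L2Near_of_not_tendsto`): a non-zero limit forces the limit circle case, where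
the boundary condition excludes it.

Entireness. `∫_a^x uᵀΦ(z)` is minus the difference quotient of `W(u,Φ(z))` at `λ`. That its value at
`λ` is minus the derivative (`Setup.integral_eq_W_deriv`) is shown by approaching `λ` along a
vertical line, combining Fatou's lemma with Cauchy–Schwarz. The numerator of `Θ_γ - Θ` vanishes at
`λ`, so the singularity is removable; the maximum principle bounds `Θ_γ` near `λ`, which makes the
limit a solution (`Sol.of_tendsto`).

Discreteness holds for any Dirac operator with a real entire system
(`IsRealEntireSystem.discreteLeft`). The Green function built from `Φ(z)` and the solution
satisfying the Dirichlet condition at `c` is a bounded resolvent wherever `Φ₁(z,c) ≠ 0`, and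
`Φ₁(·,c)` is entire and has no non-real zeros. The bound is the usual `1/|Im z|` estimate off the
axis, carried to real points by the maximum principle.

Weyl function. `M` is its value at `z` exactly if `Θ + MΦ` is a Weyl solution at `b`
(`IsRealEntireSystem.isWeylValue_iff`). The transformation sends this to `Θ_γ + (M - γ/(z - λ))Φ_γ`,
and the inverse transformation gives the converse. -/

/-- An interval of the real line. -/
structure Itv (J : Set ℝ) : Prop where
  ord : J.OrdConnected
  lc : IsLocallyClosed J

/-- `φ` is locally absolutely continuous on `J` with derivative `φ'`. -/
structure Prim (J : Set ℝ) (φ φ' : ℝ → ℂ) : Prop where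
  loc : LocallyIntegrableOn φ' J
  sub_eq : ∀ x ∈ J, ∀ y ∈ J, φ y - φ x = ∫ t in x..y, φ' t

namespace Itv

variable {J : Set ℝ}

lemma uIcc_subset (hJ : Itv J) {x y : ℝ} (hx : x ∈ J) (hy : y ∈ J) : uIcc x y ⊆ J :=
  hJ.ord.uIcc_subset hx hy

lemma uIoc_subset (hJ : Itv J) {x y : ℝ} (hx : x ∈ J) (hy : y ∈ J) : uIoc x y ⊆ J :=
  uIoc_subset_uIcc.trans (hJ.uIcc_subset hx hy)

lemma measurableSet (hJ : Itv J) : MeasurableSet J := hJ.ord.measurableSet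

lemma intervalIntegrable {E : Type*} [NormedAddCommGroup E] (hJ : Itv J) {φ : ℝ → E}
    (h : LocallyIntegrableOn φ J) {x y : ℝ}
    (hx : x ∈ J) (hy : y ∈ J) : IntervalIntegrable φ volume x y :=
  intervalIntegrable_iff.2 ((h.integrableOn_compact_subset (hJ.uIcc_subset hx hy)
    isCompact_uIcc).mono_set uIoc_subset_uIcc)

/-- It suffices to check continuity on compact subintervals. -/
lemma continuousOn_of_uIcc {E : Type*} [TopologicalSpace E] {f : ℝ → E}
    (h : ∀ x ∈ J, ∀ y ∈ J, ContinuousOn f (uIcc x y)) : ContinuousOn f J := by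
  intro x hx
  by_cases h1 : ∃ y ∈ J, y < x
  · by_cases h2 : ∃ y ∈ J, x < y
    · obtain ⟨y, hy, hyx⟩ := h1
      obtain ⟨z, hz, hxz⟩ := h2
      have := h y hy z hz
      rw [uIcc_of_le (hyx.le.trans hxz.le)] at this
      exact (this.continuousAt (Icc_mem_nhds hyx hxz)).continuousWithinAt
    · obtain ⟨y, hy, hyx⟩ := h1
      push Not at h2
      have := h y hy x hx x right_mem_uIcc
      rw [uIcc_of_le hyx.le] at this
      refine this.mono_of_mem_nhdsWithin ?_
      have h3 : J ⊆ Iic x := fun t ht => h2 t ht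
      exact nhdsWithin_mono _ h3 (Icc_mem_nhdsLE hyx)
  · push Not at h1
    by_cases h2 : ∃ y ∈ J, x < y
    · obtain ⟨z, hz, hxz⟩ := h2
      have := h x hx z hz x left_mem_uIcc
      rw [uIcc_of_le hxz.le] at this
      refine this.mono_of_mem_nhdsWithin ?_
      have h3 : J ⊆ Ici x := fun t ht => h1 t ht
      exact nhdsWithin_mono _ h3 (Icc_mem_nhdsGE hxz)
    · push Not at h2
      have : J ⊆ {x} := fun t ht => le_antisymm (h2 t ht) (h1 t ht)
      exact (continuousWithinAt_singleton).mono this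

end Itv

/-- Reduces to the real case: the integral is recombined from its real and imaginary parts, with `1`
and `I` as constant coefficients. -/
lemma absolutelyContinuousOnInterval_integral_complex {f : ℝ → ℂ} {a b : ℝ}
    (h : IntervalIntegrable f volume a b) :
    AbsolutelyContinuousOnInterval (fun x => ∫ v in a..x, f v) a b := by
  have h1 : IntervalIntegrable (fun x => (f x).re) volume a b := by
    rw [intervalIntegrable_iff] at h ⊢; exact h.re
  have h2 : IntervalIntegrable (fun x => (f x).im) volume a b := by
    rw [intervalIntegrable_iff] at h ⊢; exact h.im
  have c1 : AbsolutelyContinuousOnInterval (fun _ : ℝ => (1 : ℂ)) a b :=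
    ((LipschitzWith.const (1 : ℂ)).lipschitzOnWith).absolutelyContinuousOnInterval
  have c2 : AbsolutelyContinuousOnInterval (fun _ : ℝ => Complex.I) a b :=
    ((LipschitzWith.const Complex.I).lipschitzOnWith).absolutelyContinuousOnInterval
  have e1 := (h1.absolutelyContinuousOnInterval_intervalIntegral (c := a) (by simp)).smul c1
  have e2 := (h2.absolutelyContinuousOnInterval_intervalIntegral (c := a) (by simp)).smul c2
  have e3 := e1.add e2
  rw [absolutelyContinuousOnInterval_iff] at e3 ⊢
  intro ε hε
  obtain ⟨δ, hδ, H⟩ := e3 ε hε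
  refine ⟨δ, hδ, fun E hE hE' => ?_⟩
  convert H E hE hE' using 1
  refine Finset.sum_congr rfl fun i hi => ?_
  have key : ∀ x ∈ uIcc a b, (∫ v in a..x, f v) =
      ((fun x => ∫ v in a..x, (f v).re) • (fun _ : ℝ => (1 : ℂ)) +
        (fun x => ∫ v in a..x, (f v).im) • (fun _ : ℝ => Complex.I)) x := by
    intro x hx
    have hx' : IntervalIntegrable f volume a x :=
      h.mono_set (uIcc_subset_uIcc left_mem_uIcc hx)
    simp only [Pi.add_apply, Pi.smul_apply', Complex.real_smul, mul_one]
    have r1 : (∫ v in a..x, (f v).re) = (∫ v in a..x, f v).re := by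
      simpa using (intervalIntegral.intervalIntegral_re hx' : _)
    have r2 : (∫ v in a..x, (f v).im) = (∫ v in a..x, f v).im := by
      simpa using (intervalIntegral.intervalIntegral_im hx' : _)
    rw [r1, r2, Complex.re_add_im]
  have hE1 := hE.1 i hi
  rw [key _ hE1.1, key _ hE1.2]

namespace Prim

variable {J : Set ℝ} {φ φ' ψ ψ' : ℝ → ℂ}

lemma intervalIntegrable (hJ : Itv J) (h : Prim J φ φ') {x y : ℝ} (hx : x ∈ J) (hy : y ∈ J) :
    IntervalIntegrable φ' volume x y := hJ.intervalIntegrable h.loc hx hy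

/-- Together with `of_ac` this translates between the integral form and the pointwise form of
absolute continuity; products and inverses are differentiated in the latter. -/
lemma ac (hJ : Itv J) (h : Prim J φ φ') {x y : ℝ} (hx : x ∈ J) (hy : y ∈ J) :
    AbsolutelyContinuousOnInterval φ x y ∧
      ∀ᵐ t, t ∈ uIcc x y → HasDerivAt φ (φ' t) t := by
  have hi := h.intervalIntegrable hJ hx hy
  have eq : ∀ t ∈ uIcc x y, φ t = φ x + ∫ s in x..t, φ' s := fun t ht => by
    rw [← h.sub_eq x hx t (hJ.uIcc_subset hx hy ht)]; ring
  have c1 : AbsolutelyContinuousOnInterval (fun _ : ℝ => φ x) x y :=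
    ((LipschitzWith.const (φ x)).lipschitzOnWith).absolutelyContinuousOnInterval
  have e3 := c1.add (absolutelyContinuousOnInterval_integral_complex hi)
  constructor
  · rw [absolutelyContinuousOnInterval_iff] at e3 ⊢
    intro ε hε
    obtain ⟨δ, hδ, H⟩ := e3 ε hε
    refine ⟨δ, hδ, fun E hE hE' => ?_⟩
    convert H E hE hE' using 1
    refine Finset.sum_congr rfl fun i hi => ?_
    have hE1 := hE.1 i hi
    rw [eq _ hE1.1, eq _ hE1.2]
    rfl
  -- The integral formula is known only on `uIcc x y`, which is a neighbourhood of `t` only away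
  -- from its two end points.
  · have hne : ∀ᵐ t : ℝ, t ≠ min x y ∧ t ≠ max x y := by
      have h1 := (measure_singleton (μ := (volume : Measure ℝ)) (min x y))
      have h2 := (measure_singleton (μ := (volume : Measure ℝ)) (max x y))
      filter_upwards [compl_mem_ae_iff.2 h1, compl_mem_ae_iff.2 h2] with t a b using ⟨a, b⟩
    filter_upwards [hi.ae_hasDerivAt_integral, hne] with t ht hne htm
    have := (ht htm x left_mem_uIcc).const_add (φ x)
    refine this.congr_of_eventuallyEq ?_
    have : uIcc x y ∈ 𝓝 t := Icc_mem_nhds (lt_of_le_of_ne htm.1 hne.1.symm)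
      (lt_of_le_of_ne htm.2 hne.2)
    filter_upwards [this] with s hs using eq s hs

lemma continuousOn (hJ : Itv J) (h : Prim J φ φ') : ContinuousOn φ J :=
  Itv.continuousOn_of_uIcc fun _ hx _ hy => (h.ac hJ hx hy).1.continuousOn

/-- The difference of `φ` and the integral of `φ'` is absolutely continuous with derivative zero
almost everywhere, hence constant. -/
lemma of_ac (hJ : Itv J) (hl : LocallyIntegrableOn φ' J)
    (h : ∀ x ∈ J, ∀ y ∈ J, AbsolutelyContinuousOnInterval φ x y ∧
      ∀ᵐ t, t ∈ uIcc x y → HasDerivAt φ (φ' t) t) : Prim J φ φ' := by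
  refine ⟨hl, fun x hx y hy => ?_⟩
  have hi := hJ.intervalIntegrable hl hx hy
  obtain ⟨h1, h2⟩ := h x hx y hy
  have h3 := h1.sub (absolutelyContinuousOnInterval_integral_complex hi)
  obtain ⟨C, hC⟩ := h3.const_of_ae_hasDerivAt_zero (by
    filter_upwards [h2, hi.ae_hasDerivAt_integral] with t ht ht' htm
    simpa using (ht htm).sub (ht' htm x left_mem_uIcc))
  have e1 := hC x left_mem_uIcc
  have e2 := hC y right_mem_uIcc
  simp only [Pi.sub_apply, intervalIntegral.integral_same] at e1 e2
  linear_combination e2 - e1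

lemma congr (hJ : Itv J) (h : Prim J φ φ') (h1 : ∀ x ∈ J, ψ x = φ x)
    (h2 : ∀ᵐ x ∂(volume.restrict J), ψ' x = φ' x) : Prim J ψ ψ' := by
  have h2' := (ae_restrict_iff' hJ.measurableSet).1 h2
  constructor
  · intro x hx
    obtain ⟨t, ht, hti⟩ := h.loc x hx
    refine ⟨t ∩ J, inter_mem ht self_mem_nhdsWithin, ?_⟩
    refine (hti.mono_set inter_subset_left).congr_fun_ae ?_
    have := ae_mono (Measure.restrict_mono (inter_subset_right (s := t) (t := J)) le_rfl) h2
    filter_upwards [this] with x hx using hx.symm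
  · intro x hx y hy
    rw [h1 x hx, h1 y hy, h.sub_eq x hx y hy]
    refine intervalIntegral.integral_congr_ae ?_
    filter_upwards [h2'] with t ht htm
    exact (ht (hJ.uIoc_subset hx hy htm)).symm

lemma congr' (hJ : Itv J) (h : Prim J φ φ') (h1 : ∀ x ∈ J, ψ x = φ x)
    (h2 : ∀ x ∈ J, ψ' x = φ' x) : Prim J ψ ψ' :=
  h.congr hJ h1 (ae_restrict_of_forall_mem hJ.measurableSet h2)

lemma mono {K : Set ℝ} (h : Prim J φ φ') (hK : K ⊆ J) : Prim K φ φ' :=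
  ⟨h.loc.mono_set hK, fun x hx y hy => h.sub_eq x (hK hx) y (hK hy)⟩

lemma const (c : ℂ) : Prim J (fun _ => c) (fun _ => 0) :=
  ⟨fun _ _ => ⟨univ, univ_mem, integrableOn_zero⟩, by simp⟩

lemma add (hJ : Itv J) (h : Prim J φ φ') (k : Prim J ψ ψ') :
    Prim J (fun x => φ x + ψ x) (fun x => φ' x + ψ' x) := by
  refine ⟨h.loc.add k.loc, fun x hx y hy => ?_⟩
  rw [intervalIntegral.integral_add (h.intervalIntegrable hJ hx hy)
    (k.intervalIntegrable hJ hx hy), ← h.sub_eq x hx y hy, ← k.sub_eq x hx y hy]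
  ring

lemma mul (hJ : Itv J) (h : Prim J φ φ') (k : Prim J ψ ψ') :
    Prim J (fun x => φ x * ψ x) (fun x => φ' x * ψ x + φ x * ψ' x) := by
  refine of_ac hJ ((h.loc.mul_continuousOn (k.continuousOn hJ) hJ.lc).add
    (k.loc.continuousOn_mul (h.continuousOn hJ) hJ.lc)) fun x hx y hy => ?_
  obtain ⟨a1, d1⟩ := h.ac hJ hx hy
  obtain ⟨a2, d2⟩ := k.ac hJ hx hy
  refine ⟨a1.smul a2, ?_⟩
  filter_upwards [d1, d2] with t h1 h2 ht
  exact (h1 ht).mul (h2 ht)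

lemma const_mul (hJ : Itv J) (c : ℂ) (h : Prim J φ φ') :
    Prim J (fun x => c * φ x) (fun x => c * φ' x) :=
  ((const c).mul hJ h).congr' hJ (fun _ _ => rfl) (fun _ _ => by simp)

lemma neg (hJ : Itv J) (h : Prim J φ φ') : Prim J (fun x => - φ x) (fun x => - φ' x) :=
  (h.const_mul hJ (-1)).congr' hJ (fun _ _ => by simp) (fun _ _ => by simp)

lemma sub (hJ : Itv J) (h : Prim J φ φ') (k : Prim J ψ ψ') :
    Prim J (fun x => φ x - ψ x) (fun x => φ' x - ψ' x) :=
  (h.add hJ (k.neg hJ)).congr' hJ (fun _ _ => by ring) (fun _ _ => by ring)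

lemma star (h : Prim J φ φ') :
    Prim J (fun x => (starRingEnd ℂ) (φ x)) (fun x => (starRingEnd ℂ) (φ' x)) := by
  refine ⟨?_, fun x hx y hy => ?_⟩
  · intro x hx
    obtain ⟨t, ht, hti⟩ := h.loc x hx
    exact ⟨t, ht, by
      simpa [IntegrableOn] using ((Complex.conjCLE : ℂ →L[ℝ] ℂ).integrable_comp hti :
        Integrable _ (volume.restrict t))⟩
  · rw [← map_sub, h.sub_eq x hx y hy]
    simp only [intervalIntegral, map_sub, integral_conj]

lemma inv (hJ : Itv J) (h : Prim J φ φ') (hne : ∀ x ∈ J, φ x ≠ 0) :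
    Prim J (fun x => (φ x)⁻¹) (fun x => - φ' x / φ x ^ 2) := by
  have hc := h.continuousOn hJ
  have hl : LocallyIntegrableOn (fun x => - φ' x / φ x ^ 2) J := by
    have : ContinuousOn (fun x => - (φ x ^ 2)⁻¹) J :=
      ((hc.pow 2).inv₀ (fun x hx => pow_ne_zero _ (hne x hx))).neg
    refine (h.loc.continuousOn_mul this hJ.lc).congr ?_
    exact Eventually.of_forall fun x => by simp only []; ring
  refine of_ac hJ hl fun x hx y hy => ?_
  obtain ⟨a1, d1⟩ := h.ac hJ hx hy
  constructor
  · have hK := hJ.uIcc_subset hx hy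
    -- `C` bounds `1/φ`, so inversion is Lipschitz with constant `C²` along the values of `φ`; the
    -- added `1` below keeps the constant positive.
    obtain ⟨C, hC⟩ := isCompact_uIcc.exists_bound_of_continuousOn
      ((hc.inv₀ hne).mono hK)
    have hC0 : 0 ≤ C := (norm_nonneg _).trans (hC x left_mem_uIcc)
    rw [absolutelyContinuousOnInterval_iff] at a1 ⊢
    intro ε hε
    obtain ⟨δ, hδ, H⟩ := a1 (ε / (C * C + 1)) (by positivity)
    refine ⟨δ, hδ, fun E hE hE' => ?_⟩
    have := H E hE hE'
    have hb : ∑ i ∈ Finset.range E.1, dist (φ (E.2 i).1)⁻¹ (φ (E.2 i).2)⁻¹ ≤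
        (C * C + 1) * ∑ i ∈ Finset.range E.1, dist (φ (E.2 i).1) (φ (E.2 i).2) := by
      rw [Finset.mul_sum]
      refine Finset.sum_le_sum fun i hi => ?_
      have m := hE.1 i hi
      have n1 := hne _ (hK m.1)
      have n2 := hne _ (hK m.2)
      rw [dist_comm (φ _), dist_eq_norm, dist_eq_norm, inv_sub_inv n1 n2, div_eq_mul_inv, mul_inv,
        norm_mul, norm_mul, mul_comm]
      gcongr
      exact (mul_le_mul (hC _ m.1) (hC _ m.2) (norm_nonneg _) hC0).trans (by linarith)
    calc _ ≤ _ := hb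
      _ < (C * C + 1) * (ε / (C * C + 1)) := by gcongr
      _ = ε := by field_simp
  · filter_upwards [d1] with t h1 ht
    exact (h1 ht).inv (hne t (hJ.uIcc_subset hx hy ht))

end Prim

end DiracDC

namespace DiracDC

/-! ### Algebra of spinors -/

/-- Componentwise complex conjugation. -/
noncomputable def cj (v : C2) : C2 := WithLp.toLp 2 fun i => (starRingEnd ℂ) (v i)

@[simp] lemma cj_apply (v : C2) (i : Fin 2) : cj v i = (starRingEnd ℂ) (v i) := rfl

lemma C2.ext {v w : C2} (h0 : v 0 = w 0) (h1 : v 1 = w 1) : v = w := by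
  ext i; fin_cases i <;> assumption

lemma norm_sq_eq (v : C2) : ‖v‖ ^ 2 = ‖v 0‖ ^ 2 + ‖v 1‖ ^ 2 := by
  rw [EuclideanSpace.norm_sq_eq, Fin.sum_univ_two]

lemma norm_apply_le (v : C2) (i : Fin 2) : ‖v i‖ ≤ ‖v‖ := by
  have := norm_sq_eq v
  refine abs_le_of_sq_le_sq' ?_ (norm_nonneg _) |>.2
  fin_cases i <;> simp <;> nlinarith [sq_nonneg ‖v 0‖, sq_nonneg ‖v 1‖]

@[simp] lemma norm_cj (v : C2) : ‖cj v‖ = ‖v‖ := by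
  have h : ‖cj v‖ ^ 2 = ‖v‖ ^ 2 := by rw [norm_sq_eq, norm_sq_eq]; simp
  exact (sq_eq_sq₀ (norm_nonneg _) (norm_nonneg _)).1 h

@[simp] lemma cj_cj (v : C2) : cj (cj v) = v := C2.ext (by simp) (by simp)

lemma cj_eq_self {v : C2} (h : ∀ i, (v i).im = 0) : cj v = v :=
  C2.ext (Complex.conj_eq_iff_im.2 (h 0)) (Complex.conj_eq_iff_im.2 (h 1))

/-- `bil` has no conjugation; conjugating one argument turns it into the inner product and makes
Cauchy–Schwarz available. -/
lemma bil_eq_inner (f g : C2) : bil f g = inner ℂ (cj f) g := by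
  simp [bil, PiLp.inner_apply, Fin.sum_univ_two]; ring

lemma norm_bil_le (f g : C2) : ‖bil f g‖ ≤ ‖f‖ * ‖g‖ := by
  rw [bil_eq_inner]
  simpa using norm_inner_le_norm (𝕜 := ℂ) (cj f) g

lemma norm_W_le (f g : C2) : ‖W f g‖ ≤ ‖f‖ * ‖g‖ := by
  -- Rotating `g` by a right angle turns the Wronskian into `bil` without changing the norm.
  set g' : C2 := WithLp.toLp 2 ![g 1, - g 0]
  have h1 : W f g = bil f g' := by simp [W, bil, g']; ring
  have h2 : ‖g'‖ = ‖g‖ := by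
    have h : ‖g'‖ ^ 2 = ‖g‖ ^ 2 := by rw [norm_sq_eq, norm_sq_eq]; simp [g']; ring
    exact (sq_eq_sq₀ (norm_nonneg _) (norm_nonneg _)).1 h
  rw [h1, ← h2]; exact norm_bil_le _ _

lemma bil_self_cj (f : C2) : bil f (cj f) = ((‖f‖ ^ 2 : ℝ) : ℂ) := by
  rw [norm_sq_eq]
  simp [bil, Complex.mul_conj, Complex.normSq_eq_norm_sq]

lemma bil_comm (f g : C2) : bil f g = bil g f := by simp [bil]; ring

lemma cj_bil (f g : C2) : (starRingEnd ℂ) (bil f g) = bil (cj f) (cj g) := by simp [bil]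

lemma cj_W (f g : C2) : (starRingEnd ℂ) (W f g) = W (cj f) (cj g) := by simp [W]

/-- The Plücker identity expressing `u` through `f` and `g`. -/
lemma plucker (u f g : C2) : W f g • u = W u g • f - W u f • g :=
  C2.ext (by simp [W]; ring) (by simp [W]; ring)

/-! ### The differential expression -/

namespace Potential

variable (q : Potential)

/-- `A`, `B`, `D` are the entries of the symmetric matrix `Q`: upper diagonal, off-diagonal, lower
diagonal. -/
noncomputable def A (x : ℝ) : ℂ := ((q.qel x + (q.m + q.qsc x) : ℝ) : ℂ)
noncomputable def B (x : ℝ) : ℂ := (q.qam x : ℂ)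
noncomputable def D (x : ℝ) : ℂ := ((q.qel x - (q.m + q.qsc x) : ℝ) : ℂ)

end Potential

/-- Solves `τf = g` for the derivative. With `tau_iff` this turns every statement about `τ` into two
scalar primitives. -/
lemma tau_pointwise (q : Potential) (x : ℝ) (f f' g : C2) :
    g = Matrix.toEuclideanLin ((1 / Complex.I) • sigma2) f' + Matrix.toEuclideanLin (q.Q x) f ↔
    f' 0 = g 1 - q.B x * f 0 - q.D x * f 1 ∧ f' 1 = q.A x * f 0 + q.B x * f 1 - g 0 := by
  have h : Matrix.toEuclideanLin ((1 / Complex.I) • sigma2) f' + Matrix.toEuclideanLin (q.Q x) f =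
      WithLp.toLp 2 ![- f' 1 + q.A x * f 0 + q.B x * f 1, f' 0 + q.B x * f 0 + q.D x * f 1] := by
    refine C2.ext ?_ ?_
    · simp [Matrix.toLpLin_apply, dotProduct, Fin.sum_univ_two, sigma1, sigma2,
        sigma3, Potential.Q, Potential.A, Potential.B]
      ring
    · simp [Matrix.toLpLin_apply, dotProduct, Fin.sum_univ_two, sigma1, sigma2,
        sigma3, Potential.Q, Potential.D, Potential.B]
      ring
  rw [h]
  constructor
  · intro h
    rw [h]
    constructor <;> simp <;> ring
  · rintro ⟨h0, h1⟩
    refine C2.ext ?_ ?_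
    · simp [h1]; ring
    · simp [h0]; ring

/-- The coordinate functionals. -/
noncomputable def C2.coord (i : Fin 2) : C2 →L[ℂ] ℂ := EuclideanSpace.proj i

@[simp] lemma C2.coord_apply (i : Fin 2) (v : C2) : C2.coord i v = v i := rfl

lemma hasACDeriv_iff {J : Set ℝ} (hJ : Itv J) {f f' : ℝ → C2} :
    HasACDeriv J f f' ↔ Prim J (fun x => f x 0) (fun x => f' x 0) ∧
      Prim J (fun x => f x 1) (fun x => f' x 1) := by
  constructor
  · rintro ⟨h1, h2⟩
    have key : ∀ i : Fin 2, Prim J (fun x => f x i) (fun x => f' x i) := by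
      intro i
      refine ⟨fun x hx => ?_, fun x hx y hy => ?_⟩
      · obtain ⟨t, ht, hti⟩ := h1 x hx
        exact ⟨t, ht, (C2.coord i).integrable_comp hti⟩
      · have := congrArg (C2.coord i) (h2 x hx y hy)
        rw [← ContinuousLinearMap.intervalIntegral_comp_comm _
          (hJ.intervalIntegrable h1 hx hy)] at this
        simpa using this
    exact ⟨key 0, key 1⟩
  · rintro ⟨h0, h1⟩
    set e0 : C2 := EuclideanSpace.single 0 1
    set e1 : C2 := EuclideanSpace.single 1 1
    have dec : ∀ v : C2, v = v 0 • e0 + v 1 • e1 := fun v =>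
      C2.ext (by simp [e0, e1]) (by simp [e0, e1])
    have l0 : LocallyIntegrableOn (fun x => f' x 0 • e0) J := fun x hx => by
      obtain ⟨t, ht, hti⟩ := h0.loc x hx
      exact ⟨t, ht, hti.smul_const e0⟩
    have l1 : LocallyIntegrableOn (fun x => f' x 1 • e1) J := fun x hx => by
      obtain ⟨t, ht, hti⟩ := h1.loc x hx
      exact ⟨t, ht, hti.smul_const e1⟩
    have hf' : f' = fun x => f' x 0 • e0 + f' x 1 • e1 := funext fun x => dec (f' x)
    refine ⟨by rw [hf']; exact l0.add l1, fun x hx y hy => ?_⟩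
    rw [hf', intervalIntegral.integral_add (hJ.intervalIntegrable l0 hx hy)
      (hJ.intervalIntegrable l1 hx hy), intervalIntegral.integral_smul_const,
      intervalIntegral.integral_smul_const, ← h0.sub_eq x hx y hy, ← h1.sub_eq x hx y hy,
      dec (f y - f x)]
    simp

lemma tau_iff {q : Potential} {J : Set ℝ} (hJ : Itv J) {f g : ℝ → C2} :
    q.Tau J f g ↔
      Prim J (fun x => f x 0) (fun x => g x 1 - q.B x * f x 0 - q.D x * f x 1) ∧
      Prim J (fun x => f x 1) (fun x => q.A x * f x 0 + q.B x * f x 1 - g x 0) := by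
  constructor
  · rintro ⟨f', h, hae⟩
    obtain ⟨h0, h1⟩ := (hasACDeriv_iff hJ).1 h
    constructor
    · refine h0.congr hJ (fun _ _ => rfl) ?_
      filter_upwards [hae] with x hx using ((tau_pointwise q x _ _ _).1 hx).1.symm
    · refine h1.congr hJ (fun _ _ => rfl) ?_
      filter_upwards [hae] with x hx using ((tau_pointwise q x _ _ _).1 hx).2.symm
  · rintro ⟨h0, h1⟩
    refine ⟨fun x => WithLp.toLp 2 ![g x 1 - q.B x * f x 0 - q.D x * f x 1,
      q.A x * f x 0 + q.B x * f x 1 - g x 0], (hasACDeriv_iff hJ).2 ⟨by simpa using h0,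
      by simpa using h1⟩, Eventually.of_forall fun x => (tau_pointwise q x _ _ _).2 (by simp)⟩

lemma C2.continuousOn_iff {J : Set ℝ} {f : ℝ → C2} :
    ContinuousOn f J ↔ ContinuousOn (fun x => f x 0) J ∧ ContinuousOn (fun x => f x 1) J := by
  constructor
  · intro h
    exact ⟨(C2.coord 0).continuous.comp_continuousOn h,
      (C2.coord 1).continuous.comp_continuousOn h⟩
  · rintro ⟨h0, h1⟩
    have : ContinuousOn (fun x => (WithLp.ofLp (f x))) J := by
      refine continuousOn_pi.2 fun i => ?_
      fin_cases i <;> assumption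
    exact (PiLp.continuous_toLp 2 _).comp_continuousOn this

namespace Potential.Tau

variable {q : Potential} {J : Set ℝ} {f g h l k : ℝ → C2}

lemma continuousOn (hJ : Itv J) (H : q.Tau J f g) : ContinuousOn f J := by
  obtain ⟨h0, h1⟩ := (tau_iff hJ).1 H
  exact C2.continuousOn_iff.2 ⟨h0.continuousOn hJ, h1.continuousOn hJ⟩

lemma mono {K : Set ℝ} (H : q.Tau J f g) (hK : K ⊆ J) : q.Tau K f g := by
  obtain ⟨f', h, hae⟩ := H
  exact ⟨f', ⟨h.1.mono_set hK, fun x hx y hy => h.2 x (hK hx) y (hK hy)⟩,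
    ae_mono (Measure.restrict_mono hK le_rfl) hae⟩

lemma congr_ae (H : q.Tau J f g) (h : k =ᵐ[volume.restrict J] g) : q.Tau J f k := by
  obtain ⟨f', hf', hae⟩ := H
  refine ⟨f', hf', ?_⟩
  filter_upwards [hae, h] with x hx hk using hk.trans hx

lemma congr (hJ : Itv J) (H : q.Tau J f g) (h1 : ∀ x ∈ J, l x = f x)
    (h2 : k =ᵐ[volume.restrict J] g) : q.Tau J l k := by
  refine congr_ae ?_ h2
  obtain ⟨h0, h1'⟩ := (tau_iff hJ).1 H
  exact (tau_iff hJ).2 ⟨h0.congr' hJ (fun x hx => by rw [h1 x hx]) (fun x hx => by rw [h1 x hx]),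
    h1'.congr' hJ (fun x hx => by rw [h1 x hx]) (fun x hx => by rw [h1 x hx])⟩

lemma congr' (hJ : Itv J) (H : q.Tau J f g) (h1 : ∀ x ∈ J, l x = f x)
    (h2 : ∀ x ∈ J, k x = g x) : q.Tau J l k :=
  H.congr hJ h1 (ae_restrict_of_forall_mem hJ.measurableSet h2)

lemma add (hJ : Itv J) (H : q.Tau J f h) (K : q.Tau J l k) :
    q.Tau J (fun x => f x + l x) (fun x => h x + k x) := by
  obtain ⟨h0, h1⟩ := (tau_iff hJ).1 H
  obtain ⟨k0, k1⟩ := (tau_iff hJ).1 K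
  exact (tau_iff hJ).2
    ⟨(h0.add hJ k0).congr' hJ (fun _ _ => by simp) (fun _ _ => by simp; ring),
     (h1.add hJ k1).congr' hJ (fun _ _ => by simp) (fun _ _ => by simp; ring)⟩

lemma const_smul (hJ : Itv J) (c : ℂ) (H : q.Tau J f h) :
    q.Tau J (fun x => c • f x) (fun x => c • h x) := by
  obtain ⟨h0, h1⟩ := (tau_iff hJ).1 H
  exact (tau_iff hJ).2
    ⟨(h0.const_mul hJ c).congr' hJ (fun _ _ => by simp) (fun _ _ => by simp; ring),
     (h1.const_mul hJ c).congr' hJ (fun _ _ => by simp) (fun _ _ => by simp; ring)⟩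

lemma sub (hJ : Itv J) (H : q.Tau J f h) (K : q.Tau J l k) :
    q.Tau J (fun x => f x - l x) (fun x => h x - k x) :=
  (H.add hJ (K.const_smul hJ (-1))).congr' hJ (fun _ _ => by simp [sub_eq_add_neg])
    (fun _ _ => by simp [sub_eq_add_neg])

lemma conj (hJ : Itv J) (H : q.Tau J f h) :
    q.Tau J (fun x => cj (f x)) (fun x => cj (h x)) := by
  obtain ⟨h0, h1⟩ := (tau_iff hJ).1 H
  exact (tau_iff hJ).2
    ⟨h0.star.congr' hJ (fun _ _ => by simp)
      (fun _ _ => by simp [Potential.B, Potential.D]),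
     h1.star.congr' hJ (fun _ _ => by simp)
      (fun _ _ => by simp [Potential.A, Potential.B])⟩

/-- The Lagrange identity. -/
lemma lagrange (hJ : Itv J) (H : q.Tau J f h) (K : q.Tau J l k) :
    Prim J (fun x => W (f x) (l x)) (fun x => bil (h x) (l x) - bil (f x) (k x)) := by
  obtain ⟨h0, h1⟩ := (tau_iff hJ).1 H
  obtain ⟨k0, k1⟩ := (tau_iff hJ).1 K
  exact ((h0.mul hJ k1).sub hJ (h1.mul hJ k0)).congr' hJ (fun _ _ => rfl)
    (fun _ _ => by simp [bil]; ring)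

end Potential.Tau

/-! ### The double commutation transformation -/

/-- The potentials `q` and `q'` are related by double commutation with the solution `u` of
`τ u = λ u`, `c` being a primitive of `uᵀ u`. -/
structure DC (q q' : Potential) (J : Set ℝ) (lam : ℂ) (u : ℝ → C2) (c : ℝ → ℂ) : Prop where
  tau : q.Tau J u (fun x => lam • u x)
  prim : Prim J c (fun x => bil (u x) (u x))
  ne : ∀ x ∈ J, c x ≠ 0
  relA : ∀ x ∈ J, q'.A x = q.A x - 2 * (u x 0 * u x 1) / c x
  relB : ∀ x ∈ J, q'.B x = q.B x + (u x 0 ^ 2 - u x 1 ^ 2) / c x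
  relD : ∀ x ∈ J, q'.D x = q.D x + 2 * (u x 0 * u x 1) / c x

namespace DC

variable {q q' : Potential} {J : Set ℝ} {lam : ℂ} {u f h : ℝ → C2} {c g : ℝ → ℂ}

/-- The central identity. Differentiating `g/c` produces terms in `uᵀf` and `uᵀu`; the change of
potential is exactly what absorbs them, leaving only a multiple of `u`. No eigenvalue equation for
`f` is needed. -/
lemma intertwine (hJ : Itv J) (H : DC q q' J lam u c) (hf : q.Tau J f h)
    (hg : Prim J g (fun x => bil (u x) (f x))) :
    q'.Tau J (fun x => f x - (g x / c x) • u x)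
      (fun x => h x - ((lam * g x - W (u x) (f x)) / c x) • u x) := by
  obtain ⟨h0, h1⟩ := (tau_iff hJ).1 hf
  obtain ⟨u0, u1⟩ := (tau_iff hJ).1 H.tau
  have hi := hg.mul hJ (H.prim.inv hJ H.ne)
  refine (tau_iff hJ).2 ⟨(h0.sub hJ (hi.mul hJ u0)).congr' hJ (fun x hx => ?_) (fun x hx => ?_),
    (h1.sub hJ (hi.mul hJ u1)).congr' hJ (fun x hx => ?_) (fun x hx => ?_)⟩
  · simp [div_eq_mul_inv]
  · have := H.ne x hx
    simp only [H.relB x hx, H.relD x hx, bil, W, PiLp.sub_apply, PiLp.smul_apply,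
      smul_eq_mul]
    field_simp
    ring
  · simp [div_eq_mul_inv]
  · have := H.ne x hx
    simp only [H.relA x hx, H.relB x hx, bil, W, PiLp.sub_apply, PiLp.smul_apply,
      smul_eq_mul]
    field_simp
    ring

lemma tau_div (hJ : Itv J) (H : DC q q' J lam u c) :
    q'.Tau J (fun x => (c x)⁻¹ • u x) (fun x => lam • (c x)⁻¹ • u x) := by
  -- For `f = u` any `c + const` is an admissible `g`; the constant `-1` leaves exactly `u/c`.
  refine (H.intertwine hJ (g := fun x => c x - 1) H.tau
    ((H.prim.sub hJ (Prim.const 1)).congr' hJ (fun _ _ => rfl) (fun _ _ => by simp))).congr' hJ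
    (fun x hx => ?_) (fun x hx => ?_)
  · have := H.ne x hx
    have e : (c x - 1) / c x = 1 - (c x)⁻¹ := by field_simp
    rw [e, sub_smul, one_smul, sub_sub_cancel]
  · have := H.ne x hx
    have e : (lam * (c x - 1) - W (u x) (u x)) / c x = lam - lam * (c x)⁻¹ := by
      simp [W]; field_simp; ring
    rw [e, sub_smul, sub_sub_cancel, mul_smul]

/-- The transformation inverts itself: `(-1/c)' = uᵀu/c² = (u/c)ᵀ(u/c)`, and quadratic expressions
in `u/c` divided by `-1/c` are those in `u` divided by `-c`, so the change of potential is undone.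
-/
lemma symm (hJ : Itv J) (H : DC q q' J lam u c) :
    DC q' q J lam (fun x => (c x)⁻¹ • u x) (fun x => - (c x)⁻¹) where
  tau := H.tau_div hJ
  prim := ((H.prim.inv hJ H.ne).neg hJ).congr' hJ (fun _ _ => rfl) (fun x hx => by
    have := H.ne x hx
    simp only [bil, PiLp.smul_apply, smul_eq_mul]; field_simp)
  ne x hx := neg_ne_zero.2 (inv_ne_zero (H.ne x hx))
  relA x hx := by
    have := H.ne x hx
    simp only [H.relA x hx, PiLp.smul_apply, smul_eq_mul]; field_simp; ring
  relB x hx := by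
    have := H.ne x hx
    simp only [H.relB x hx, PiLp.smul_apply, smul_eq_mul]; field_simp; ring
  relD x hx := by
    have := H.ne x hx
    simp only [H.relD x hx, PiLp.smul_apply, smul_eq_mul]; field_simp; ring

/-- Double commutation maps solutions to solutions. -/
lemma tau_sol (hJ : Itv J) (H : DC q q' J lam u c) {z : ℂ} (hz : z ≠ lam)
    (hf : q.Tau J f (fun x => z • f x)) :
    q'.Tau J (fun x => f x + (1 / (z - lam)) • (W (u x) (f x) • (c x)⁻¹ • u x))
      (fun x => z • (f x + (1 / (z - lam)) • (W (u x) (f x) • (c x)⁻¹ • u x))) := by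
  have hz' : z - lam ≠ 0 := sub_ne_zero.2 hz
  have hW := (H.tau.lagrange hJ hf).const_mul hJ (-1 / (z - lam))
  -- With this `g` one has `λg - W(u,f) = zg`, so the image is again an eigensolution for `z`.
  refine (H.intertwine hJ (g := fun x => -1 / (z - lam) * W (u x) (f x)) hf
    (hW.congr' hJ (fun _ _ => rfl) (fun x _ => ?_))).congr' hJ (fun x hx => ?_) (fun x hx => ?_)
  · simp only [bil, PiLp.smul_apply, smul_eq_mul]; field_simp; ring
  · have := H.ne x hx
    refine C2.ext ?_ ?_ <;> simp <;> field_simp <;> ring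
  · have := H.ne x hx
    refine C2.ext ?_ ?_ <;> simp <;> field_simp <;> ring

/-- The energy identity, for real `u` and `c`. -/
lemma energy (hJ : Itv J) (H : DC q q' J lam u c) (hu : ∀ x ∈ J, cj (u x) = u x)
    (hc : ∀ x ∈ J, (starRingEnd ℂ) (c x) = c x)
    (hg : Prim J g (fun x => bil (u x) (f x))) :
    Prim J (fun x => ((‖g x‖ ^ 2 : ℝ) : ℂ) / c x)
      (fun x => ((‖f x‖ ^ 2 - ‖f x - (g x / c x) • u x‖ ^ 2 : ℝ) : ℂ)) := by
  have hi := (hg.mul hJ hg.star).mul hJ (H.prim.inv hJ H.ne)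
  refine hi.congr' hJ (fun x hx => ?_) (fun x hx => ?_)
  · rw [Complex.mul_conj, Complex.normSq_eq_norm_sq]; rfl
  · have h1 := H.ne x hx
    have h2 := hc x hx
    have h3 : (starRingEnd ℂ) (u x 0) = u x 0 := by rw [← cj_apply, hu x hx]
    have h4 : (starRingEnd ℂ) (u x 1) = u x 1 := by rw [← cj_apply, hu x hx]
    rw [Complex.ofReal_sub, ← bil_self_cj, ← bil_self_cj]
    simp only [bil, cj_apply, PiLp.sub_apply, PiLp.smul_apply, smul_eq_mul, map_sub, map_mul,
      map_div₀, h2, h3, h4, map_add]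
    field_simp
    ring

end DC

end DiracDC

/-! ### Endpoints of an interval and square integrability near them -/

namespace DiracDC

/-- An endpoint of the interval `I`: the filter `l` of neighbourhoods of the endpoint in `I`, and
for `c ∈ I` the open interval `S c` between the endpoint and `c`. -/
structure IsEnd (I : Set ℝ) (l : Filter ℝ) (S : ℝ → Set ℝ) : Prop where
  nonempty : I.Nonempty
  itv : Itv I
  neBot : l.NeBot
  cg : l.IsCountablyGenerated
  mem : ∀ c ∈ I, S c ∈ l
  sub : ∀ c ∈ I, S c ⊆ I
  nested : ∀ c ∈ I, ∀ x ∈ S c, S x ⊆ S c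
  ordS : ∀ c ∈ I, (S c).OrdConnected
  cover : ∀ c ∈ I, ∀ x ∈ S c, ∀ᶠ y in l, x ∈ uIoc c y
  cap : ∀ c ∈ I, ∀ c' ∈ I, S c' ⊆ S c ∪ uIcc c c'
  between : ∀ c ∈ I, ∀ y ∈ S c, uIcc c y ⊆ insert c (S c)
  not_mem : ∀ x ∈ I, ∀ᶠ y in l, x ∉ S y

lemma memLp_two_of_continuousOn_isCompact {f : ℝ → C2} {K : Set ℝ} (hK : IsCompact K)
    (hf : ContinuousOn f K) : MemLp f 2 (volume.restrict K) := by
  obtain ⟨C, hC⟩ := hK.exists_bound_of_continuousOn hf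
  have : IsFiniteMeasure (volume.restrict K) := ⟨by simpa using hK.measure_lt_top⟩
  exact MemLp.of_bound (hf.aestronglyMeasurable hK.measurableSet) C
    (ae_restrict_of_forall_mem hK.measurableSet hC)

section MemLp

variable {μ : Measure ℝ} {f g : ℝ → C2}

lemma memLp_apply (hf : MemLp f 2 μ) (i : Fin 2) : MemLp (fun x => f x i) 2 μ :=
  (C2.coord i).comp_memLp' hf

lemma continuous_cj : Continuous cj := by
  refine (PiLp.continuous_toLp 2 _).comp (continuous_pi fun i => ?_)
  exact Complex.continuous_conj.comp (C2.coord i).continuous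

lemma memLp_cj (hf : MemLp f 2 μ) : MemLp (fun x => cj (f x)) 2 μ := by
  refine hf.of_le (f := fun x => cj (f x)) ?_ (Eventually.of_forall fun x => by simp)
  exact continuous_cj.comp_aestronglyMeasurable hf.1

lemma integrable_bil (hf : MemLp f 2 μ) (hg : MemLp g 2 μ) :
    Integrable (fun x => bil (f x) (g x)) μ :=
  ((memLp_apply hf 0).integrable_mul (memLp_apply hg 0)).add
    ((memLp_apply hf 1).integrable_mul (memLp_apply hg 1))

lemma integrable_norm_mul_norm (hf : MemLp f 2 μ) (hg : MemLp g 2 μ) :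
    Integrable (fun x => ‖f x‖ * ‖g x‖) μ := hf.norm.integrable_mul hg.norm

/-- The Cauchy–Schwarz inequality. -/
lemma norm_integral_bil_sq_le (hf : MemLp f 2 μ) (hg : MemLp g 2 μ) :
    ‖∫ x, bil (f x) (g x) ∂μ‖ ^ 2 ≤ (∫ x, ‖f x‖ ^ 2 ∂μ) * ∫ x, ‖g x‖ ^ 2 ∂μ := by
  have h1 : ‖∫ x, bil (f x) (g x) ∂μ‖ ≤ ∫ x, ‖f x‖ * ‖g x‖ ∂μ :=
    (norm_integral_le_integral_norm _).trans
      (integral_mono (integrable_bil hf hg).norm (integrable_norm_mul_norm hf hg)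
        fun x => norm_bil_le _ _)
  have h2 := integral_mul_le_Lp_mul_Lq_of_nonneg (μ := μ) Real.HolderConjugate.two_two
    (f := fun x => ‖f x‖) (g := fun x => ‖g x‖) (Eventually.of_forall fun _ => norm_nonneg _)
    (Eventually.of_forall fun _ => norm_nonneg _) (by simpa using hf.norm) (by simpa using hg.norm)
  have e1 : 0 ≤ ∫ x, ‖f x‖ ^ 2 ∂μ := integral_nonneg fun _ => sq_nonneg _
  have e2 : 0 ≤ ∫ x, ‖g x‖ ^ 2 ∂μ := integral_nonneg fun _ => sq_nonneg _
  have h3 := pow_le_pow_left₀ (norm_nonneg _) (h1.trans h2) 2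
  refine h3.trans_eq ?_
  simp only [Real.rpow_two]
  rw [mul_pow, ← Real.sqrt_eq_rpow, ← Real.sqrt_eq_rpow, Real.sq_sqrt e1, Real.sq_sqrt e2]

end MemLp

namespace IsEnd

variable {I : Set ℝ} {l : Filter ℝ} {S : ℝ → Set ℝ}

lemma measS (E : IsEnd I l S) {c : ℝ} (hc : c ∈ I) : MeasurableSet (S c) :=
  (E.ordS c hc).measurableSet

lemma mem_I (E : IsEnd I l S) : I ∈ l := by
  obtain ⟨c, hc⟩ := E.nonempty
  exact mem_of_superset (E.mem c hc) (E.sub c hc)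

lemma exists_mem (E : IsEnd I l S) {p : ℝ → Prop} (h : ∀ᶠ x in l, p x) {c : ℝ} (hc : c ∈ I) :
    ∃ x ∈ S c, p x := by
  have := E.neBot
  obtain ⟨x, h1, h2⟩ := ((eventually_mem_set.2 (E.mem c hc)).and h).exists
  exact ⟨x, h1, h2⟩

/-- Dominated convergence: every fixed point eventually lies outside `S y`. -/
lemma tendsto_setIntegral (E : IsEnd I l S) {φ : ℝ → ℝ} {c : ℝ} (hc : c ∈ I)
    (h : IntegrableOn φ (S c)) : Tendsto (fun y => ∫ x in S y, φ x) l (𝓝 0) := by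
  have := E.cg
  have h1 : Tendsto (fun y => ∫ x in S c, (S y).indicator φ x) l (𝓝 (∫ x in S c, (0 : ℝ))) := by
    refine tendsto_integral_filter_of_dominated_convergence (fun x => ‖φ x‖) ?_ ?_ h.norm ?_
    · filter_upwards [E.mem_I] with y hy
      exact (h.1.indicator (E.measS hy))
    · exact Eventually.of_forall fun y => Eventually.of_forall fun x => norm_indicator_le_norm_self _ _
    · refine ae_restrict_of_forall_mem (E.measS hc) fun x hx => ?_
      refine tendsto_const_nhds.congr' ?_
      filter_upwards [E.not_mem x (E.sub c hc hx)] with y hy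
      rw [indicator_of_notMem hy]
  rw [integral_zero] at h1
  refine h1.congr' ?_
  filter_upwards [E.mem c hc] with y hy
  have hyI := E.sub c hc hy
  rw [setIntegral_indicator (E.measS hyI), inter_eq_right.2 (E.nested c hc y hy)]

lemma exists_setIntegral_le (E : IsEnd I l S) {φ : ℝ → ℝ} {c : ℝ} (hc : c ∈ I)
    (h : IntegrableOn φ (S c)) {ε : ℝ} (hε : 0 < ε) : ∃ y ∈ S c, ∫ x in S y, φ x ≤ ε :=
  E.exists_mem ((E.tendsto_setIntegral hc h).eventually_le_const hε) hc

lemma memLp_of_mem (E : IsEnd I l S) {f : ℝ → C2} (hf : ContinuousOn f I) {c c' : ℝ} (hc : c ∈ I)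
    (hc' : c' ∈ I) (h : MemLp f 2 (volume.restrict (S c))) :
    MemLp f 2 (volume.restrict (S c')) := by
  have hK : MemLp f 2 (volume.restrict (uIcc c c')) :=
    memLp_two_of_continuousOn_isCompact isCompact_uIcc (hf.mono (E.itv.uIcc_subset hc hc'))
  refine MemLp.mono_measure (Measure.restrict_mono (E.cap c hc c' hc') le_rfl) ?_
  refine (memLp_two_iff_integrable_sq_norm (aestronglyMeasurable_union_iff.2 ⟨h.1, hK.1⟩)).2 ?_
  exact IntegrableOn.union ((memLp_two_iff_integrable_sq_norm h.1).1 h)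
    ((memLp_two_iff_integrable_sq_norm hK.1).1 hK)

lemma uIoc_ae_le (E : IsEnd I l S) {c : ℝ} (hc : c ∈ I) {x y : ℝ} (hx : x ∈ S c) (hy : y ∈ S c) :
    uIoc x y ⊆ S c := uIoc_subset_uIcc.trans ((E.ordS c hc).uIcc_subset hx hy)

lemma norm_sub_le_setIntegral (E : IsEnd I l S) {φ φ' : ℝ → ℂ} (h : Prim I φ φ') {c : ℝ} (hc : c ∈ I)
    (hi : IntegrableOn φ' (S c)) {x y : ℝ} (hx : x ∈ S c) (hy : y ∈ S c) :
    ‖φ y - φ x‖ ≤ ∫ t in S c, ‖φ' t‖ := by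
  rw [h.sub_eq x (E.sub c hc hx) y (E.sub c hc hy)]
  refine intervalIntegral.norm_integral_le_integral_norm_uIoc.trans ?_
  exact setIntegral_mono_set hi.norm (Eventually.of_forall fun _ => norm_nonneg _)
    (E.uIoc_ae_le hc hx hy).eventuallyLE

/-- Cauchy's criterion: the oscillation of `φ` on `S y` is at most the integral of `|φ'|` there. -/
lemma exists_tendsto (E : IsEnd I l S) {φ φ' : ℝ → ℂ} (h : Prim I φ φ') {c : ℝ} (hc : c ∈ I)
    (hi : IntegrableOn φ' (S c)) : ∃ ω, Tendsto φ l (𝓝 ω) := by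
  have := E.neBot
  refine cauchy_map_iff_exists_tendsto.1 ?_
  rw [Metric.cauchy_iff]
  refine ⟨inferInstance, fun ε hε => ?_⟩
  obtain ⟨y, hy, hyε⟩ := E.exists_setIntegral_le hc hi.norm (half_pos hε)
  have hyI := E.sub c hc hy
  refine ⟨φ '' S y, image_mem_map (E.mem y hyI), ?_⟩
  rintro _ ⟨x, hx, rfl⟩ _ ⟨x', hx', rfl⟩
  rw [dist_eq_norm]
  have := E.norm_sub_le_setIntegral h hyI (hi.mono_set (E.nested c hc y hy)) hx' hx
  linarith

/-- The intervals between `c` and `y` exhaust `S c`, so a bound on the truncated integrals passes to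
the limit of the lower integrals. -/
lemma memLp_of_bound (E : IsEnd I l S) {f : ℝ → C2} (hf : ContinuousOn f I) {c K : ℝ} (hc : c ∈ I)
    (h : ∀ᶠ y in l, ∫ t in uIoc c y, ‖f t‖ ^ 2 ≤ K) : MemLp f 2 (volume.restrict (S c)) := by
  have := E.neBot
  have := E.cg
  have hm : AEStronglyMeasurable f (volume.restrict (S c)) :=
    (hf.mono (E.sub c hc)).aestronglyMeasurable (E.measS hc)
  rw [memLp_two_iff_integrable_sq_norm hm]
  have hm2 : AEStronglyMeasurable (fun x => ‖f x‖ ^ 2) (volume.restrict (S c)) := hm.norm.pow 2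
  have hm3 : AEMeasurable (fun x => ‖‖f x‖ ^ 2‖ₑ) (volume.restrict (S c)) := hm2.enorm
  refine ⟨hm2, ?_⟩
  have hcov : AECover (volume.restrict (S c)) l (fun y => uIoc c y) :=
    ⟨ae_restrict_of_forall_mem (E.measS hc) fun x hx => E.cover c hc x hx,
      fun y => measurableSet_uIoc⟩
  have hlim := hcov.lintegral_tendsto_of_countably_generated hm3
  have hle : ∫⁻ x in S c, ‖‖f x‖ ^ 2‖ₑ ≤ ENNReal.ofReal K := by
    refine le_of_tendsto hlim ?_
    filter_upwards [h, E.mem c hc] with y hy hyS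
    have hi : IntegrableOn (fun t => ‖f t‖ ^ 2) (uIoc c y) := by
      refine IntegrableOn.mono_set (t := uIcc c y) ?_ uIoc_subset_uIcc
      exact ((hf.mono (E.itv.uIcc_subset hc (E.sub c hc hyS))).norm.pow 2).integrableOn_compact
        isCompact_uIcc
    calc ∫⁻ x in uIoc c y, ‖‖f x‖ ^ 2‖ₑ ∂(volume.restrict (S c))
        ≤ ∫⁻ x in uIoc c y, ‖‖f x‖ ^ 2‖ₑ := by
          rw [Measure.restrict_restrict measurableSet_uIoc]
          exact lintegral_mono_set inter_subset_left
      _ = ENNReal.ofReal (∫ t in uIoc c y, ‖f t‖ ^ 2) := by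
          rw [← ofReal_integral_norm_eq_lintegral_enorm hi]
          simp
      _ ≤ ENNReal.ofReal K := ENNReal.ofReal_le_ofReal hy
  exact lt_of_le_of_lt hle ENNReal.ofReal_lt_top

/-- A linear system with small coefficients is controlled by its value at any one point. -/
lemma norm_add_norm_le_two_mul (E : IsEnd I l S) {α α' β β' : ℝ → ℂ} {κ : ℝ → ℝ} (hα : Prim I α α')
    (hβ : Prim I β β') {c : ℝ} (hc : c ∈ I) (hκ : IntegrableOn κ (S c))
    (hκ0 : ∀ x ∈ S c, 0 ≤ κ x)
    (hb : ∀ x ∈ S c, ‖α' x‖ + ‖β' x‖ ≤ κ x * (‖α x‖ + ‖β x‖)) (h2 : ∫ x in S c, κ x ≤ 1 / 2)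
    {x y : ℝ} (hx : x ∈ S c) (hy : y ∈ S c) :
    ‖α y‖ + ‖β y‖ ≤ 2 * (‖α x‖ + ‖β x‖) := by
  have hK : uIcc x y ⊆ S c := (E.ordS c hc).uIcc_subset hx hy
  have hcont : ContinuousOn (fun t => ‖α t‖ + ‖β t‖) (uIcc x y) :=
    (((hα.continuousOn E.itv).norm.add (hβ.continuousOn E.itv).norm).mono
      (hK.trans (E.sub c hc)))
  -- At the maximum `M` on the segment, the growth from `x` is at most `M/2`, hence `M` is at most
  -- twice the value at `x`.
  obtain ⟨t, ht, hmax⟩ := isCompact_uIcc.exists_isMaxOn nonempty_uIcc hcont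
  set M := ‖α t‖ + ‖β t‖ with hM
  have hM0 : 0 ≤ M := by positivity
  have hmax' : ∀ s ∈ uIcc x y, ‖α s‖ + ‖β s‖ ≤ M := fun s hs => hmax hs
  have hsub : uIoc x t ⊆ uIcc x y := uIoc_subset_uIcc.trans (uIcc_subset_uIcc left_mem_uIcc ht)
  have hxI := E.sub c hc hx
  have htI := E.sub c hc (hK ht)
  have ia := (intervalIntegrable_iff.1 (hα.intervalIntegrable E.itv hxI htI)).norm
  have ib := (intervalIntegrable_iff.1 (hβ.intervalIntegrable E.itv hxI htI)).norm
  have e1 : ‖α t - α x‖ ≤ ∫ s in uIoc x t, ‖α' s‖ := by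
    rw [hα.sub_eq x hxI t htI]; exact intervalIntegral.norm_integral_le_integral_norm_uIoc
  have e2 : ‖β t - β x‖ ≤ ∫ s in uIoc x t, ‖β' s‖ := by
    rw [hβ.sub_eq x hxI t htI]; exact intervalIntegral.norm_integral_le_integral_norm_uIoc
  have hκ' : IntegrableOn κ (uIoc x t) := hκ.mono_set (hsub.trans hK)
  have e3 : (∫ s in uIoc x t, ‖α' s‖) + ∫ s in uIoc x t, ‖β' s‖ ≤ (1 / 2) * M := by
    rw [← integral_add ia ib]
    calc ∫ s in uIoc x t, (‖α' s‖ + ‖β' s‖) ≤ ∫ s in uIoc x t, κ s * M := by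
          refine setIntegral_mono_on (ia.add ib) (hκ'.mul_const M) measurableSet_uIoc fun s hs => ?_
          have hs' := hsub hs
          exact (hb s (hK hs')).trans
            (mul_le_mul_of_nonneg_left (hmax' s hs') (hκ0 s (hK hs')))
      _ = (∫ s in uIoc x t, κ s) * M := integral_mul_const _ _
      _ ≤ (∫ s in S c, κ s) * M := by
          refine mul_le_mul_of_nonneg_right ?_ hM0
          exact setIntegral_mono_set hκ (ae_restrict_of_forall_mem (E.measS hc) hκ0)
            (hsub.trans hK).eventuallyLE
      _ ≤ (1 / 2) * M := by gcongr
  have n1 := norm_sub_norm_le (α t) (α x)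
  have n2 := norm_sub_norm_le (β t) (β x)
  have := hmax' y right_mem_uIcc
  linarith

end IsEnd

end DiracDC

/-! ### Weyl's alternative through limits of Wronskians -/

namespace DiracDC

namespace IsEnd

variable {I : Set ℝ} {l : Filter ℝ} {S : ℝ → Set ℝ}

lemma exists_tendsto_W (E : IsEnd I l S) {q : Potential} {f h f₂ h₂ : ℝ → C2} {c : ℝ} (hc : c ∈ I)
    (hf : q.Tau I f h) (hf₂ : q.Tau I f₂ h₂)
    (Lf : MemLp f 2 (volume.restrict (S c))) (Lh : MemLp h 2 (volume.restrict (S c)))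
    (Lf₂ : MemLp f₂ 2 (volume.restrict (S c))) (Lh₂ : MemLp h₂ 2 (volume.restrict (S c))) :
    ∃ ω, Tendsto (fun x => W (f x) (f₂ x)) l (𝓝 ω) :=
  E.exists_tendsto (hf.lagrange E.itv hf₂) hc ((integrable_bil Lh Lf₂).sub (integrable_bil Lf Lh₂))

/-- Two functions of the maximal domain with non-vanishing Wronskian at the endpoint control all
solutions near that endpoint. -/
lemma exists_le_of_W_tendsto (E : IsEnd I l S) {q : Potential} {f h f₂ h₂ u : ℝ → C2} {z ω : ℂ}
    {c : ℝ} (hc : c ∈ I) (hf : q.Tau I f h) (hf₂ : q.Tau I f₂ h₂)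
    (hu : q.Tau I u (fun x => z • u x))
    (Lf : MemLp f 2 (volume.restrict (S c))) (Lh : MemLp h 2 (volume.restrict (S c)))
    (Lf₂ : MemLp f₂ 2 (volume.restrict (S c))) (Lh₂ : MemLp h₂ 2 (volume.restrict (S c)))
    (hω : Tendsto (fun x => W (f x) (f₂ x)) l (𝓝 ω)) (hω0 : ω ≠ 0) :
    ∃ d ∈ S c, ∃ C : ℝ, 0 ≤ C ∧ ∀ x ∈ S d, ∀ y ∈ S d,
      ‖u y‖ ≤ C * (‖W (u x) (f₂ x)‖ + ‖W (u x) (f x)‖) * (‖f y‖ + ‖f₂ y‖) := by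
  -- Close enough to the endpoint `W(f, f₂)` is bounded below by `|ω|/2`, so `f` and `f₂` form a
  -- basis there with controlled inverse.
  have hpos : 0 < ‖ω‖ / 2 := by positivity
  have hev : ∀ᶠ x in l, ∀ y ∈ S x, ‖ω‖ / 2 ≤ ‖W (f y) (f₂ y)‖ := by
    obtain ⟨d, hd, hd'⟩ : ∃ d ∈ S c, ∀ y ∈ S d, ‖ω‖ / 2 ≤ ‖W (f y) (f₂ y)‖ := by
      have hi : IntegrableOn (fun x => bil (h x) (f₂ x) - bil (f x) (h₂ x)) (S c) :=
        (integrable_bil Lh Lf₂).sub (integrable_bil Lf Lh₂)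
      obtain ⟨d, hd, hdε⟩ := E.exists_setIntegral_le hc hi.norm hpos
      refine ⟨d, hd, fun y hy => ?_⟩
      have hdI := E.sub c hc hd
      have := E.neBot
      have h1 : ‖ω - W (f y) (f₂ y)‖ ≤ ‖ω‖ / 2 := by
        refine le_of_tendsto (hω.sub_const _).norm ?_
        filter_upwards [E.mem d hdI] with x hx
        exact (E.norm_sub_le_setIntegral (hf.lagrange E.itv hf₂) hdI (hi.mono_set (E.nested c hc d hd))
          hy hx).trans hdε
      have := norm_sub_norm_le ω (W (f y) (f₂ y))
      linarith
    filter_upwards [E.mem d (E.sub c hc hd)] with x hx y hy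
    exact hd' y (E.nested d (E.sub c hc hd) x hx hy)
  -- By the Plücker identity `u` is a combination of `f` and `f₂` with coefficients `W(u,f₂)` and
  -- `W(u,f)` divided by `W(f,f₂)`. These two Wronskians satisfy a linear system whose coefficients
  -- are bounded by the integrable `κ`.
  set κ : ℝ → ℝ := fun x => (‖ω‖ / 2)⁻¹ * ((‖f x‖ + ‖f₂ x‖) * ((‖z • f x - h x‖ +
    ‖z • f₂ x - h₂ x‖))) with hκ
  have Lk : MemLp (fun x => z • f x - h x) 2 (volume.restrict (S c)) := (Lf.const_smul z).sub Lh
  have Lk₂ : MemLp (fun x => z • f₂ x - h₂ x) 2 (volume.restrict (S c)) :=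
    (Lf₂.const_smul z).sub Lh₂
  have hκi : IntegrableOn κ (S c) :=
    ((Lf.norm.add Lf₂.norm).integrable_mul (Lk.norm.add Lk₂.norm)).const_mul _
  have hκ0 : ∀ x, 0 ≤ κ x := fun x => by positivity
  obtain ⟨d, hd, hd1, hd2⟩ := E.exists_mem (hev.and
    ((E.tendsto_setIntegral hc hκi).eventually_le_const (half_pos one_pos))) hc
  have hdI := E.sub c hc hd
  have hdsub := E.nested c hc d hd
  refine ⟨d, hd, (‖ω‖ / 2)⁻¹ * 2, by positivity, fun x hx y hy => ?_⟩
  have hα := hu.lagrange E.itv hf₂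
  have hβ := hu.lagrange E.itv hf
  have bound : ∀ t ∈ S d, ‖u t‖ ≤ (‖ω‖ / 2)⁻¹ * ((‖f t‖ + ‖f₂ t‖) *
      (‖W (u t) (f₂ t)‖ + ‖W (u t) (f t)‖)) := by
    intro t ht
    have h1 := hd1 t ht
    have h2 : ‖W (f t) (f₂ t)‖ * ‖u t‖ ≤ (‖f t‖ + ‖f₂ t‖) *
      (‖W (u t) (f₂ t)‖ + ‖W (u t) (f t)‖) := by
      rw [← norm_smul, plucker (u t)]
      refine (norm_sub_le _ _).trans ?_
      rw [norm_smul, norm_smul]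
      nlinarith [norm_nonneg (f t), norm_nonneg (f₂ t), norm_nonneg (W (u t) (f₂ t)),
        norm_nonneg (W (u t) (f t)), mul_nonneg (norm_nonneg (f t)) (norm_nonneg (W (u t) (f t))),
        mul_nonneg (norm_nonneg (f₂ t)) (norm_nonneg (W (u t) (f₂ t)))]
    rw [inv_mul_eq_div, le_div_iff₀ hpos, mul_comm]
    exact (mul_le_mul_of_nonneg_right h1 (norm_nonneg _)).trans h2
  have hb : ∀ t ∈ S d, ‖bil (z • u t) (f₂ t) - bil (u t) (h₂ t)‖ +
      ‖bil (z • u t) (f t) - bil (u t) (h t)‖ ≤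
      κ t * (‖W (u t) (f₂ t)‖ + ‖W (u t) (f t)‖) := by
    intro t ht
    have e1 : bil (z • u t) (f₂ t) - bil (u t) (h₂ t) = bil (u t) (z • f₂ t - h₂ t) := by
      simp [bil]; ring
    have e2 : bil (z • u t) (f t) - bil (u t) (h t) = bil (u t) (z • f t - h t) := by
      simp [bil]; ring
    rw [e1, e2]
    calc _ ≤ ‖u t‖ * ‖z • f₂ t - h₂ t‖ + ‖u t‖ * ‖z • f t - h t‖ :=
          add_le_add (norm_bil_le _ _) (norm_bil_le _ _)
      _ = ‖u t‖ * (‖z • f t - h t‖ + ‖z • f₂ t - h₂ t‖) := by ring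
      _ ≤ ((‖ω‖ / 2)⁻¹ * ((‖f t‖ + ‖f₂ t‖) *
      (‖W (u t) (f₂ t)‖ + ‖W (u t) (f t)‖))) * (‖z • f t - h t‖ + ‖z • f₂ t - h₂ t‖) := by
          gcongr; exact bound t ht
      _ = _ := by simp only [hκ]; ring
  have h3 := E.norm_add_norm_le_two_mul hα hβ hdI (hκi.mono_set hdsub) (fun x _ => hκ0 x) hb hd2 hx hy
  calc ‖u y‖ ≤ (‖ω‖ / 2)⁻¹ * ((‖f y‖ + ‖f₂ y‖) * (‖W (u y) (f₂ y)‖ + ‖W (u y) (f y)‖)) := bound y hy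
    _ ≤ (‖ω‖ / 2)⁻¹ * ((‖f y‖ + ‖f₂ y‖) * (2 * (‖W (u x) (f₂ x)‖ + ‖W (u x) (f x)‖))) := by gcongr
    _ = _ := by ring

/-- `f` is square integrable near the endpoint. -/
def L2Near (I : Set ℝ) (S : ℝ → Set ℝ) (f : ℝ → C2) : Prop :=
  ∃ c ∈ I, MemLp f 2 (volume.restrict (S c))

/-- `f` and its image under `τ` are square integrable near the endpoint. -/
def InMax (q : Potential) (I : Set ℝ) (S : ℝ → Set ℝ) (f : ℝ → C2) : Prop :=
  ∃ h, q.Tau I f h ∧ L2Near I S f ∧ L2Near I S h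

lemma L2Near.common (E : IsEnd I l S) {f g : ℝ → C2} (hf : L2Near I S f) (hg : L2Near I S g) :
    ∃ c ∈ I, MemLp f 2 (volume.restrict (S c)) ∧ MemLp g 2 (volume.restrict (S c)) := by
  obtain ⟨c, hc, Lf⟩ := hf
  obtain ⟨d, hd, Lg⟩ := hg
  obtain ⟨x, hx, hx'⟩ := E.exists_mem (E.mem d hd) hc
  exact ⟨x, E.sub c hc hx, Lf.mono_measure (Measure.restrict_mono (E.nested c hc x hx) le_rfl),
    Lg.mono_measure (Measure.restrict_mono (E.nested d hd x hx') le_rfl)⟩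

lemma InMax.common (E : IsEnd I l S) {q : Potential} {f f₂ : ℝ → C2} (hf : InMax q I S f)
    (hf₂ : InMax q I S f₂) : ∃ h h₂, ∃ c ∈ I, q.Tau I f h ∧ q.Tau I f₂ h₂ ∧
      MemLp f 2 (volume.restrict (S c)) ∧ MemLp h 2 (volume.restrict (S c)) ∧
      MemLp f₂ 2 (volume.restrict (S c)) ∧ MemLp h₂ 2 (volume.restrict (S c)) := by
  obtain ⟨h, hh, L1, L2⟩ := hf
  obtain ⟨h₂, hh₂, L3, L4⟩ := hf₂
  obtain ⟨c, hc, M1, M2⟩ := L1.common E L2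
  obtain ⟨d, hd, M3, M4⟩ := L3.common E L4
  obtain ⟨x, hx, hx'⟩ := E.exists_mem (E.mem d hd) hc
  have e1 := Measure.restrict_mono (μ := volume) (E.nested c hc x hx) le_rfl
  have e2 := Measure.restrict_mono (μ := volume) (E.nested d hd x hx') le_rfl
  exact ⟨h, h₂, x, E.sub c hc hx, hh, hh₂, M1.mono_measure e1, M2.mono_measure e1,
    M3.mono_measure e2, M4.mono_measure e2⟩

/-- If the Wronskian of two functions of the maximal domain does not vanish at the endpoint, all
solutions are square integrable near the endpoint. -/
lemma L2Near_of_not_tendsto (E : IsEnd I l S) {q : Potential} {f f₂ u : ℝ → C2} {z : ℂ}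
    (hf : InMax q I S f) (hf₂ : InMax q I S f₂) (hu : q.Tau I u (fun x => z • u x))
    (hW : ¬ Tendsto (fun x => W (f x) (f₂ x)) l (𝓝 0)) : L2Near I S u := by
  obtain ⟨h, h₂, c, hc, hh, hh₂, L1, L2, L3, L4⟩ := hf.common E hf₂
  obtain ⟨ω, hω⟩ := E.exists_tendsto_W hc hh hh₂ L1 L2 L3 L4
  have hω0 : ω ≠ 0 := by rintro rfl; exact hW hω
  obtain ⟨d, hd, C, hC, H⟩ := E.exists_le_of_W_tendsto hc hh hh₂ hu L1 L2 L3 L4 hω hω0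
  have hdI := E.sub c hc hd
  obtain ⟨x, hx, -⟩ := E.exists_mem (E.mem_I) hdI
  have e1 := Measure.restrict_mono (μ := volume) (E.nested c hc d hd) le_rfl
  refine ⟨d, hdI, ((L1.norm.add L3.norm).mono_measure e1).of_le_mul
    (c := C * (‖W (u x) (f₂ x)‖ + ‖W (u x) (f x)‖))
    (((hu.continuousOn E.itv).mono (E.sub d hdI)).aestronglyMeasurable (E.measS hdI)) ?_⟩
  refine ae_restrict_of_forall_mem (E.measS hdI) fun y hy => ?_
  refine (H x hx y hy).trans_eq ?_
  simp only [Pi.add_apply]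
  rw [Real.norm_of_nonneg (by positivity)]

/-- If `W(u, f)` and `W(u, f₂)` vanish at the endpoint for a solution `u` which does not vanish
near it, so does `W(f, f₂)`. -/
lemma tendsto_W_zero (E : IsEnd I l S) {q : Potential} {f f₂ u : ℝ → C2} {z : ℂ}
    (hf : InMax q I S f) (hf₂ : InMax q I S f₂) (hu : q.Tau I u (fun x => z • u x))
    (hu0 : ∀ x ∈ I, u x ≠ 0) (h1 : Tendsto (fun x => W (u x) (f x)) l (𝓝 0))
    (h2 : Tendsto (fun x => W (u x) (f₂ x)) l (𝓝 0)) :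
    Tendsto (fun x => W (f x) (f₂ x)) l (𝓝 0) := by
  obtain ⟨h, h₂, c, hc, hh, hh₂, L1, L2, L3, L4⟩ := hf.common E hf₂
  obtain ⟨ω, hω⟩ := E.exists_tendsto_W hc hh hh₂ L1 L2 L3 L4
  by_cases hω0 : ω = 0
  · rwa [hω0] at hω
  exfalso
  -- With `y` fixed and `x` tending to the endpoint, the right side of the estimate tends to zero
  -- and forces `u y = 0`.
  obtain ⟨d, hd, C, hC, H⟩ := E.exists_le_of_W_tendsto hc hh hh₂ hu L1 L2 L3 L4 hω hω0
  have hdI := E.sub c hc hd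
  obtain ⟨y, hy, -⟩ := E.exists_mem (E.mem_I) hdI
  refine hu0 y (E.sub d hdI hy) ?_
  have hlim : Tendsto (fun x => C * (‖W (u x) (f₂ x)‖ + ‖W (u x) (f x)‖) * (‖f y‖ + ‖f₂ y‖)) l
      (𝓝 (C * (‖(0 : ℂ)‖ + ‖(0 : ℂ)‖) * (‖f y‖ + ‖f₂ y‖))) :=
    ((h2.norm.add h1.norm).const_mul C).mul_const _
  have := E.neBot
  have h3 : ‖u y‖ ≤ C * (‖(0 : ℂ)‖ + ‖(0 : ℂ)‖) * (‖f y‖ + ‖f₂ y‖) := by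
    refine ge_of_tendsto hlim ?_
    filter_upwards [E.mem d hdI] with x hx using H x hx y hy
  simpa using h3

end IsEnd

/-! ### The endpoints of a Dirac operator -/

namespace DiracOp

variable (H : DiracOp)

lemma itv_I : Itv H.I := by
  have h : H.I = (fun x : ℝ => (x : EReal)) ⁻¹' Ioo H.a H.b := rfl
  constructor
  · rw [h]
    exact OrdConnected.preimage_mono (ordConnected_Ioo) EReal.coe_strictMono.monotone
  · rw [h]
    exact (isOpen_Ioo.preimage continuous_coe_real_ereal).isLocallyClosed

lemma isOpen_I : IsOpen H.I := by
  have h : H.I = (fun x : ℝ => (x : EReal)) ⁻¹' Ioo H.a H.b := rfl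
  rw [h]
  exact isOpen_Ioo.preimage continuous_coe_real_ereal

lemma leftClosed_subset {c : ℝ} (hc : c ∈ H.I) : H.leftClosed c ⊆ H.I :=
  fun _ hx => ⟨hx.1, (EReal.coe_le_coe_iff.2 hx.2).trans_lt hc.2⟩

lemma leftClosed_eq {c : ℝ} (hc : c ∈ H.I) : H.leftClosed c = H.I ∩ Iic c :=
  Subset.antisymm (fun _ hx => ⟨H.leftClosed_subset hc hx, hx.2⟩) fun _ hx => ⟨hx.1.1, hx.2⟩

lemma itv_leftClosed {c : ℝ} (hc : c ∈ H.I) : Itv (H.leftClosed c) := by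
  rw [H.leftClosed_eq hc]
  exact ⟨H.itv_I.ord.inter ordConnected_Iic, H.itv_I.lc.inter isClosed_Iic.isLocallyClosed⟩

variable {H}

lemma nonempty_I (h : H.a < H.b) : H.I.Nonempty := by
  obtain ⟨x, h1, h2⟩ := EReal.lt_iff_exists_real_btwn.1 h
  exact ⟨x, h1, h2⟩

lemma isEnd_atA (h : H.a < H.b) : IsEnd H.I H.atA H.leftOpen := by
  have hb : H.atA.HasBasis (fun d : EReal => H.a < d) fun d => (fun x : ℝ => (x : EReal)) ⁻¹'
      Ioo H.a d := (nhdsGT_basis_of_exists_gt ⟨_, h⟩).comap _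
  have hmem : ∀ c : ℝ, H.a < c → H.leftOpen c ∈ H.atA := fun c hc => by
    refine mem_of_superset (hb.mem_of_mem hc) fun x hx => ⟨hx.1, EReal.coe_lt_coe_iff.1 hx.2⟩
  have hord : ∀ c, (H.leftOpen c).OrdConnected := fun c => by
    have : H.leftOpen c = (fun x : ℝ => (x : EReal)) ⁻¹' Ioo H.a c := by
      ext x; simp [leftOpen]
    rw [this]
    exact OrdConnected.preimage_mono (ordConnected_Ioo) EReal.coe_strictMono.monotone
  have hsub : ∀ c ∈ H.I, H.leftOpen c ⊆ H.I := fun c hc x hx =>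
    ⟨hx.1, (EReal.coe_lt_coe_iff.2 hx.2).trans hc.2⟩
  refine ⟨nonempty_I h, H.itv_I, ?_, ?_, fun c hc => hmem c hc.1, hsub, ?_, fun c _ => hord c, ?_,
    ?_, ?_, ?_⟩
  · refine hb.neBot_iff.2 fun {d} hd => ?_
    obtain ⟨x, h1, h2⟩ := EReal.lt_iff_exists_real_btwn.1 hd
    exact ⟨x, h1, h2⟩
  · unfold atA; infer_instance
  · exact fun c _ x hx y hy => ⟨hy.1, hy.2.trans hx.2⟩
  · intro c _ x hx
    filter_upwards [hmem x hx.1] with y hy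
    rw [uIoc_of_ge (hy.2.trans hx.2).le]
    exact ⟨hy.2, hx.2.le⟩
  · intro c hc c' _ x hx
    by_cases hxc : x < c
    · exact Or.inl ⟨hx.1, hxc⟩
    · exact Or.inr (Icc_subset_uIcc ⟨not_lt.1 hxc, hx.2.le⟩)
  · intro c _ y hy x hx
    rw [uIcc_of_ge hy.2.le] at hx
    rcases hx.2.eq_or_lt with e | e
    · exact Or.inl e
    · exact Or.inr ⟨hy.1.trans_le (EReal.coe_le_coe_iff.2 hx.1), e⟩
  · intro x hx
    filter_upwards [hmem x hx.1] with y hy hy'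
    exact lt_asymm hy.2 hy'.2

lemma isEnd_atB (h : H.a < H.b) : IsEnd H.I H.atB H.rightOpen := by
  have hb : H.atB.HasBasis (fun d : EReal => d < H.b) fun d => (fun x : ℝ => (x : EReal)) ⁻¹'
      Ioo d H.b := (nhdsLT_basis_of_exists_lt ⟨_, h⟩).comap _
  have hmem : ∀ c : ℝ, (c : EReal) < H.b → H.rightOpen c ∈ H.atB := fun c hc => by
    refine mem_of_superset (hb.mem_of_mem hc) fun x hx => ⟨EReal.coe_lt_coe_iff.1 hx.1, hx.2⟩
  have hord : ∀ c, (H.rightOpen c).OrdConnected := fun c => by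
    have : H.rightOpen c = (fun x : ℝ => (x : EReal)) ⁻¹' Ioo c H.b := by
      ext x; simp [rightOpen]
    rw [this]
    exact OrdConnected.preimage_mono (ordConnected_Ioo) EReal.coe_strictMono.monotone
  have hsub : ∀ c ∈ H.I, H.rightOpen c ⊆ H.I := fun c hc x hx =>
    ⟨hc.1.trans (EReal.coe_lt_coe_iff.2 hx.1), hx.2⟩
  refine ⟨nonempty_I h, H.itv_I, ?_, ?_, fun c hc => hmem c hc.2, hsub, ?_, fun c _ => hord c, ?_,
    ?_, ?_, ?_⟩
  · refine hb.neBot_iff.2 fun {d} hd => ?_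
    obtain ⟨x, h1, h2⟩ := EReal.lt_iff_exists_real_btwn.1 hd
    exact ⟨x, h1, h2⟩
  · unfold atB; infer_instance
  · exact fun c _ x hx y hy => ⟨hx.1.trans hy.1, hy.2⟩
  · intro c _ x hx
    filter_upwards [hmem x hx.2] with y hy
    rw [uIoc_of_le (hx.1.trans hy.1).le]
    exact ⟨hx.1, hy.1.le⟩
  · intro c hc c' _ x hx
    by_cases hxc : c < x
    · exact Or.inl ⟨hxc, hx.2⟩
    · exact Or.inr (Icc_subset_uIcc' ⟨hx.1.le, not_lt.1 hxc⟩)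
  · intro c _ y hy x hx
    rw [uIcc_of_le hy.1.le] at hx
    rcases hx.1.eq_or_lt with e | e
    · exact Or.inl e.symm
    · exact Or.inr ⟨e, (EReal.coe_le_coe_iff.2 hx.2).trans_lt hy.2⟩
  · intro x hx
    filter_upwards [hmem x hx.2] with y hy hy'
    exact lt_asymm hy.1 hy'.1

end DiracOp

end DiracDC

/-! ### Consequences of the boundary conditions, and fundamental systems -/

namespace DiracDC

lemma W_self (f : C2) : W f f = 0 := by simp only [W]; ring

lemma W_swap (f g : C2) : W g f = - W f g := by simp only [W]; ring

lemma W_smul_right (c : ℂ) (f g : C2) : W f (c • g) = c * W f g := by simp [W]; ring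

lemma W_smul_left (c : ℂ) (f g : C2) : W (c • f) g = c * W f g := by simp [W]; ring

lemma W_add_right (f g h : C2) : W f (g + h) = W f g + W f h := by simp [W]; ring

lemma W_sub_right (f g h : C2) : W f (g - h) = W f g - W f h := by simp [W]; ring

lemma eq_of_W_eq_one {θ φ : C2} (h : W θ φ = 1) (u : C2) : u = W u φ • θ + W θ u • φ := by
  have := plucker u θ φ
  rw [h, one_smul, W_swap θ u] at this
  rwa [neg_smul, sub_neg_eq_add] at this

/-! ### Vanishing of Wronskians at an endpoint -/

namespace IsEnd

variable {I : Set ℝ} {l : Filter ℝ} {S : ℝ → Set ℝ}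

/-- A non-zero limit would put the endpoint in the limit circle case. There both functions satisfy
the condition generated by the non-vanishing solution `w`, and this again forces the limit to be
zero. -/
lemma tendsto_W_zero_of_bc (E : IsEnd I l S) {q : Potential} {f f₂ w : ℝ → C2} {LC : Prop}
    (hLC : LC ↔ ∀ (z : ℂ) (u : ℝ → C2), q.Tau I u (fun x => z • u x) → L2Near I S u)
    (hw : LC → (∃ μ : ℂ, q.Tau I w (fun x => μ • w x)) ∧ ∀ x ∈ I, w x ≠ 0)
    (hf : InMax q I S f) (hf₂ : InMax q I S f₂)
    (h1 : LC → Tendsto (fun x => W (w x) (f x)) l (𝓝 0))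
    (h2 : LC → Tendsto (fun x => W (w x) (f₂ x)) l (𝓝 0)) :
    Tendsto (fun x => W (f x) (f₂ x)) l (𝓝 0) := by
  by_contra hW
  have lc : LC := hLC.2 fun z u hu => E.L2Near_of_not_tendsto hf hf₂ hu hW
  obtain ⟨⟨μ, hμ⟩, hw0⟩ := hw lc
  exact hW (E.tendsto_W_zero hf hf₂ hμ hw0 (h1 lc) (h2 lc))

lemma InMax.of_sol {q : Potential} {f : ℝ → C2} {z : ℂ}
    (hf : q.Tau I f (fun x => z • f x)) (h : L2Near I S f) : InMax q I S f := by
  obtain ⟨c, hc, hL⟩ := h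
  exact ⟨_, hf, ⟨c, hc, hL⟩, ⟨c, hc, hL.const_smul z⟩⟩

/-- The boundary condition at the endpoint may be checked on any non-vanishing solution which
satisfies it. -/
lemma tendsto_W_bc (E : IsEnd I l S) {q : Potential} {f u w : ℝ → C2} {LC : Prop} {z : ℂ}
    (hLC : LC ↔ ∀ (z : ℂ) (u : ℝ → C2), q.Tau I u (fun x => z • u x) → L2Near I S u)
    (hw : LC → ∃ μ : ℂ, q.Tau I w (fun x => μ • w x))
    (hu : q.Tau I u (fun x => z • u x)) (hu0 : ∀ x ∈ I, u x ≠ 0)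
    (hf : InMax q I S f)
    (h1 : LC → Tendsto (fun x => W (w x) (u x)) l (𝓝 0))
    (h2 : LC → Tendsto (fun x => W (u x) (f x)) l (𝓝 0)) (lc : LC) :
    Tendsto (fun x => W (w x) (f x)) l (𝓝 0) := by
  obtain ⟨μ, hμ⟩ := hw lc
  refine E.tendsto_W_zero (InMax.of_sol hμ (hLC.1 lc μ w hμ)) hf hu hu0 ?_ (h2 lc)
  have := (h1 lc).neg
  simp only [neg_zero] at this
  exact this.congr fun x => (W_swap _ _).symm

lemma L2Near.memLp (E : IsEnd I l S) {f : ℝ → C2} (hf : ContinuousOn f I) (h : L2Near I S f)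
    {c : ℝ} (hc : c ∈ I) : MemLp f 2 (volume.restrict (S c)) := by
  obtain ⟨d, hd, hL⟩ := h
  exact E.memLp_of_mem hf hd hc hL

end IsEnd

namespace DiracOp

variable {H : DiracOp} {Θ Φ : ℂ → ℝ → C2} {u v f g : ℝ → C2} {z : ℂ}

lemma Sol.tau (h : H.Sol z u) : H.pot.Tau H.I u (fun x => z • u x) := h

lemma Sol.continuousOn (h : H.Sol z u) : ContinuousOn u H.I := h.tau.continuousOn H.itv_I

lemma Sol.W_eq (hu : H.Sol z u) (hv : H.Sol z v) {x y : ℝ} (hx : x ∈ H.I) (hy : y ∈ H.I) :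
    W (u x) (v x) = W (u y) (v y) := by
  have h := (hu.tau.lagrange H.itv_I hv).sub_eq x hx y hy
  have e : ∀ t, bil (z • u t) (v t) - bil (u t) (z • v t) = 0 := fun t => by simp [bil]; ring
  simp only [e, intervalIntegral.integral_zero] at h
  exact (sub_eq_zero.1 h).symm

lemma Sol.smul (h : H.Sol z u) (c : ℂ) : H.Sol z (fun x => c • u x) :=
  (h.tau.const_smul H.itv_I c).congr' H.itv_I (fun _ _ => rfl) fun _ _ => smul_comm _ _ _

lemma Sol.add (h : H.Sol z u) (h' : H.Sol z v) : H.Sol z (fun x => u x + v x) :=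
  (h.tau.add H.itv_I h').congr' H.itv_I (fun _ _ => rfl) fun _ _ => smul_add _ _ _

lemma Sol.conj (h : H.Sol z u) : H.Sol ((starRingEnd ℂ) z) (fun x => cj (u x)) :=
  (h.tau.conj H.itv_I).congr' H.itv_I (fun _ _ => rfl) fun x _ =>
    C2.ext (by simp) (by simp)

section System

variable (hs : H.IsRealEntireSystem Θ Φ)
include hs

lemma IsRealEntireSystem.sol_eq (hu : H.Sol z u) {x y : ℝ} (hx : x ∈ H.I) (hy : y ∈ H.I) :
    u y = W (u x) (Φ z x) • Θ z y + W (Θ z x) (u x) • Φ z y := by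
  rw [hu.W_eq (hs.phi.sol z) hx hy, (hs.theta.sol z).W_eq hu hx hy]
  exact eq_of_W_eq_one (hs.wronskian z y hy) (u y)

lemma IsRealEntireSystem.sol_ne_zero (hu : H.Sol z u) (h : ∃ x ∈ H.I, u x ≠ 0) :
    ∀ x ∈ H.I, u x ≠ 0 := by
  obtain ⟨y, hy, hne⟩ := h
  intro x hx h0
  refine hne ?_
  rw [hs.sol_eq hu hx hy, h0]
  simp [W]

lemma IsRealEntireSystem.phi_ne_zero {x : ℝ} (hx : x ∈ H.I) : Φ z x ≠ 0 :=
  hs.sol_ne_zero (hs.phi.sol z) (hs.phi_nontrivial z) x hx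

lemma IsRealEntireSystem.bc_spec {w : ℝ → C2} (h : H.IsBoundaryFunction w) :
    (∃ μ : ℂ, H.pot.Tau H.I w (fun x => μ • w x)) ∧ ∀ x ∈ H.I, w x ≠ 0 := by
  obtain ⟨⟨μ, hμ⟩, -, hne⟩ := h
  exact ⟨⟨μ, hμ⟩, hs.sol_ne_zero hμ hne⟩

lemma IsRealEntireSystem.tendsto_W_atA (hH : H.IsDirac) (hf : H.InDomA f) (hg : H.InDomA g) :
    Tendsto (fun x => W (f x) (g x)) H.atA (𝓝 0) := by
  obtain ⟨f', h1, h2, h3, h4⟩ := hf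
  obtain ⟨g', k1, k2, k3, k4⟩ := hg
  exact (isEnd_atA hH.lt).tendsto_W_zero_of_bc (LC := H.LimitCircleA) Iff.rfl
    (fun lc => hs.bc_spec (hH.bcA lc)) ⟨f', h1, h2, h3⟩ ⟨g', k1, k2, k3⟩ h4 k4

lemma IsRealEntireSystem.tendsto_W_atB (hH : H.IsDirac) (hf : H.InDomB f) (hg : H.InDomB g) :
    Tendsto (fun x => W (f x) (g x)) H.atB (𝓝 0) := by
  obtain ⟨f', h1, h2, h3, h4⟩ := hf
  obtain ⟨g', k1, k2, k3, k4⟩ := hg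
  exact (isEnd_atB hH.lt).tendsto_W_zero_of_bc (LC := H.LimitCircleB) Iff.rfl
    (fun lc => hs.bc_spec (hH.bcB lc)) ⟨f', h1, h2, h3⟩ ⟨g', k1, k2, k3⟩ h4 k4

/-- In the basis `Θ, Φ` the coefficient of `Θ` is `W(u,Φ)`; this is constant on the interval and
tends to zero at `a`. -/
lemma IsRealEntireSystem.eq_smul_phi (hH : H.IsDirac) (hu : H.Sol z u) (ha : H.InDomA u) :
    ∃ α : ℂ, ∀ x ∈ H.I, u x = α • Φ z x := by
  obtain ⟨x0, hx0⟩ := nonempty_I hH.lt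
  have hlim := hs.tendsto_W_atA hH ha (hs.phi_dom z)
  have hE := isEnd_atA hH.lt
  have := hE.neBot
  have hconst : Tendsto (fun x => W (u x) (Φ z x)) H.atA (𝓝 (W (u x0) (Φ z x0))) := by
    refine tendsto_const_nhds.congr' ?_
    filter_upwards [hE.mem_I] with x hx using hu.W_eq (hs.phi.sol z) hx0 hx
  have h0 := tendsto_nhds_unique hlim hconst
  refine ⟨W (Θ z x0) (u x0), fun x hx => ?_⟩
  rw [hs.sol_eq hu hx0 hx, ← h0, zero_smul, zero_add]

end System

lemma InDomA.conj (hH : H.IsDirac) (hf : H.InDomA f) : H.InDomA (fun x => cj (f x)) := by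
  obtain ⟨g, h1, ⟨c, hc, L1⟩, ⟨d, hd, L2⟩, h4⟩ := hf
  refine ⟨_, h1.conj H.itv_I, ⟨c, hc, memLp_cj L1⟩, ⟨d, hd, memLp_cj L2⟩, fun lc => ?_⟩
  have h := (Complex.continuous_conj.tendsto 0).comp (h4 lc)
  rw [map_zero] at h
  refine h.congr' ?_
  filter_upwards [(isEnd_atA hH.lt).mem_I] with x hx
  simp only [Function.comp, cj_W]
  rw [cj_eq_self ((hH.bcA lc).2.1 x hx)]

lemma BCA.add (hf : H.BCA f) (hg : H.BCA g) : H.BCA (fun x => f x + g x) := fun lc => by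
  have := (hf lc).add (hg lc)
  rw [zero_add] at this
  exact this.congr fun x => (W_add_right _ _ _).symm

lemma BCA.smul (hf : H.BCA f) (c : ℂ) : H.BCA (fun x => c • f x) := fun lc => by
  have := (hf lc).const_mul c
  rw [mul_zero] at this
  exact this.congr fun x => (W_smul_right _ _ _).symm

lemma BCA.congr (hH : H.IsDirac) (hf : H.BCA f) {c : ℝ} (hc : c ∈ H.I)
    (h : ∀ x ∈ H.leftOpen c, g x = f x) : H.BCA g := fun lc => by
  refine (hf lc).congr' ?_
  filter_upwards [(isEnd_atA hH.lt).mem c hc] with x hx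
  rw [h x hx]

lemma BCB.smul (hf : H.BCB f) (c : ℂ) : H.BCB (fun x => c • f x) := fun lc => by
  have := (hf lc).const_mul c
  rw [mul_zero] at this
  exact this.congr fun x => (W_smul_right _ _ _).symm

lemma InDomB.smul (hf : H.InDomB f) (c : ℂ) : H.InDomB (fun x => c • f x) := by
  obtain ⟨g, h1, ⟨d, hd, L1⟩, ⟨e, he, L2⟩, h4⟩ := hf
  exact ⟨_, h1.const_smul H.itv_I c, ⟨d, hd, L1.const_smul c⟩, ⟨e, he, L2.const_smul c⟩, h4.smul c⟩

lemma InDomB.congr (hH : H.IsDirac) (hf : H.InDomB f) (h : ∀ x ∈ H.I, g x = f x) : H.InDomB g := by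
  obtain ⟨k, h1, ⟨d, hd, L1⟩, h3, h4⟩ := hf
  have hE := isEnd_atB hH.lt
  refine ⟨k, h1.congr' H.itv_I h (fun _ _ => rfl), ⟨d, hd, L1.ae_eq ?_⟩, h3, fun lc => ?_⟩
  · exact ae_restrict_of_forall_mem (hE.measS hd) fun x hx => (h x (hE.sub d hd hx)).symm
  · refine (h4 lc).congr' ?_
    filter_upwards [hE.mem_I] with x hx
    rw [h x hx]

/-! ### Integrals from the left endpoint -/

lemma prim_integral_leftOpen (hab : H.a < H.b) {φ : ℝ → ℂ} (hl : LocallyIntegrableOn φ H.I)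
    (hi : ∀ c ∈ H.I, IntegrableOn φ (H.leftOpen c)) :
    Prim H.I (fun x => ∫ t in H.leftOpen x, φ t) φ := by
  have hE := isEnd_atA hab
  have key : ∀ x ∈ H.I, ∀ y ∈ H.I, x ≤ y →
      (∫ t in H.leftOpen y, φ t) - ∫ t in H.leftOpen x, φ t = ∫ t in x..y, φ t := by
    intro x hx y hy hxy
    have hd : H.leftOpen y \ H.leftOpen x = Ico x y := by
      ext t
      exact ⟨fun h => ⟨not_lt.1 fun h' => h.2 ⟨h.1.1, h'⟩, h.1.2⟩,
        fun h => ⟨⟨hx.1.trans_le (EReal.coe_le_coe_iff.2 h.1), h.2⟩, fun h' => h.1.not_gt h'.2⟩⟩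
    rw [intervalIntegral.integral_of_le hxy, integral_Ioc_eq_integral_Ioo,
      ← integral_Ico_eq_integral_Ioo, ← hd,
      setIntegral_sdiff (hE.measS hx) (hi y hy) fun t ht => ⟨ht.1, ht.2.trans_le hxy⟩]
  refine ⟨hl, fun x hx y hy => ?_⟩
  rcases le_total x y with h | h
  · exact key x hx y hy h
  · rw [intervalIntegral.integral_symm, ← key y hy x hx h]; ring

lemma tendsto_integral_leftOpen (hab : H.a < H.b) {φ : ℝ → ℂ} {c : ℝ} (hc : c ∈ H.I)
    (hi : IntegrableOn φ (H.leftOpen c)) :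
    Tendsto (fun x => ∫ t in H.leftOpen x, φ t) H.atA (𝓝 0) :=
  squeeze_zero_norm (fun _ => norm_integral_le_integral_norm _)
    ((isEnd_atA hab).tendsto_setIntegral hc hi.norm)

/-- A primitive vanishing at the left endpoint is the integral from that endpoint. -/
lemma eq_of_prim_of_tendsto (hab : H.a < H.b) {φ ψ χ : ℝ → ℂ} {ω : ℂ} (h1 : Prim H.I φ χ)
    (h2 : Prim H.I ψ χ) (l1 : Tendsto φ H.atA (𝓝 ω)) (l2 : Tendsto ψ H.atA (𝓝 ω)) {x : ℝ}
    (hx : x ∈ H.I) : φ x = ψ x := by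
  have hE := isEnd_atA hab
  have := hE.neBot
  have h3 : Tendsto (fun y => φ y - ψ y) H.atA (𝓝 (φ x - ψ x)) := by
    refine tendsto_const_nhds.congr' ?_
    filter_upwards [hE.mem_I] with y hy
    have e1 := h1.sub_eq x hx y hy
    have e2 := h2.sub_eq x hx y hy
    linear_combination e2 - e1
  have := tendsto_nhds_unique h3 (l1.sub l2)
  rw [sub_self] at this
  exact sub_eq_zero.1 this

end DiracOp

end DiracDC

/-! ### Square integrability and boundary behaviour of the transform near `b` -/

namespace DiracDC

lemma cj_real_smul {v : C2} (h : cj v = v) (r : ℝ) : cj ((r : ℂ) • v) = (r : ℂ) • v := by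
  refine C2.ext ?_ ?_
  · have := congrArg (fun w : C2 => w 0) h
    simp only [cj_apply] at this
    simp [this]
  · have := congrArg (fun w : C2 => w 1) h
    simp only [cj_apply] at this
    simp [this]

lemma bil_self_of_real {v : C2} (h : cj v = v) : bil v v = ((‖v‖ ^ 2 : ℝ) : ℂ) := by
  conv_lhs => rw [← h]
  rw [h, ← bil_self_cj, h]

namespace DC

variable {q q' : Potential} {lam : ℂ} {u f : ℝ → C2} {c : ℝ → ℝ} {g : ℝ → ℂ}

section
variable {J : Set ℝ}

lemma sub_eq (D : DC q q' J lam u (fun x => (c x : ℂ))) (hJ : Itv J)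
    (hu : ∀ x ∈ J, cj (u x) = u x) {x y : ℝ} (hx : x ∈ J) (hy : y ∈ J) :
    c y - c x = ∫ t in x..y, ‖u t‖ ^ 2 := by
  have h := D.prim.sub_eq x hx y hy
  have e : ∫ t in x..y, bil (u t) (u t) = ∫ t in x..y, ((‖u t‖ ^ 2 : ℝ) : ℂ) :=
    intervalIntegral.integral_congr fun t ht =>
      bil_self_of_real (hu t (hJ.uIcc_subset hx hy ht))
  rw [e, intervalIntegral.integral_ofReal] at h
  exact_mod_cast h

lemma monotoneOn (D : DC q q' J lam u (fun x => (c x : ℂ))) (hJ : Itv J)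
    (hu : ∀ x ∈ J, cj (u x) = u x) : MonotoneOn c J := fun x hx y hy hxy => by
  have := D.sub_eq hJ hu hx hy
  have h2 : 0 ≤ ∫ t in x..y, ‖u t‖ ^ 2 :=
    intervalIntegral.integral_nonneg hxy fun _ _ => sq_nonneg _
  linarith

lemma energy_integral (D : DC q q' J lam u (fun x => (c x : ℂ))) (hJ : Itv J)
    (hu : ∀ x ∈ J, cj (u x) = u x) (hg : Prim J g (fun x => bil (u x) (f x)))
    (hf : ContinuousOn f J)
    {x y : ℝ} (hx : x ∈ J) (hy : y ∈ J) :
    ∫ t in x..y, ‖f t - (g t / c t) • u t‖ ^ 2 =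
      (∫ t in x..y, ‖f t‖ ^ 2) - ‖g y‖ ^ 2 / c y + ‖g x‖ ^ 2 / c x := by
  have h := (D.energy hJ hu (fun _ _ => Complex.conj_ofReal _) hg).sub_eq x hx y hy
  rw [intervalIntegral.integral_ofReal] at h
  have h' : ‖g y‖ ^ 2 / c y - ‖g x‖ ^ 2 / c x =
      ∫ t in x..y, (‖f t‖ ^ 2 - ‖f t - (g t / c t) • u t‖ ^ 2) := by exact_mod_cast h
  have hcg := hg.continuousOn hJ
  have hcu := D.tau.continuousOn hJ
  have hcc := D.prim.continuousOn hJ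
  have hcf : ContinuousOn (fun t => f t - (g t / c t) • u t) J :=
    hf.sub ((hcg.div hcc D.ne).smul hcu)
  have hK := hJ.uIcc_subset hx hy
  have i1 : IntervalIntegrable (fun t => ‖f t‖ ^ 2) volume x y :=
    ((hf.norm.pow 2).mono hK).intervalIntegrable
  have i2 : IntervalIntegrable (fun t => ‖f t - (g t / c t) • u t‖ ^ 2) volume x y :=
    ((hcf.norm.pow 2).mono hK).intervalIntegrable
  rw [intervalIntegral.integral_sub i1 i2] at h'
  linarith

end

lemma continuousOn_sub_smul {H : DiracOp} (D : DC q q' H.I lam u (fun x => (c x : ℂ)))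
    (hg : Prim H.I g (fun x => bil (u x) (f x)))
    (hf : ContinuousOn f H.I) : ContinuousOn (fun t => f t - (g t / c t) • u t) H.I := by
  have hJ := H.itv_I
  exact hf.sub (((hg.continuousOn hJ).div (D.prim.continuousOn hJ) D.ne).smul
    (D.tau.continuousOn hJ))

lemma integral_uIoc_le {H : DiracOp} (hab : H.a < H.b) {φ : ℝ → C2} {x y : ℝ}
    (hy : y ∈ H.rightOpen x) (h : MemLp φ 2 (volume.restrict (H.rightOpen x))) :
    ∫ t in x..y, ‖φ t‖ ^ 2 ≤ ∫ t in H.rightOpen x, ‖φ t‖ ^ 2 := by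
  have hE := DiracOp.isEnd_atB hab
  rw [intervalIntegral.integral_of_le hy.1.le]
  exact setIntegral_mono_set ((memLp_two_iff_integrable_sq_norm h.1).1 h)
    (Eventually.of_forall fun _ => sq_nonneg _)
    (show Ioc x y ⊆ H.rightOpen x from
      fun t ht => ⟨ht.1, (EReal.coe_le_coe_iff.2 ht.2).trans_lt hy.2⟩).eventuallyLE

section AtB

variable {H : DiracOp} (D : DC q q' H.I lam u (fun x => (c x : ℂ))) (hab : H.a < H.b)
  (hu : ∀ x ∈ H.I, cj (u x) = u x) (hg : Prim H.I g (fun x => bil (u x) (f x)))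
  (hf : ContinuousOn f H.I) (hL : H.L2NearB f)

include D hab hu hg hf hL in
-- In the integrated energy identity only the boundary term `-|g(y)|²/c(y)` depends on `y`
-- uncontrollably, so a one-sided bound on it is enough.
lemma L2NearB_of_bound {K : ℝ} (hK : ∀ᶠ y in H.atB, - (‖g y‖ ^ 2 / c y) ≤ K) :
    H.L2NearB (fun t => f t - (g t / c t) • u t) := by
  have hE := DiracOp.isEnd_atB hab
  have hJ := H.itv_I
  obtain ⟨x, hx, hLx⟩ := hL
  refine ⟨x, hx, hE.memLp_of_bound (D.continuousOn_sub_smul hg hf)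
    (K := (∫ t in H.rightOpen x, ‖f t‖ ^ 2) + K + ‖g x‖ ^ 2 / c x) hx ?_⟩
  filter_upwards [hK, hE.mem x hx] with y hy hyx
  have h1 := integral_uIoc_le hab hyx hLx
  rw [uIoc_of_le hyx.1.le, ← intervalIntegral.integral_of_le hyx.1.le,
    D.energy_integral hJ hu hg hf hx (hE.sub x hx hyx)]
  linarith

include D hab hu hg hf hL in
lemma L2NearB_of_pos (hc : ∀ x ∈ H.I, 0 < c x) :
    H.L2NearB (fun t => f t - (g t / c t) • u t) := by
  refine D.L2NearB_of_bound hab hu hg hf hL (K := 0) ?_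
  filter_upwards [(DiracOp.isEnd_atB hab).mem_I] with y hy
  have := hc y hy
  rw [neg_nonpos]
  positivity

include D hab hu hg hf hL in
-- If `u` is square integrable near `b`, then `g → 0` while the increasing `c` stays above a
-- positive value. Otherwise `c → ∞`, and the energy identity bounds `|g|²/c` by a constant `K`, so
-- `|g/c| ≤ √(K/c) → 0`.
lemma tendsto_div_of_pos (hc : ∀ x ∈ H.I, 0 < c x)
    (h0 : H.L2NearB u → Tendsto g H.atB (𝓝 0)) :
    Tendsto (fun x => g x / c x) H.atB (𝓝 0) := by
  have hE := DiracOp.isEnd_atB hab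
  have hJ := H.itv_I
  have hmono := D.monotoneOn hJ hu
  obtain ⟨x, hx, hLx⟩ := hL
  have hcx := hc x hx
  by_cases hLu : H.L2NearB u
  · have h1 : Tendsto (fun y => ‖g y‖ / c x) H.atB (𝓝 (‖(0 : ℂ)‖ / c x)) :=
      (h0 hLu).norm.div_const _
    rw [norm_zero, zero_div] at h1
    refine squeeze_zero_norm' ?_ h1
    filter_upwards [hE.mem x hx] with y hy
    have := hmono hx (hE.sub x hx hy) hy.1.le
    rw [norm_div, Complex.norm_real, Real.norm_of_nonneg (hcx.le.trans this)]
    gcongr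
  · have htop : Tendsto c H.atB atTop := by
      refine tendsto_atTop.2 fun K => ?_
      by_contra hK
      refine hLu ⟨x, hx, hE.memLp_of_bound (D.tau.continuousOn hJ) (K := K - c x) hx ?_⟩
      filter_upwards [hE.mem x hx] with y hy
      have hyI := hE.sub x hx hy
      rw [uIoc_of_le hy.1.le, ← intervalIntegral.integral_of_le hy.1.le,
        ← D.sub_eq hJ hu hx hyI]
      by_contra hlt
      refine hK ?_
      filter_upwards [hE.mem y hyI] with w hw
      have := hmono hyI (hE.sub y hyI hw) hw.1.le
      linarith
    set K := (∫ t in H.rightOpen x, ‖f t‖ ^ 2) + ‖g x‖ ^ 2 / c x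
    have h1 : Tendsto (fun y => √(K / c y)) H.atB (𝓝 √0) :=
      (Real.continuous_sqrt.tendsto _).comp (htop.const_div_atTop K)
    rw [Real.sqrt_zero] at h1
    refine squeeze_zero_norm' ?_ h1
    filter_upwards [hE.mem x hx] with y hy
    have hyI := hE.sub x hx hy
    have hcy := hc y hyI
    have h2 := D.energy_integral hJ hu hg hf hx hyI
    have h3 : 0 ≤ ∫ t in x..y, ‖f t - (g t / c t) • u t‖ ^ 2 :=
      intervalIntegral.integral_nonneg hy.1.le fun _ _ => sq_nonneg _
    have h4 := integral_uIoc_le hab hy hLx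
    refine Real.le_sqrt_of_sq_le ?_
    rw [norm_div, Complex.norm_real, Real.norm_of_nonneg hcy.le, div_pow, pow_two (c y),
      ← div_div]
    gcongr
    linarith

include hab hg hf hL in
-- Since `g → 0` at `b`, `g(y)` is minus the integral of `uᵀf` from `y` to `b`; Cauchy–Schwarz and
-- the upper bound on `c` finish.
lemma norm_sq_le_of_neg (hLu : ∀ x ∈ H.I, MemLp u 2 (volume.restrict (H.rightOpen x)))
    (hc : ∀ x ∈ H.I, c x ≤ - ∫ t in H.rightOpen x, ‖u t‖ ^ 2)
    (h0 : Tendsto g H.atB (𝓝 0)) {y : ℝ} (hy : y ∈ H.I) :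
    ‖g y‖ ^ 2 ≤ - c y * ∫ t in H.rightOpen y, ‖f t‖ ^ 2 := by
  have hE := DiracOp.isEnd_atB hab
  have := hE.neBot
  have hLf := IsEnd.L2Near.memLp hE hf hL hy
  have e0 : 0 ≤ ∫ t in H.rightOpen y, ‖f t‖ ^ 2 := integral_nonneg fun _ => sq_nonneg _
  have h1 : Tendsto (fun x => ‖g x - g y‖ ^ 2) H.atB (𝓝 (‖0 - g y‖ ^ 2)) :=
    ((h0.sub_const _).norm).pow 2
  rw [zero_sub, norm_neg] at h1
  refine le_of_tendsto h1 ?_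
  filter_upwards [hE.mem y hy] with x hx
  have hsub : Ioc y x ⊆ H.rightOpen y :=
    fun t ht => ⟨ht.1, (EReal.coe_le_coe_iff.2 ht.2).trans_lt hx.2⟩
  have hm := Measure.restrict_mono (μ := volume) hsub le_rfl
  rw [hg.sub_eq y hy x (hE.sub y hy hx), intervalIntegral.integral_of_le hx.1.le]
  refine (norm_integral_bil_sq_le ((hLu y hy).mono_measure hm) (hLf.mono_measure hm)).trans ?_
  have i1 := integral_uIoc_le hab hx (hLu y hy)
  have i2 := integral_uIoc_le hab hx hLf
  rw [intervalIntegral.integral_of_le hx.1.le] at i1 i2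
  have := hc y hy
  have e1 : 0 ≤ ∫ t in Ioc y x, ‖u t‖ ^ 2 := integral_nonneg fun _ => sq_nonneg _
  refine mul_le_mul (by linarith) i2 (integral_nonneg fun _ => sq_nonneg _) (by linarith)

include D hab hu hg hf hL in
lemma L2NearB_of_neg (hLu : ∀ x ∈ H.I, MemLp u 2 (volume.restrict (H.rightOpen x)))
    (hc : ∀ x ∈ H.I, c x ≤ - ∫ t in H.rightOpen x, ‖u t‖ ^ 2)
    (h0 : Tendsto g H.atB (𝓝 0)) :
    H.L2NearB (fun t => f t - (g t / c t) • u t) := by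
  have hE := DiracOp.isEnd_atB hab
  obtain ⟨x, hx⟩ := DiracOp.nonempty_I hab
  have hLx := IsEnd.L2Near.memLp hE hf hL hx
  refine D.L2NearB_of_bound hab hu hg hf hL (K := ∫ t in H.rightOpen x, ‖f t‖ ^ 2) ?_
  filter_upwards [hE.mem x hx] with y hy
  have hyI := hE.sub x hx hy
  have h1 := norm_sq_le_of_neg hab hg hf hL hLu hc h0 hyI
  have h2 : ∫ t in H.rightOpen y, ‖f t‖ ^ 2 ≤ ∫ t in H.rightOpen x, ‖f t‖ ^ 2 :=
    setIntegral_mono_set ((memLp_two_iff_integrable_sq_norm hLx.1).1 hLx)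
      (Eventually.of_forall fun _ => sq_nonneg _) (hE.nested x hx y hy).eventuallyLE
  have h3 : c y < 0 := by
    refine lt_of_le_of_ne ((hc y hyI).trans (neg_nonpos.2 (integral_nonneg fun _ => sq_nonneg _)))
      fun h => D.ne y hyI (by simp [h])
  rw [← div_neg, div_le_iff₀ (neg_pos.2 h3)]
  nlinarith

include D hab hu in
-- Here `c` may tend to zero at `b`, but `-1/c` is a primitive of `|u/c|²`; if `u/c` is square
-- integrable, `1/c` stays bounded and `g → 0` suffices.
lemma tendsto_div_of_neg (hc : ∀ x ∈ H.I, c x < 0) (h0 : Tendsto g H.atB (𝓝 0))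
    (hL : H.L2NearB (fun x => ((c x : ℂ))⁻¹ • u x)) :
    Tendsto (fun x => g x / c x) H.atB (𝓝 0) := by
  have hE := DiracOp.isEnd_atB hab
  have hJ := H.itv_I
  obtain ⟨x, hx, hLx⟩ := hL
  have D' : DC q' q H.I lam (fun x => ((c x : ℂ))⁻¹ • u x) (fun x => ((- (c x)⁻¹ : ℝ) : ℂ)) := by
    simpa using D.symm hJ
  have hu' : ∀ x ∈ H.I, cj (((c x : ℂ))⁻¹ • u x) = ((c x : ℂ))⁻¹ • u x := fun x hx => by
    rw [← Complex.ofReal_inv]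
    exact cj_real_smul (hu x hx) _
  set K := (∫ t in H.rightOpen x, ‖((c t : ℂ))⁻¹ • u t‖ ^ 2) + - (c x)⁻¹
  have h1 : Tendsto (fun y => ‖g y‖ * K) H.atB (𝓝 (‖(0 : ℂ)‖ * K)) := h0.norm.mul_const _
  rw [norm_zero, zero_mul] at h1
  refine squeeze_zero_norm' ?_ h1
  filter_upwards [hE.mem x hx] with y hy
  have hyI := hE.sub x hx hy
  have h2 := D'.sub_eq hJ hu' hx hyI
  have h3 := integral_uIoc_le hab hy hLx
  rw [norm_div, Complex.norm_real, Real.norm_of_nonpos (hc y hyI).le, div_eq_mul_inv, inv_neg]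
  gcongr
  linarith

end AtB

end DC

end DiracDC

/-! ### The transformation for `γ ≠ 0`: sign of `c_γ`, the new potential, eigenfunctions -/

namespace DiracDC

namespace DiracOp

/-- The hypotheses of the double commutation method, for `γ ≠ 0`. -/
structure Setup (H : DiracOp) (Θ Φ : ℂ → ℝ → C2) (lam γ : ℝ) : Prop where
  dirac : H.IsDirac
  sys : H.IsRealEntireSystem Θ Φ
  bound : -((H.normSq (Φ lam))⁻¹).toReal ≤ γ
  eig : MemLp (Φ lam) 2 (volume.restrict H.I) → IsEigenvalue H.graph lam
  ne : γ ≠ 0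

lemma normSq_lt_top_iff {H : DiracOp} {u : ℝ → C2} (hu : ContinuousOn u H.I) :
    H.normSq u < ⊤ ↔ MemLp u 2 (volume.restrict H.I) := by
  have hm : AEStronglyMeasurable u (volume.restrict H.I) :=
    hu.aestronglyMeasurable H.isOpen_I.measurableSet
  have e : H.normSq u = ∫⁻ x in H.I, ‖‖u x‖ ^ 2‖ₑ := by
    unfold normSq
    simp
  rw [memLp_two_iff_integrable_sq_norm hm, e]
  exact ⟨fun h => ⟨hm.norm.pow 2, h⟩, fun h => h.2⟩

namespace Setup

variable {H : DiracOp} {Θ Φ : ℂ → ℝ → C2} {lam γ : ℝ} (P : H.Setup Θ Φ lam γ)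
include P

lemma hab : H.a < H.b := P.dirac.lt

lemma real {x : ℝ} (hx : x ∈ H.I) : cj (Φ lam x) = Φ lam x :=
  cj_eq_self (P.sys.phi.real lam x hx)

lemma sol (z : ℂ) : H.Sol z (Φ z) := P.sys.phi.sol z

lemma re_eq {x : ℝ} (hx : x ∈ H.I) (i : Fin 2) : ((Φ lam x i).re : ℂ) = Φ lam x i :=
  Complex.conj_eq_iff_re.1 (Complex.conj_eq_iff_im.2 (P.sys.phi.real lam x hx i))

lemma sq_eq {x : ℝ} (hx : x ∈ H.I) :
    (Φ lam x 0).re ^ 2 + (Φ lam x 1).re ^ 2 = ‖Φ lam x‖ ^ 2 := by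
  rw [norm_sq_eq, ← P.re_eq hx 0, ← P.re_eq hx 1, Complex.norm_real, Complex.norm_real]
  simp

lemma memLp_left (z : ℂ) {x : ℝ} (hx : x ∈ H.I) :
    MemLp (Φ z) 2 (volume.restrict (H.leftOpen x)) := by
  obtain ⟨g, -, h, -⟩ := P.sys.phi_dom z
  exact IsEnd.L2Near.memLp (isEnd_atA P.hab) (P.sol z).continuousOn h hx

lemma integrableOn_bil {f : ℝ → C2} {x : ℝ} (hx : x ∈ H.I)
    (hf : MemLp f 2 (volume.restrict (H.leftOpen x))) :
    IntegrableOn (fun y => bil (Φ lam y) (f y)) (H.leftOpen x) :=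
  integrable_bil (P.memLp_left lam hx) hf

lemma cGamma_eq {x : ℝ} (hx : x ∈ H.I) :
    H.cGamma (Φ lam) γ x = 1 / γ + ∫ y in H.leftOpen x, ‖Φ lam y‖ ^ 2 := by
  have hE := isEnd_atA P.hab
  unfold cGamma
  rw [setIntegral_congr_fun (hE.measS hx) fun y hy => P.sq_eq (hE.sub x hx hy)]

lemma cGamma_eq' {x : ℝ} (hx : x ∈ H.I) : (H.cGamma (Φ lam) γ x : ℂ) =
    1 / γ + ∫ y in H.leftOpen x, bil (Φ lam y) (Φ lam y) := by
  have hE := isEnd_atA P.hab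
  rw [P.cGamma_eq hx, setIntegral_congr_fun (hE.measS hx)
    fun y hy => bil_self_of_real (P.real (hE.sub x hx hy)), integral_complex_ofReal]
  push_cast
  rfl

lemma locallyIntegrableOn_bil {f : ℝ → C2}
    (hf : ∀ x ∈ H.I, MemLp f 2 (volume.restrict (H.leftOpen x))) :
    LocallyIntegrableOn (fun y => bil (Φ lam y) (f y)) H.I := by
  intro x hx
  obtain ⟨y, hy, -⟩ := (isEnd_atB P.hab).exists_mem (isEnd_atB P.hab).mem_I hx
  have hyI := (isEnd_atB P.hab).sub x hx hy
  refine ⟨H.leftOpen y, ?_, P.integrableOn_bil hyI (hf y hyI)⟩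
  have : H.leftOpen y = H.I ∩ Iio y := by
    ext t
    exact ⟨fun h => ⟨(isEnd_atA P.hab).sub y hyI h, h.2⟩, fun h => ⟨h.1.1, h.2⟩⟩
  rw [this]
  exact inter_mem_nhdsWithin _ (Iio_mem_nhds hy.1)

lemma prim_left {f : ℝ → C2} (hf : ∀ x ∈ H.I, MemLp f 2 (volume.restrict (H.leftOpen x))) :
    Prim H.I (fun x => ∫ y in H.leftOpen x, bil (Φ lam y) (f y))
      (fun x => bil (Φ lam x) (f x)) :=
  prim_integral_leftOpen P.hab (P.locallyIntegrableOn_bil hf)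
    fun c hc => P.integrableOn_bil hc (hf c hc)

lemma tendsto_left {f : ℝ → C2} (hf : ∀ x ∈ H.I, MemLp f 2 (volume.restrict (H.leftOpen x))) :
    Tendsto (fun x => ∫ y in H.leftOpen x, bil (Φ lam y) (f y)) H.atA (𝓝 0) := by
  obtain ⟨c, hc⟩ := nonempty_I P.hab
  exact tendsto_integral_leftOpen P.hab hc (P.integrableOn_bil hc (hf c hc))

lemma prim_cGamma : Prim H.I (fun x => (H.cGamma (Φ lam) γ x : ℂ))
    (fun x => bil (Φ lam x) (Φ lam x)) := by
  refine ((Prim.const (1 / γ : ℂ)).add H.itv_I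
    (P.prim_left (f := Φ lam) fun x hx => P.memLp_left lam hx)).congr' H.itv_I
    (fun x hx => P.cGamma_eq' hx) (fun _ _ => by simp)

lemma tendsto_cGamma : Tendsto (fun x => (H.cGamma (Φ lam) γ x : ℂ)) H.atA (𝓝 (1 / γ)) := by
  have h := (P.tendsto_left (f := Φ lam) fun x hx => P.memLp_left lam hx).const_add (1 / γ : ℂ)
  rw [add_zero] at h
  refine h.congr' ?_
  filter_upwards [(isEnd_atA P.hab).mem_I] with x hx using (P.cGamma_eq' hx).symm

lemma cGamma_pos (h : 0 < γ) {x : ℝ} (hx : x ∈ H.I) : 0 < H.cGamma (Φ lam) γ x := by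
  rw [P.cGamma_eq hx]
  have : 0 ≤ ∫ y in H.leftOpen x, ‖Φ lam y‖ ^ 2 := integral_nonneg fun _ => sq_nonneg _
  positivity

lemma memLp_of_neg (h : γ < 0) : MemLp (Φ lam) 2 (volume.restrict H.I) := by
  refine (normSq_lt_top_iff (P.sol lam).continuousOn).1 ?_
  by_contra hn
  have := P.bound
  rw [not_lt_top_iff.1 hn] at this
  simp at this
  linarith

lemma integral_pos {x y : ℝ} (hx : x ∈ H.I) (hy : y ∈ H.I) (hxy : x < y) :
    0 < ∫ t in x..y, ‖Φ lam t‖ ^ 2 := by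
  have hK := H.itv_I.uIcc_subset hx hy
  refine intervalIntegral.intervalIntegral_pos_of_pos_on ?_ (fun t ht => ?_) hxy
  · have : ContinuousOn (fun t => ‖Φ lam t‖ ^ 2) (uIcc x y) :=
      (((P.sol lam).continuousOn.mono hK).norm.pow 2)
    exact this.intervalIntegrable
  · have : Φ lam t ≠ 0 := P.sys.phi_ne_zero (hK (Icc_subset_uIcc (Ioo_subset_Icc_self ht)))
    positivity

/-- With `N = ‖Φ(λ)‖²`, the bound `-1/N ≤ γ < 0` gives `1/γ ≤ -N`, and what remains of `-N` after
adding the integral from `a` to `x` is at most minus the integral from `x` to `b`. -/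
lemma cGamma_le_of_neg (h : γ < 0) {x : ℝ} (hx : x ∈ H.I) :
    H.cGamma (Φ lam) γ x ≤ - ∫ y in H.rightOpen x, ‖Φ lam y‖ ^ 2 := by
  have hL := P.memLp_of_neg h
  have hi := (memLp_two_iff_integrable_sq_norm hL.1).1 hL
  have hEa := isEnd_atA P.hab
  have hEb := isEnd_atB P.hab
  set N := ∫ y in H.I, ‖Φ lam y‖ ^ 2 with hN
  have h0 : 0 ≤ N := integral_nonneg fun _ => sq_nonneg _
  have hle : (∫ y in H.leftOpen x, ‖Φ lam y‖ ^ 2) + ∫ y in H.rightOpen x, ‖Φ lam y‖ ^ 2 ≤ N := by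
    have hd : Disjoint (H.leftOpen x) (H.rightOpen x) :=
      disjoint_left.2 fun t h1 h2 => lt_asymm h1.2 h2.1
    rw [← setIntegral_union hd (hEb.measS hx) (hi.mono_measure
      (Measure.restrict_mono (hEa.sub x hx) le_rfl)) (hi.mono_measure
      (Measure.restrict_mono (hEb.sub x hx) le_rfl))]
    exact setIntegral_mono_set hi (Eventually.of_forall fun _ => sq_nonneg _)
      (union_subset (hEa.sub x hx) (hEb.sub x hx)).eventuallyLE
  have hpos : 0 < N := by
    obtain ⟨y, hy, -⟩ := hEb.exists_mem hEb.mem_I hx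
    have h1 := P.integral_pos hx (hEb.sub x hx hy) hy.1
    rw [intervalIntegral.integral_of_le hy.1.le] at h1
    refine h1.trans_le (setIntegral_mono_set hi (Eventually.of_forall fun _ => sq_nonneg _) ?_)
    exact (show Ioc x y ⊆ H.I by
      rw [← uIoc_of_le hy.1.le]
      exact H.itv_I.uIoc_subset hx (hEb.sub x hx hy)).eventuallyLE
  have hb : -N⁻¹ ≤ γ := by
    have := P.bound
    have e : H.normSq (Φ lam) = ENNReal.ofReal N := by
      rw [hN, ofReal_integral_eq_lintegral_ofReal hi (Eventually.of_forall fun _ => sq_nonneg _)]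
      unfold normSq
      refine lintegral_congr fun t => ?_
      rw [ENNReal.ofReal_pow (norm_nonneg _), ofReal_norm]
    rwa [e, ← ENNReal.ofReal_inv_of_pos hpos, ENNReal.toReal_ofReal (inv_nonneg.2 h0)] at this
  have hg : 1 / γ ≤ -N := by
    rw [div_le_iff_of_neg h]
    have := mul_le_mul_of_nonneg_left hb h0
    rw [mul_neg, mul_inv_cancel₀ hpos.ne'] at this
    linarith
  rw [P.cGamma_eq hx]
  linarith

/-- Strictness also in the extreme case `γ = -‖Φ(λ)‖⁻²`: `c_γ` is strictly increasing and
non-positive at a point to the right of `x`. -/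
lemma cGamma_neg (h : γ < 0) {x : ℝ} (hx : x ∈ H.I) : H.cGamma (Φ lam) γ x < 0 := by
  have hEb := isEnd_atB P.hab
  obtain ⟨y, hy, -⟩ := hEb.exists_mem hEb.mem_I hx
  have hyI := hEb.sub x hx hy
  have h1 := P.integral_pos hx hyI hy.1
  have h2 := P.cGamma_le_of_neg h hyI
  have h3 : 0 ≤ ∫ y in H.rightOpen y, ‖Φ lam y‖ ^ 2 := integral_nonneg fun _ => sq_nonneg _
  have h4 := P.prim_cGamma.sub_eq x hx y hyI
  have e : ∫ t in x..y, bil (Φ lam t) (Φ lam t) = ∫ t in x..y, ((‖Φ lam t‖ ^ 2 : ℝ) : ℂ) :=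
    intervalIntegral.integral_congr fun t ht =>
      bil_self_of_real (P.real (H.itv_I.uIcc_subset hx hyI ht))
  rw [e, intervalIntegral.integral_ofReal] at h4
  have h5 : H.cGamma (Φ lam) γ y - H.cGamma (Φ lam) γ x = ∫ t in x..y, ‖Φ lam t‖ ^ 2 := by
    exact_mod_cast h4
  linarith

lemma cGamma_ne {x : ℝ} (hx : x ∈ H.I) : H.cGamma (Φ lam) γ x ≠ 0 := by
  rcases lt_or_gt_of_ne P.ne with h | h
  · exact (P.cGamma_neg h hx).ne
  · exact (P.cGamma_pos h hx).ne'

lemma cGammaInv_eq (x : ℝ) : H.cGammaInv (Φ lam) γ x = (H.cGamma (Φ lam) γ x)⁻¹ := by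
  simp [cGammaInv, P.ne]

lemma uGamma_eq : H.uGamma (Φ lam) γ = fun x => ((H.cGamma (Φ lam) γ x : ℂ))⁻¹ • Φ lam x := by
  funext x
  simp [uGamma, P.cGammaInv_eq]

lemma dc : DC H.pot (H.doubleComm (Φ lam) γ).pot H.I lam (Φ lam)
    (fun x => (H.cGamma (Φ lam) γ x : ℂ)) where
  tau := P.sol lam
  prim := P.prim_cGamma
  ne x hx := Complex.ofReal_ne_zero.2 (P.cGamma_ne hx)
  relA x hx := by
    rw [← P.re_eq hx 0, ← P.re_eq hx 1]
    simp only [Potential.A, doubleComm, P.cGammaInv_eq]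
    push_cast
    ring
  relB x hx := by
    rw [← P.re_eq hx 0, ← P.re_eq hx 1]
    simp only [Potential.B, doubleComm, P.cGammaInv_eq]
    push_cast
    ring
  relD x hx := by
    rw [← P.re_eq hx 0, ← P.re_eq hx 1]
    simp only [Potential.D, doubleComm, P.cGammaInv_eq]
    push_cast
    ring

lemma sol_uGamma : (H.doubleComm (Φ lam) γ).Sol lam (H.uGamma (Φ lam) γ) := by
  rw [P.uGamma_eq]
  exact P.dc.tau_div H.itv_I

lemma uGamma_real {x : ℝ} (hx : x ∈ H.I) :
    cj (H.uGamma (Φ lam) γ x) = H.uGamma (Φ lam) γ x := by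
  unfold uGamma
  exact cj_real_smul (P.real hx) _

lemma uGamma_ne_zero {x : ℝ} (hx : x ∈ H.I) : H.uGamma (Φ lam) γ x ≠ 0 := by
  rw [P.uGamma_eq]
  exact smul_ne_zero (inv_ne_zero (P.dc.ne x hx)) (P.sys.phi_ne_zero hx)

lemma isBoundaryFunction_uGamma :
    (H.doubleComm (Φ lam) γ).IsBoundaryFunction (H.uGamma (Φ lam) γ) := by
  refine ⟨⟨lam, P.sol_uGamma⟩, fun x hx i => ?_, ?_⟩
  · have := congrArg (fun w : C2 => w i) (P.uGamma_real hx)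
    exact Complex.conj_eq_iff_im.1 this
  · obtain ⟨x, hx⟩ := nonempty_I P.hab
    exact ⟨x, hx, P.uGamma_ne_zero hx⟩

lemma isDirac : (H.doubleComm (Φ lam) γ).IsDirac where
  lt := P.hab
  m_nonneg := P.dirac.m_nonneg
  qel_loc := P.dirac.qel_loc
  qsc_loc := by
    have hc : ContinuousOn (fun x => 2 * ((Φ lam x 0).re * (Φ lam x 1).re) *
        H.cGammaInv (Φ lam) γ x) H.I := by
      obtain ⟨h0, h1⟩ := C2.continuousOn_iff.1 (P.sol lam).continuousOn
      have h2 := Complex.continuous_re.comp_continuousOn (P.prim_cGamma.continuousOn H.itv_I)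
      simp only [P.cGammaInv_eq]
      exact (continuousOn_const.mul ((Complex.continuous_re.comp_continuousOn h0).mul
        (Complex.continuous_re.comp_continuousOn h1))).mul
        (h2.inv₀ fun x hx => P.cGamma_ne hx)
    exact P.dirac.qsc_loc.sub (hc.locallyIntegrableOn H.isOpen_I.measurableSet)
  qam_loc := by
    have hc : ContinuousOn (fun x => ((Φ lam x 0).re ^ 2 - (Φ lam x 1).re ^ 2) *
        H.cGammaInv (Φ lam) γ x) H.I := by
      obtain ⟨h0, h1⟩ := C2.continuousOn_iff.1 (P.sol lam).continuousOn
      have h2 := Complex.continuous_re.comp_continuousOn (P.prim_cGamma.continuousOn H.itv_I)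
      simp only [P.cGammaInv_eq]
      exact (((Complex.continuous_re.comp_continuousOn h0).pow 2).sub
        ((Complex.continuous_re.comp_continuousOn h1).pow 2)).mul
        (h2.inv₀ fun x hx => P.cGamma_ne hx)
    exact P.dirac.qam_loc.add (hc.locallyIntegrableOn H.isOpen_I.measurableSet)
  bcA _ := by simpa [doubleComm, P.ne] using P.isBoundaryFunction_uGamma
  bcB _ := by simpa [doubleComm, P.ne] using P.isBoundaryFunction_uGamma

/-- If `Φ(λ)` is square integrable, it is an eigenfunction of `H`. -/
lemma inDomB_of_memLp (h : MemLp (Φ lam) 2 (volume.restrict H.I)) : H.InDomB (Φ lam) := by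
  obtain ⟨F, hF, f, g, hfg, hA, hB, hFf, hFg⟩ := P.eig h
  have hEa := isEnd_atA P.hab
  have hEb := isEnd_atB P.hab
  have hg : g =ᵐ[volume.restrict H.I] fun x => (lam : ℂ) • f x := by
    have h1 := Lp.coeFn_smul (lam : ℂ) F
    filter_upwards [hFf, hFg, h1] with x h2 h3 h4
    rw [← h3]
    simp only [h4, Pi.smul_apply, h2]
  have hsol : H.Sol lam f := hfg.congr_ae hg.symm
  have Lf : MemLp f 2 (volume.restrict H.I) := (Lp.memLp F).ae_eq hFf
  obtain ⟨x, hx⟩ := nonempty_I P.hab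
  have hLa : MemLp f 2 (volume.restrict (H.leftOpen x)) :=
    Lf.mono_measure (Measure.restrict_mono (hEa.sub x hx) le_rfl)
  have hLb : MemLp f 2 (volume.restrict (H.rightOpen x)) :=
    Lf.mono_measure (Measure.restrict_mono (hEb.sub x hx) le_rfl)
  -- An eigenfunction lies in the domain near `a`, hence is a multiple of `Φ(λ)`; its condition at
  -- `b` is thereby inherited by `Φ(λ)`.
  obtain ⟨α, hα⟩ := P.sys.eq_smul_phi P.dirac hsol
    ⟨_, hsol, ⟨x, hx, hLa⟩, ⟨x, hx, hLa.const_smul (lam : ℂ)⟩, hA⟩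
  have hα0 : α ≠ 0 := by
    rintro rfl
    refine hF ?_
    rw [Lp.eq_zero_iff_ae_eq_zero]
    filter_upwards [hFf, ae_restrict_mem H.isOpen_I.measurableSet] with t h1 h2
    rw [h1, hα t h2]
    simp
  have hdom : H.InDomB f := ⟨_, hsol, ⟨x, hx, hLb⟩, ⟨x, hx, hLb.const_smul (lam : ℂ)⟩, hB⟩
  refine (hdom.smul α⁻¹).congr P.dirac fun t ht => ?_
  rw [hα t ht, smul_smul, inv_mul_cancel₀ hα0, one_smul]

lemma inDomB_of_L2NearB (h : H.L2NearB (Φ lam)) : H.InDomB (Φ lam) := by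
  obtain ⟨c, hc, hL⟩ := h
  have hEb := isEnd_atB P.hab
  obtain ⟨d, hd, -⟩ := hEb.exists_mem hEb.mem_I hc
  have hdI := hEb.sub c hc hd
  refine P.inDomB_of_memLp ?_
  have hcov : H.I ⊆ H.leftOpen d ∪ H.rightOpen c := fun t ht => by
    rcases lt_or_ge t d with h | h
    · exact Or.inl ⟨ht.1, h⟩
    · exact Or.inr ⟨hd.1.trans_le h, ht.2⟩
  refine MemLp.mono_measure (Measure.restrict_mono hcov le_rfl) ?_
  have hl := P.memLp_left lam hdI
  refine (memLp_two_iff_integrable_sq_norm (aestronglyMeasurable_union_iff.2 ⟨hl.1, hL.1⟩)).2 ?_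
  exact IntegrableOn.union ((memLp_two_iff_integrable_sq_norm hl.1).1 hl)
    ((memLp_two_iff_integrable_sq_norm hL.1).1 hL)

end Setup

end DiracOp

end DiracDC

/-! ### The transformation and its inverse on solutions near `b` -/

namespace DiracDC

lemma IsEnd.setIntegral_le_of_bound {I : Set ℝ} {l : Filter ℝ} {S : ℝ → Set ℝ} (E : IsEnd I l S)
    {φ : ℝ → ℝ} {c K : ℝ} (hc : c ∈ I) (hφ : IntegrableOn φ (S c))
    (h : ∀ᶠ y in l, ∫ t in uIoc c y, φ t ≤ K) : ∫ t in S c, φ t ≤ K := by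
  have := E.neBot
  have := E.cg
  have hcov : AECover (volume.restrict (S c)) l (fun y => uIoc c y) :=
    ⟨ae_restrict_of_forall_mem (E.measS hc) fun x hx => E.cover c hc x hx,
      fun y => measurableSet_uIoc⟩
  refine le_of_tendsto (hcov.integral_tendsto_of_countably_generated hφ) ?_
  filter_upwards [h, E.mem c hc] with y hy hyS
  refine le_trans (le_of_eq ?_) hy
  rw [Measure.restrict_restrict measurableSet_uIoc]
  refine setIntegral_congr_set ?_
  have hsub : uIoc c y ⊆ insert c (S c) := uIoc_subset_uIcc.trans (E.between c hc y hyS)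
  have h0 : ∀ᵐ t : ℝ, t ≠ c :=
    compl_mem_ae_iff.2 (measure_singleton (μ := (volume : Measure ℝ)) c)
  filter_upwards [h0] with t ht
  refine propext ⟨fun h => h.1, fun h => ⟨h, ?_⟩⟩
  rcases hsub h with h' | h'
  · exact absurd h' ht
  · exact h'

namespace DiracOp

namespace Setup

variable {H : DiracOp} {Θ Φ : ℂ → ℝ → C2} {lam γ : ℝ} (P : H.Setup Θ Φ lam γ)
include P

lemma W_uGamma (x : ℝ) (v : C2) :
    W (H.uGamma (Φ lam) γ x) v = W (Φ lam x) v / (H.cGamma (Φ lam) γ x : ℂ) := by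
  rw [P.uGamma_eq, W_smul_left, div_eq_inv_mul]

lemma bcA_eq : (H.doubleComm (Φ lam) γ).bcA = H.uGamma (Φ lam) γ := by simp [doubleComm, P.ne]

lemma bcB_eq : (H.doubleComm (Φ lam) γ).bcB = H.uGamma (Φ lam) γ := by simp [doubleComm, P.ne]

/-- The primitive of `Φ(λ)ᵀ f` associated with a solution `f` of `τ f = z f`. -/
lemma prim_W {z : ℂ} (hz : z ≠ lam) {f : ℝ → C2} (hf : H.Sol z f) :
    Prim H.I (fun x => -1 / (z - lam) * W (Φ lam x) (f x)) (fun x => bil (Φ lam x) (f x)) := by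
  have hz' : z - lam ≠ 0 := sub_ne_zero.2 hz
  refine (((P.sol lam).tau.lagrange H.itv_I hf).const_mul H.itv_I (-1 / (z - lam))).congr' H.itv_I
    (fun _ _ => rfl) fun x _ => ?_
  simp only [bil, PiLp.smul_apply, smul_eq_mul]
  field_simp
  ring

lemma transform_eq (z : ℂ) (f : ℝ → C2) (x : ℝ) :
    f x + (1 / (z - lam)) • (W (Φ lam x) (f x) • H.uGamma (Φ lam) γ x) =
      f x - ((-1 / (z - lam) * W (Φ lam x) (f x)) / (H.cGamma (Φ lam) γ x : ℂ)) • Φ lam x := by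
  rw [P.uGamma_eq, smul_smul, smul_smul, sub_eq_add_neg (f x), ← neg_smul]
  congr 2
  ring

lemma sol_transform {z : ℂ} (hz : z ≠ lam) {f : ℝ → C2} (hf : H.Sol z f) :
    (H.doubleComm (Φ lam) γ).Sol z
      (fun x => f x + (1 / (z - lam)) • (W (Φ lam x) (f x) • H.uGamma (Φ lam) γ x)) := by
  rw [P.uGamma_eq]
  exact P.dc.tau_sol H.itv_I hz hf

lemma W_uGamma_sub (x : ℝ) (v : C2) (k : ℂ) :
    W (H.uGamma (Φ lam) γ x) (v - k • Φ lam x) =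
      W (Φ lam x) v / (H.cGamma (Φ lam) γ x : ℂ) := by
  rw [P.W_uGamma, W_sub_right, W_smul_right, W_self, mul_zero, sub_zero]

/-- The sign of `γ` decides which energy estimate applies. The new boundary condition is `W(u,f)/c =
-(z - λ)g/c → 0`, because subtracting a multiple of `Φ(λ)` does not affect the Wronskian with
`Φ(λ)/c`. -/
lemma inDomB_transform {z : ℂ} (hz : z ≠ lam) {f : ℝ → C2} (hf : H.Sol z f)
    (hB : H.InDomB f) : (H.doubleComm (Φ lam) γ).InDomB
      (fun x => f x + (1 / (z - lam)) • (W (Φ lam x) (f x) • H.uGamma (Φ lam) γ x)) := by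
  have hz' : z - lam ≠ 0 := sub_ne_zero.2 hz
  have hg := P.prim_W hz hf
  set g : ℝ → ℂ := fun x => -1 / (z - lam) * W (Φ lam x) (f x) with hgdef
  have hLf : H.L2NearB f := by obtain ⟨_, _, h, _⟩ := hB; exact h
  have hlim : H.L2NearB (Φ lam) → Tendsto g H.atB (𝓝 0) := fun h => by
    have := (P.sys.tendsto_W_atB P.dirac (P.inDomB_of_L2NearB h) hB).const_mul (-1 / (z - lam))
    rwa [mul_zero] at this
  have hu : ∀ x ∈ H.I, cj (Φ lam x) = Φ lam x := fun x hx => P.real hx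
  have key : H.L2NearB (fun t => f t - (g t / (H.cGamma (Φ lam) γ t : ℂ)) • Φ lam t) ∧
      ((H.doubleComm (Φ lam) γ).LimitCircleB →
        Tendsto (fun x => g x / (H.cGamma (Φ lam) γ x : ℂ)) H.atB (𝓝 0)) := by
    rcases lt_or_gt_of_ne P.ne with h | h
    · have hL := P.memLp_of_neg h
      have hLu : ∀ x ∈ H.I, MemLp (Φ lam) 2 (volume.restrict (H.rightOpen x)) := fun x hx =>
        hL.mono_measure (Measure.restrict_mono ((isEnd_atB P.hab).sub x hx) le_rfl)
      obtain ⟨x0, hx0⟩ := nonempty_I P.hab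
      have h0 := hlim ⟨x0, hx0, hLu x0 hx0⟩
      refine ⟨P.dc.L2NearB_of_neg P.hab hu hg hf.continuousOn hLf hLu
        (fun x hx => P.cGamma_le_of_neg h hx) h0, fun lc => ?_⟩
      refine P.dc.tendsto_div_of_neg P.hab hu (fun x hx => P.cGamma_neg h hx) h0 ?_
      have := lc lam _ P.sol_uGamma
      rwa [P.uGamma_eq] at this
    · exact ⟨P.dc.L2NearB_of_pos P.hab hu hg hf.continuousOn hLf (fun x hx => P.cGamma_pos h hx),
        fun _ => P.dc.tendsto_div_of_pos P.hab hu hg hf.continuousOn hLf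
          (fun x hx => P.cGamma_pos h hx) hlim⟩
  have hsol := P.sol_transform hz hf
  simp only [P.transform_eq] at hsol ⊢
  obtain ⟨c, hc, hL⟩ := key.1
  refine ⟨_, hsol, ⟨c, hc, hL⟩, ⟨c, hc, hL.const_smul z⟩, fun lc => ?_⟩
  have := (key.2 lc).const_mul (-(z - lam))
  rw [mul_zero] at this
  refine this.congr fun x => ?_
  rw [P.bcB_eq, P.W_uGamma_sub]
  simp only [hgdef]
  field_simp

/-- The data of the inverse transformation. -/
lemma dc_inv : DC (H.doubleComm (Φ lam) γ).pot H.pot H.I lam (H.uGamma (Φ lam) γ)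
    (fun x => ((- (H.cGamma (Φ lam) γ x)⁻¹ : ℝ) : ℂ)) := by
  have := P.dc.symm H.itv_I
  rw [P.uGamma_eq]
  simpa using this

lemma inv_smul_uGamma {x : ℝ} (hx : x ∈ H.I) :
    (((- (H.cGamma (Φ lam) γ x)⁻¹ : ℝ) : ℂ))⁻¹ • H.uGamma (Φ lam) γ x = - Φ lam x := by
  have := P.dc.ne x hx
  rw [P.uGamma_eq, smul_smul]
  push_cast
  rw [inv_neg, inv_inv, neg_mul, mul_inv_cancel₀ this, neg_one_smul]

/-- `-1/c_γ` is a negative primitive of `|Φ(λ)/c_γ|²`, so the truncated norms are at most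
`1/c_γ(x)`. For `γ > 0` this is the input that the inverse transformation needs in the negative
case. -/
lemma integral_uGamma_le (h : 0 < γ) {x : ℝ} (hx : x ∈ H.I) :
    MemLp (H.uGamma (Φ lam) γ) 2 (volume.restrict (H.rightOpen x)) ∧
    - (H.cGamma (Φ lam) γ x)⁻¹ ≤ - ∫ t in H.rightOpen x, ‖H.uGamma (Φ lam) γ t‖ ^ 2 := by
  have hE := isEnd_atB P.hab
  have hb : ∀ᶠ y in H.atB, ∫ t in uIoc x y, ‖H.uGamma (Φ lam) γ t‖ ^ 2 ≤
      (H.cGamma (Φ lam) γ x)⁻¹ := by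
    filter_upwards [hE.mem x hx] with y hy
    have hyI := hE.sub x hx hy
    have := P.dc_inv.sub_eq H.itv_I (fun x hx => P.uGamma_real hx) hx hyI
    rw [uIoc_of_le hy.1.le, ← intervalIntegral.integral_of_le hy.1.le, ← this]
    have := inv_pos.2 (P.cGamma_pos h hyI)
    linarith
  have hL := hE.memLp_of_bound P.sol_uGamma.continuousOn hx hb
  exact ⟨hL, neg_le_neg (hE.setIntegral_le_of_bound hx
    ((memLp_two_iff_integrable_sq_norm hL.1).1 hL) hb)⟩

lemma inDomB_uGamma (h : H.L2NearB (H.uGamma (Φ lam) γ)) :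
    (H.doubleComm (Φ lam) γ).InDomB (H.uGamma (Φ lam) γ) := by
  obtain ⟨c, hc, hL⟩ := h
  refine ⟨_, P.sol_uGamma, ⟨c, hc, hL⟩, ⟨c, hc, hL.const_smul (lam : ℂ)⟩, fun _ => ?_⟩
  rw [P.bcB_eq]
  simp only [W_self]
  exact tendsto_const_nhds

lemma inv_transform_eq (z : ℂ) {f : ℝ → C2} {x : ℝ} (hx : x ∈ H.I) :
    f x - (1 / (z - lam)) • (W (H.uGamma (Φ lam) γ x) (f x) • Φ lam x) =
      f x - ((-1 / (z - lam) * W (H.uGamma (Φ lam) γ x) (f x)) /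
        ((- (H.cGamma (Φ lam) γ x)⁻¹ : ℝ) : ℂ)) • H.uGamma (Φ lam) γ x := by
  rw [div_eq_mul_inv _ ((- (H.cGamma (Φ lam) γ x)⁻¹ : ℝ) : ℂ), mul_smul, P.inv_smul_uGamma hx,
    smul_smul, smul_neg, ← neg_smul]
  congr 2
  ring

/-- The inverse transformation maps solutions in the domain of `H_γ` near `b` to solutions in the
domain of `H` near `b`. -/
lemma inDomB_inv_transform {Θ' Φ' : ℂ → ℝ → C2}
    (hs : (H.doubleComm (Φ lam) γ).IsRealEntireSystem Θ' Φ')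
    {z : ℂ} (hz : z ≠ lam) {f : ℝ → C2} (hf : (H.doubleComm (Φ lam) γ).Sol z f)
    (hB : (H.doubleComm (Φ lam) γ).InDomB f) :
    H.Sol z (fun x => f x - (1 / (z - lam)) • (W (H.uGamma (Φ lam) γ x) (f x) • Φ lam x)) ∧
    H.InDomB
      (fun x => f x - (1 / (z - lam)) • (W (H.uGamma (Φ lam) γ x) (f x) • Φ lam x)) := by
  have hE := isEnd_atB P.hab
  have hz' : z - lam ≠ 0 := sub_ne_zero.2 hz
  have hsol : H.Sol z
      (fun x => f x - (1 / (z - lam)) • (W (H.uGamma (Φ lam) γ x) (f x) • Φ lam x)) := by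
    refine (P.dc_inv.tau_sol H.itv_I hz hf).congr' H.itv_I (fun x hx => ?_) fun x hx => ?_
    · rw [P.inv_smul_uGamma hx, smul_neg, smul_neg, sub_eq_add_neg]
    · rw [P.inv_smul_uGamma hx, smul_neg, smul_neg, ← sub_eq_add_neg]
  refine ⟨hsol, ?_⟩
  have hg : Prim H.I (fun x => -1 / (z - lam) * W (H.uGamma (Φ lam) γ x) (f x))
      (fun x => bil (H.uGamma (Φ lam) γ x) (f x)) := by
    refine ((P.sol_uGamma.tau.lagrange H.itv_I hf).const_mul H.itv_I (-1 / (z - lam))).congr'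
      H.itv_I (fun _ _ => rfl) fun x _ => ?_
    simp only [bil, PiLp.smul_apply, smul_eq_mul]
    field_simp
    ring
  set g : ℝ → ℂ := fun x => -1 / (z - lam) * W (H.uGamma (Φ lam) γ x) (f x) with hgdef
  have hLf : H.L2NearB f := by obtain ⟨_, _, h, _⟩ := hB; exact h
  have hlim : H.L2NearB (H.uGamma (Φ lam) γ) → Tendsto g H.atB (𝓝 0) := fun h => by
    have := (hs.tendsto_W_atB P.isDirac (P.inDomB_uGamma h) hB).const_mul (-1 / (z - lam))
    rwa [mul_zero] at this
  have hu : ∀ x ∈ H.I, cj (H.uGamma (Φ lam) γ x) = H.uGamma (Φ lam) γ x :=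
    fun x hx => P.uGamma_real hx
  have hfc : ContinuousOn f H.I := hf.continuousOn
  have key : H.L2NearB (fun t => f t - (g t / ((- (H.cGamma (Φ lam) γ t)⁻¹ : ℝ) : ℂ)) •
        H.uGamma (Φ lam) γ t) ∧
      (H.LimitCircleB →
        Tendsto (fun x => g x / ((- (H.cGamma (Φ lam) γ x)⁻¹ : ℝ) : ℂ)) H.atB (𝓝 0)) := by
    -- The signs are exchanged: the role of `c` is played by `-1/c_γ`, positive exactly when `γ <
    -- 0`.
    rcases lt_or_gt_of_ne P.ne with h | h
    · have hpos : ∀ x ∈ H.I, 0 < - (H.cGamma (Φ lam) γ x)⁻¹ := fun x hx =>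
        neg_pos.2 (inv_lt_zero.2 (P.cGamma_neg h hx))
      exact ⟨P.dc_inv.L2NearB_of_pos P.hab hu hg hfc hLf hpos,
        fun _ => P.dc_inv.tendsto_div_of_pos P.hab hu hg hfc hLf hpos hlim⟩
    · have hneg : ∀ x ∈ H.I, - (H.cGamma (Φ lam) γ x)⁻¹ < 0 := fun x hx =>
        neg_lt_zero.2 (inv_pos.2 (P.cGamma_pos h hx))
      obtain ⟨x0, hx0⟩ := nonempty_I P.hab
      have h0 := hlim ⟨x0, hx0, (P.integral_uGamma_le h hx0).1⟩
      refine ⟨P.dc_inv.L2NearB_of_neg P.hab hu hg hfc hLf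
        (fun x hx => (P.integral_uGamma_le h hx).1)
        (fun x hx => (P.integral_uGamma_le h hx).2) h0, fun lc => ?_⟩
      refine P.dc_inv.tendsto_div_of_neg P.hab hu hneg h0 ?_
      obtain ⟨c, hc, hL⟩ := lc lam _ (P.sol lam)
      exact ⟨c, hc, hL.neg.ae_eq (ae_restrict_of_forall_mem (hE.measS hc) fun x hx =>
        (P.inv_smul_uGamma (hE.sub c hc hx)).symm)⟩
  have hL : H.L2NearB
      (fun x => f x - (1 / (z - lam)) • (W (H.uGamma (Φ lam) γ x) (f x) • Φ lam x)) := by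
    obtain ⟨c, hc, hL⟩ := key.1
    exact ⟨c, hc, hL.ae_eq (ae_restrict_of_forall_mem (hE.measS hc) fun x hx =>
      (P.inv_transform_eq z (hE.sub c hc hx)).symm)⟩
  have hmax := IsEnd.InMax.of_sol hsol hL
  obtain ⟨c, hc, hLc⟩ := hL
  refine ⟨_, hsol, ⟨c, hc, hLc⟩, ⟨c, hc, hLc.const_smul z⟩, fun lc => ?_⟩
  -- The given boundary function of `H` at `b` is replaced by `Φ(λ)`: in the limit circle case
  -- `Φ(λ)` is square integrable, hence an eigenfunction satisfying that condition.
  refine hE.tendsto_W_bc (LC := H.LimitCircleB) Iff.rfl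
    (fun lc => (P.sys.bc_spec (P.dirac.bcB lc)).1) (P.sol lam)
    (fun x hx => P.sys.phi_ne_zero hx) hmax (fun lc => ?_) (fun lc => ?_) lc
  · obtain ⟨_, _, _, _, h⟩ := P.inDomB_of_L2NearB (lc lam _ (P.sol lam))
    exact h lc
  · have := (key.2 lc).const_mul (z - lam)
    rw [mul_zero] at this
    refine this.congr' ?_
    filter_upwards [hE.mem_I] with x hx
    have hc := P.dc.ne x hx
    rw [W_sub_right, W_smul_right, W_smul_right, W_self, mul_zero, mul_zero, sub_zero]
    simp only [hgdef, P.W_uGamma]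
    push_cast
    field_simp

end Setup

end DiracOp

end DiracDC

/-! ### `Φ_γ` near `a`, and the norm of `Φ(λ)` as a derivative -/

namespace DiracDC

lemma tendsto_W {α : Type*} {l : Filter α} {f g : α → C2} {v w : C2} (hf : Tendsto f l (𝓝 v))
    (hg : Tendsto g l (𝓝 w)) : Tendsto (fun t => W (f t) (g t)) l (𝓝 (W v w)) := by
  have h : ∀ i : Fin 2, Continuous fun v : C2 => v i := fun i => (C2.coord i).continuous
  have e : ∀ i : Fin 2, Tendsto (fun t => f t i) l (𝓝 (v i)) := fun i =>
    ((h i).tendsto v).comp hf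
  have e' : ∀ i : Fin 2, Tendsto (fun t => g t i) l (𝓝 (w i)) := fun i =>
    ((h i).tendsto w).comp hg
  exact ((e 0).mul (e' 1)).sub ((e 1).mul (e' 0))

lemma hasDerivAt_W {F : ℂ → C2} {F' u : C2} {z : ℂ} (h : HasDerivAt F F' z) :
    HasDerivAt (fun w => W u (F w)) (W u F') z := by
  have h0 := ((C2.coord 0).hasFDerivAt.comp_hasDerivAt z h)
  have h1 := ((C2.coord 1).hasFDerivAt.comp_hasDerivAt z h)
  exact (h1.const_mul (u 0)).sub (h0.const_mul (u 1))

lemma differentiable_W {F : ℂ → C2} {u : C2} (h : Differentiable ℂ F) :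
    Differentiable ℂ (fun w => W u (F w)) :=
  fun z => (hasDerivAt_W (h z).hasDerivAt).differentiableAt

lemma differentiable_dslope {E : Type*} [NormedAddCommGroup E] [NormedSpace ℂ E] [CompleteSpace E]
    {F : ℂ → E} (h : Differentiable ℂ F) (a : ℂ) : Differentiable ℂ (dslope F a) :=
  differentiableOn_univ.1 ((Complex.differentiableOn_dslope univ_mem).2 h.differentiableOn)

namespace DiracOp

section

variable {H : DiracOp} {Θ Φ : ℂ → ℝ → C2}

lemma IsRealEntireSystem.memLp_left (hs : H.IsRealEntireSystem Θ Φ) (hH : H.IsDirac) (z : ℂ)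
    {x : ℝ} (hx : x ∈ H.I) : MemLp (Φ z) 2 (volume.restrict (H.leftOpen x)) := by
  obtain ⟨g, -, h, -⟩ := hs.phi_dom z
  exact IsEnd.L2Near.memLp (isEnd_atA hH.lt) (hs.phi.sol z).continuousOn h hx

/-- `W(Φ(z)^*, Φ(z))` in terms of the norm of `Φ(z)`. -/
lemma IsRealEntireSystem.W_conj_eq (hs : H.IsRealEntireSystem Θ Φ) (hH : H.IsDirac) (z : ℂ) {x : ℝ} (hx : x ∈ H.I) :
    W (cj (Φ z x)) (Φ z x) =
      ((starRingEnd ℂ) z - z) * ((∫ y in H.leftOpen x, ‖Φ z y‖ ^ 2 : ℝ) : ℂ) := by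
  have hL : ∀ x ∈ H.I, MemLp (Φ z) 2 (volume.restrict (H.leftOpen x)) :=
    fun x hx => hs.memLp_left hH z hx
  have hi : ∀ x ∈ H.I, IntegrableOn (fun y => ((‖Φ z y‖ ^ 2 : ℝ) : ℂ)) (H.leftOpen x) :=
    fun x hx => ((memLp_two_iff_integrable_sq_norm (hL x hx).1).1 (hL x hx)).ofReal
  have hl : LocallyIntegrableOn (fun y => ((‖Φ z y‖ ^ 2 : ℝ) : ℂ)) H.I :=
    (Complex.continuous_ofReal.comp_continuousOn
      ((hs.phi.sol z).continuousOn.norm.pow 2)).locallyIntegrableOn H.isOpen_I.measurableSet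
  have h1 := (prim_integral_leftOpen hH.lt hl hi).const_mul H.itv_I ((starRingEnd ℂ) z - z)
  have l1 := (tendsto_integral_leftOpen hH.lt hx (hi x hx)).const_mul ((starRingEnd ℂ) z - z)
  rw [mul_zero] at l1
  have h2 := (hs.phi.sol z).conj.tau.lagrange H.itv_I (hs.phi.sol z)
  have l2 := hs.tendsto_W_atA hH ((hs.phi_dom z).conj hH) (hs.phi_dom z)
  rw [← integral_complex_ofReal]
  refine eq_of_prim_of_tendsto hH.lt h2 (h1.congr' H.itv_I (fun _ _ => rfl) fun t _ => ?_) l2 l1 hx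
  rw [← bil_self_cj]
  simp only [bil, PiLp.smul_apply, smul_eq_mul, cj_apply]
  ring

end

namespace Setup

variable {H : DiracOp} {Θ Φ : ℂ → ℝ → C2} {lam γ : ℝ} (P : H.Setup Θ Φ lam γ)
include P

/-- `c_γ` is monotone: for `γ < 0` its modulus on the left of `x` is smallest at `x`, for `γ > 0` it
is at least `1/γ`. -/
lemma exists_inv_cGamma_le {x : ℝ} (hx : x ∈ H.I) :
    ∃ K, 0 ≤ K ∧ ∀ t ∈ H.leftOpen x, ‖((H.cGamma (Φ lam) γ t : ℂ))⁻¹‖ ≤ K := by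
  have hE := isEnd_atA P.hab
  rcases lt_or_gt_of_ne P.ne with h | h
  · have hcx := P.cGamma_neg h hx
    refine ⟨- (H.cGamma (Φ lam) γ x)⁻¹, neg_nonneg.2 (inv_nonpos.2 hcx.le), fun t ht => ?_⟩
    have htI := hE.sub x hx ht
    have := P.dc.monotoneOn H.itv_I (fun x hx => P.real hx) htI hx ht.2.le
    have hct := P.cGamma_neg h htI
    rw [norm_inv, Complex.norm_real, Real.norm_of_nonpos hct.le, ← inv_neg]
    exact inv_anti₀ (neg_pos.2 hcx) (neg_le_neg this)
  · refine ⟨γ, h.le, fun t ht => ?_⟩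
    have htI := hE.sub x hx ht
    have hct := P.cGamma_pos h htI
    rw [norm_inv, Complex.norm_real, Real.norm_of_nonneg hct.le]
    refine inv_le_of_inv_le₀ h ?_
    rw [P.cGamma_eq htI, ← one_div]
    have : 0 ≤ ∫ y in H.leftOpen t, ‖Φ lam y‖ ^ 2 := integral_nonneg fun _ => sq_nonneg _
    linarith

lemma memLp_smul_left {g : ℝ → ℂ} (hg : ContinuousOn g H.I) {x K : ℝ} (hx : x ∈ H.I)
    (hK : ∀ t ∈ H.leftOpen x, ‖g t‖ ≤ K) :
    MemLp (fun t => (g t / (H.cGamma (Φ lam) γ t : ℂ)) • Φ lam t) 2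
      (volume.restrict (H.leftOpen x)) := by
  have hE := isEnd_atA P.hab
  obtain ⟨C, hC0, hC⟩ := P.exists_inv_cGamma_le hx
  have hc : ContinuousOn (fun t => (g t / (H.cGamma (Φ lam) γ t : ℂ)) • Φ lam t) H.I :=
    (hg.div (P.prim_cGamma.continuousOn H.itv_I) P.dc.ne).smul (P.sol lam).continuousOn
  refine (P.memLp_left lam hx).of_le_mul (c := K * C)
    ((hc.mono (hE.sub x hx)).aestronglyMeasurable (hE.measS hx))
    (ae_restrict_of_forall_mem (hE.measS hx) fun t ht => ?_)
  rw [norm_smul, div_eq_mul_inv, norm_mul]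
  gcongr
  · exact (norm_nonneg _).trans (hK t ht)
  · exact hK t ht
  · exact hC t ht

lemma norm_integral_left_le {f : ℝ → C2}
    (hf : ∀ x ∈ H.I, MemLp f 2 (volume.restrict (H.leftOpen x))) {x : ℝ} (hx : x ∈ H.I) {t : ℝ}
    (ht : t ∈ H.leftOpen x) :
    ‖∫ y in H.leftOpen t, bil (Φ lam y) (f y)‖ ≤ ∫ y in H.leftOpen x, ‖bil (Φ lam y) (f y)‖ :=
  (norm_integral_le_integral_norm _).trans
    (setIntegral_mono_set (P.integrableOn_bil hx (hf x hx)).norm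
      (Eventually.of_forall fun _ => norm_nonneg _)
      ((isEnd_atA P.hab).nested x hx t ht).eventuallyLE)

lemma memLp_transform {f : ℝ → C2}
    (hf : ∀ x ∈ H.I, MemLp f 2 (volume.restrict (H.leftOpen x))) {x : ℝ} (hx : x ∈ H.I) :
    MemLp (fun t => f t - ((∫ y in H.leftOpen t, bil (Φ lam y) (f y)) /
      (H.cGamma (Φ lam) γ t : ℂ)) • Φ lam t) 2 (volume.restrict (H.leftOpen x)) :=
  (hf x hx).sub (P.memLp_smul_left ((P.prim_left hf).continuousOn H.itv_I) hx
    fun _ ht => P.norm_integral_left_le hf hx ht)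

lemma bcA_transform {f : ℝ → C2} (k : ℝ → ℂ)
    (hW : Tendsto (fun x => W (Φ lam x) (f x)) H.atA (𝓝 0)) :
    (H.doubleComm (Φ lam) γ).BCA (fun t => f t - k t • Φ lam t) := fun _ => by
  have hγ : (1 / γ : ℂ) ≠ 0 := one_div_ne_zero (Complex.ofReal_ne_zero.2 P.ne)
  have h := hW.div P.tendsto_cGamma hγ
  rw [zero_div] at h
  refine h.congr fun x => ?_
  rw [P.bcA_eq, P.W_uGamma_sub, Pi.div_apply]

/-- Both sides are primitives of `(z - λ)Φ(λ)ᵀΦ(z)` that vanish at `a`. -/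
lemma mul_integral_eq (z : ℂ) {x : ℝ} (hx : x ∈ H.I) :
    (z - lam) * ∫ y in H.leftOpen x, bil (Φ lam y) (Φ z y) = - W (Φ lam x) (Φ z x) := by
  have h1 := (P.prim_left (f := Φ z) fun x hx => P.memLp_left z hx).const_mul H.itv_I (z - lam)
  have l1 := (P.tendsto_left (f := Φ z) fun x hx => P.memLp_left z hx).const_mul (z - lam)
  have h2 := ((P.sol lam).tau.lagrange H.itv_I (P.sol z)).neg H.itv_I
  have l2 := (P.sys.tendsto_W_atA P.dirac (P.sys.phi_dom lam) (P.sys.phi_dom z)).neg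
  rw [mul_zero] at l1
  rw [neg_zero] at l2
  refine eq_of_prim_of_tendsto P.hab h1 (h2.congr' H.itv_I (fun _ _ => rfl) fun t _ => ?_) l1 l2 hx
  simp only [bil, PiLp.smul_apply, smul_eq_mul]
  ring

/-- The function `Φ_γ(z, x)`. -/
lemma sol_phi (z : ℂ) : (H.doubleComm (Φ lam) γ).Sol z (fun x => Φ z x -
    ((∫ y in H.leftOpen x, bil (Φ lam y) (Φ z y)) / (H.cGamma (Φ lam) γ x : ℂ)) • Φ lam x) := by
  refine (P.dc.intertwine H.itv_I (P.sol z)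
    (P.prim_left (f := Φ z) fun x hx => P.memLp_left z hx)).congr' H.itv_I (fun _ _ => rfl)
    fun x hx => ?_
  have h := P.mul_integral_eq z hx
  have e : lam * (∫ y in H.leftOpen x, bil (Φ lam y) (Φ z y)) - W (Φ lam x) (Φ z x) =
      z * ∫ y in H.leftOpen x, bil (Φ lam y) (Φ z y) := by linear_combination -h
  rw [e, smul_sub, smul_smul, mul_div_assoc]

lemma inDomA_phi (z : ℂ) : (H.doubleComm (Φ lam) γ).InDomA (fun x => Φ z x -
    ((∫ y in H.leftOpen x, bil (Φ lam y) (Φ z y)) / (H.cGamma (Φ lam) γ x : ℂ)) • Φ lam x) := by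
  obtain ⟨x, hx⟩ := nonempty_I P.hab
  have hL := P.memLp_transform (f := Φ z) (fun x hx => P.memLp_left z hx) hx
  exact ⟨_, P.sol_phi z, ⟨x, hx, hL⟩, ⟨x, hx, hL.const_smul z⟩, P.bcA_transform _
    (P.sys.tendsto_W_atA P.dirac (P.sys.phi_dom lam) (P.sys.phi_dom z))⟩

lemma hasDerivAt_phi {x : ℝ} (hx : x ∈ H.I) :
    HasDerivAt (fun z => Φ z x) (deriv (fun z => Φ z x) lam) lam :=
  (P.sys.phi.entire x hx lam).hasDerivAt

/-- The norm of `Φ(λ)` in terms of the derivative of `Φ(z)`. -/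
lemma integral_eq_W_deriv {x : ℝ} (hx : x ∈ H.I) :
    ∫ y in H.leftOpen x, bil (Φ lam y) (Φ lam y) =
      - W (Φ lam x) (deriv (fun z => Φ z x) lam) := by
  have hE := isEnd_atA P.hab
  -- No domination in `z` is available near `a`, so the limit cannot simply be taken under the
  -- integral. Instead `L`, the limit of `∫ Φ(λ)ᵀΦ(z)`, is compared with `A`: Fatou gives `A ≤ Re
  -- L`, Cauchy–Schwarz gives `|L|² ≤ A Re L`, and together they force `L = A`.
  set d := deriv (fun z => Φ z x) lam with hd
  set L := - W (Φ lam x) d with hL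
  set A := ∫ y in H.leftOpen x, ‖Φ lam y‖ ^ 2 with hA
  have hint : ∫ y in H.leftOpen x, bil (Φ lam y) (Φ lam y) = (A : ℂ) := by
    rw [setIntegral_congr_fun (hE.measS hx)
      fun y hy => bil_self_of_real (P.real (hE.sub x hx hy)), integral_complex_ofReal]
  rw [hint]
  obtain ⟨s, hs0, hs⟩ : ∃ s : ℕ → ℝ, (∀ n, s n ≠ 0) ∧ Tendsto s atTop (𝓝 0) :=
    ⟨fun n => 1 / ((n : ℝ) + 1), fun n => by positivity, tendsto_one_div_add_atTop_nhds_zero_nat⟩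
  -- Approach along the imaginary direction, since the formula for `W(Φ(z)^*, Φ(z))` determines the
  -- norm of `Φ(z)` only off the real axis.
  set w : ℕ → ℂ := fun n => s n * Complex.I with hw
  have hw0 : ∀ n, w n ≠ 0 := fun n =>
    mul_ne_zero (Complex.ofReal_ne_zero.2 (hs0 n)) Complex.I_ne_zero
  have hwlim : Tendsto w atTop (𝓝 0) := by
    have := ((Complex.continuous_ofReal.tendsto 0).comp hs).mul_const Complex.I
    simpa using this
  set z : ℕ → ℂ := fun n => lam + w n with hz
  have hzlim : Tendsto z atTop (𝓝 lam) := by simpa using hwlim.const_add (lam : ℂ)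
  have hzne : ∀ n, z n ≠ lam := fun n h => hw0 n (by simpa [hz] using h)
  have hzlim' : Tendsto z atTop (𝓝[≠] (lam : ℂ)) :=
    tendsto_nhdsWithin_iff.2 ⟨hzlim, Eventually.of_forall hzne⟩
  -- the difference quotient
  set σ : ℕ → C2 := fun n => (w n)⁻¹ • (Φ (z n) x - Φ lam x) with hσ
  have hσlim : Tendsto σ atTop (𝓝 d) := by
    have := (hasDerivAt_iff_tendsto_slope.1 (P.hasDerivAt_phi hx)).comp hzlim'
    refine this.congr fun n => ?_
    simp [slope, hσ, hz]
  have hΦ : ∀ n, Φ (z n) x = Φ lam x + w n • σ n := fun n => by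
    simp only [hσ, smul_smul, mul_inv_cancel₀ (hw0 n), one_smul]; abel
  -- the norms converge
  set N : ℕ → ℝ := fun n => ∫ y in H.leftOpen x, ‖Φ (z n) y‖ ^ 2 with hN
  have hNeq : ∀ n, (N n : ℂ) = -(1 / 2) * (W (Φ lam x) (σ n) + W (Φ lam x) (cj (σ n)) -
      w n * W (cj (σ n)) (σ n)) := by
    intro n
    have h1 := P.sys.W_conj_eq P.dirac (z n) hx
    have hcw : (starRingEnd ℂ) (w n) = - w n := by simp [hw]
    have e1 : cj (Φ (z n) x) = Φ lam x - w n • cj (σ n) := by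
      rw [hΦ n]
      have hr := P.real hx
      have hr0 := congrArg (fun v : C2 => v 0) hr
      have hr1 := congrArg (fun v : C2 => v 1) hr
      simp only [cj_apply] at hr0 hr1
      refine C2.ext ?_ ?_
      · simp [hcw, hr0]; ring
      · simp [hcw, hr1]; ring
    have e2 : (starRingEnd ℂ) (z n) - z n = -2 * w n := by
      simp only [hz, map_add, Complex.conj_ofReal, hcw]; ring
    rw [e1, e2, hΦ n] at h1
    have h2 : W (Φ lam x - w n • cj (σ n)) (Φ lam x + w n • σ n) =
        w n * (W (Φ lam x) (σ n) + W (Φ lam x) (cj (σ n)) - w n * W (cj (σ n)) (σ n)) := by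
      simp [W]; ring
    rw [h2] at h1
    have h3 := mul_left_cancel₀ (hw0 n) (b := _ + _ - _) (c := -2 * (N n : ℂ))
      (by rw [h1]; ring)
    rw [h3]; ring
  have hcjlim : Tendsto (fun n => cj (σ n)) atTop (𝓝 (cj d)) :=
    (continuous_cj.tendsto d).comp hσlim
  have hNlim : Tendsto N atTop (𝓝 L.re) := by
    have h1 : Tendsto (fun n => (N n : ℂ)) atTop (𝓝 (-(1 / 2) * (W (Φ lam x) d +
        W (Φ lam x) (cj d) - 0 * W (cj d) d))) := by
      simp only [hNeq]
      exact (((tendsto_W tendsto_const_nhds hσlim).add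
        (tendsto_W tendsto_const_nhds hcjlim)).sub
        (hwlim.mul (tendsto_W hcjlim hσlim))).const_mul _
    have h2 := (Complex.continuous_re.tendsto _).comp h1
    have e : (-(1 / 2) * (W (Φ lam x) d + W (Φ lam x) (cj d) - 0 * W (cj d) d)).re = L.re := by
      have : W (Φ lam x) (cj d) = (starRingEnd ℂ) (W (Φ lam x) d) := by
        rw [cj_W, P.real hx]
      rw [this, zero_mul, sub_zero, Complex.add_conj, hL]
      have e3 : (-(1 / 2) * ((2 * (W (Φ lam x) d).re : ℝ) : ℂ)) =
        ((-(1 / 2) * (2 * (W (Φ lam x) d).re) : ℝ) : ℂ) := by push_cast; ring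
      rw [e3, Complex.ofReal_re, Complex.neg_re]
      ring
    rw [e] at h2
    exact h2
  have hLp : ∀ n, MemLp (Φ (z n)) 2 (volume.restrict (H.leftOpen x)) :=
    fun n => P.memLp_left (z n) hx
  have hLu := P.memLp_left lam hx
  -- lower semicontinuity of the norm
  have hfatou : A ≤ L.re := by
    have hmeas : ∀ n, AEMeasurable (fun y => ‖Φ (z n) y‖ₑ ^ 2) (volume.restrict (H.leftOpen x)) :=
      fun n => (hLp n).1.enorm.pow_const 2
    have h1 := lintegral_liminf_le' (u := atTop) hmeas
    have conv : ∀ ψ : ℝ → C2, MemLp ψ 2 (volume.restrict (H.leftOpen x)) →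
        ∫⁻ y in H.leftOpen x, ‖ψ y‖ₑ ^ 2 =
          ENNReal.ofReal (∫ y in H.leftOpen x, ‖ψ y‖ ^ 2) := by
      intro ψ hψ
      rw [ofReal_integral_eq_lintegral_ofReal ((memLp_two_iff_integrable_sq_norm hψ.1).1 hψ)
        (Eventually.of_forall fun _ => sq_nonneg _)]
      refine lintegral_congr fun t => ?_
      rw [ENNReal.ofReal_pow (norm_nonneg _), ofReal_norm]
    have h2 : ∫⁻ y in H.leftOpen x, ‖Φ lam y‖ₑ ^ 2 =
        ∫⁻ y in H.leftOpen x, liminf (fun n => ‖Φ (z n) y‖ₑ ^ 2) atTop := by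
      refine setLIntegral_congr_fun (hE.measS hx) fun y hy => ?_
      have hc := ((P.sys.phi.entire y (hE.sub x hx hy)).continuous.tendsto lam).comp hzlim
      exact (((ENNReal.continuous_pow 2).tendsto _).comp hc.enorm).liminf_eq.symm
    rw [← h2, conv _ hLu] at h1
    have h3 : liminf (fun n => ∫⁻ y in H.leftOpen x, ‖Φ (z n) y‖ₑ ^ 2) atTop =
        ENNReal.ofReal L.re := by
      simp only [fun n => conv _ (hLp n)]
      exact ((ENNReal.continuous_ofReal.tendsto _).comp hNlim).liminf_eq
    rw [h3] at h1
    have hL0 : 0 ≤ L.re := ge_of_tendsto hNlim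
      (Eventually.of_forall fun n => integral_nonneg fun _ => sq_nonneg _)
    exact (ENNReal.ofReal_le_ofReal_iff hL0).1 h1
  -- the Cauchy–Schwarz inequality
  have hcs : ‖L‖ ^ 2 ≤ A * L.re := by
    have h1 : Tendsto (fun n => ∫ y in H.leftOpen x, bil (Φ lam y) (Φ (z n) y)) atTop (𝓝 L) := by
      refine (tendsto_W (tendsto_const_nhds (x := Φ lam x)) hσlim).neg.congr fun n => ?_
      have h2 := P.mul_integral_eq (z n) hx
      have e : z n - lam = w n := by simp [hz]
      rw [e, hΦ n, W_add_right, W_self, zero_add, W_smul_right, ← mul_neg] at h2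
      rw [← mul_left_cancel₀ (hw0 n) h2]
    refine le_of_tendsto_of_tendsto' (h1.norm.pow 2) (hNlim.const_mul A) fun n => ?_
    exact norm_integral_bil_sq_le hLu (hLp n)
  have hApos : 0 < A := by
    obtain ⟨y, hy, -⟩ := hE.exists_mem hE.mem_I hx
    have h1 := P.integral_pos (hE.sub x hx hy) hx hy.2
    rw [intervalIntegral.integral_of_le hy.2.le, integral_Ioc_eq_integral_Ioo] at h1
    refine h1.trans_le (setIntegral_mono_set ((memLp_two_iff_integrable_sq_norm hLu.1).1 hLu)
      (Eventually.of_forall fun _ => sq_nonneg _) ?_)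
    exact (show Ioo y x ⊆ H.leftOpen x from
      fun t ht => ⟨hy.1.trans (EReal.coe_lt_coe_iff.2 ht.1), ht.2⟩).eventuallyLE
  rw [← Complex.normSq_eq_norm_sq, Complex.normSq_apply] at hcs
  have hre : L.re = A := by nlinarith [mul_self_nonneg L.im]
  have him : L.im = 0 := by
    rw [hre] at hcs
    have : L.im * L.im ≤ 0 := by linarith
    exact mul_self_eq_zero.1 (le_antisymm this (mul_self_nonneg _))
  exact (Complex.ext (by simpa using hre) (by simpa using him)).symm

/-- `∫_a^x Φ(λ)ᵀ Φ(z)` as a difference quotient. -/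
lemma integral_eq_dslope (z : ℂ) {x : ℝ} (hx : x ∈ H.I) :
    ∫ y in H.leftOpen x, bil (Φ lam y) (Φ z y) =
      - dslope (fun z => W (Φ lam x) (Φ z x)) lam z := by
  by_cases hz : z = lam
  · rw [hz, dslope_same, (hasDerivAt_W (P.hasDerivAt_phi hx)).deriv]
    exact P.integral_eq_W_deriv hx
  · have hz' : z - lam ≠ 0 := sub_ne_zero.2 hz
    have h := P.mul_integral_eq z hx
    rw [dslope_of_ne _ hz, slope_def_field, W_self, sub_zero]
    field_simp
    linear_combination h

end Setup

end DiracOp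

end DiracDC

/-! ### Limits and local bounds of solutions in the spectral parameter -/

namespace DiracDC

lemma Prim.of_tendsto {I : Set ℝ} (hI : Itv I) {φ φ' : ℕ → ℝ → ℂ} {ψ ψ' : ℝ → ℂ}
    (h : ∀ n, Prim I (φ n) (φ' n)) (h1 : ∀ x ∈ I, Tendsto (fun n => φ n x) atTop (𝓝 (ψ x)))
    (h2 : ∀ x ∈ I, Tendsto (fun n => φ' n x) atTop (𝓝 (ψ' x)))
    (hb : ∀ x ∈ I, ∀ y ∈ I, ∃ κ : ℝ → ℝ, IntegrableOn κ (uIcc x y) ∧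
      ∀ᶠ n in atTop, ∀ t ∈ uIcc x y, ‖φ' n t‖ ≤ κ t) : Prim I ψ ψ' := by
  have hint : ∀ x ∈ I, ∀ y ∈ I, IntegrableOn ψ' (uIcc x y) := by
    intro x hx y hy
    have hK := hI.uIcc_subset hx hy
    obtain ⟨κ, hκ, hn⟩ := hb x hx y hy
    refine hκ.mono' (aestronglyMeasurable_of_tendsto_ae (u := atTop) (f := φ') (fun n => ?_)
      (ae_restrict_of_forall_mem measurableSet_uIcc fun t ht => h2 t (hK ht)))
      (ae_restrict_of_forall_mem measurableSet_uIcc fun t ht => ?_)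
    · exact ((h n).loc.integrableOn_compact_subset hK isCompact_uIcc).1
    · exact le_of_tendsto (h2 t (hK ht)).norm (hn.mono fun n hn => hn t ht)
  refine ⟨(locallyIntegrableOn_iff hI.lc).2 fun k hk hkc => ?_, fun x hx y hy => ?_⟩
  · rcases k.eq_empty_or_nonempty with rfl | hne
    · exact integrableOn_empty
    · refine (hint _ (hk (hkc.sInf_mem hne)) _ (hk (hkc.sSup_mem hne))).mono_set fun t ht => ?_
      exact Icc_subset_uIcc ⟨csInf_le hkc.bddBelow ht, le_csSup hkc.bddAbove ht⟩
  · obtain ⟨κ, hκ, hn⟩ := hb x hx y hy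
    have hK := hI.uIcc_subset hx hy
    have hlim : Tendsto (fun n => ∫ t in x..y, φ' n t) atTop (𝓝 (∫ t in x..y, ψ' t)) := by
      refine intervalIntegral.tendsto_integral_filter_of_dominated_convergence κ ?_ ?_ ?_ ?_
      · refine Eventually.of_forall fun n => ?_
        exact (intervalIntegrable_iff.1 ((h n).intervalIntegrable hI hx hy)).1
      · filter_upwards [hn] with n hn
        exact Eventually.of_forall fun t ht => hn t (uIoc_subset_uIcc ht)
      · exact intervalIntegrable_iff.2 (hκ.mono_set uIoc_subset_uIcc)
      · exact Eventually.of_forall fun t ht => h2 t (hK (uIoc_subset_uIcc ht))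
    refine tendsto_nhds_unique ((h1 y hy).sub (h1 x hx)) (hlim.congr fun n => ?_)
    exact ((h n).sub_eq x hx y hy).symm

namespace DiracOp

variable {H : DiracOp} {Θ Φ : ℂ → ℝ → C2}

lemma IsDirac.locA (hH : H.IsDirac) : LocallyIntegrableOn H.pot.A H.I := by
  have hm : LocallyIntegrableOn (fun _ : ℝ => H.pot.m) H.I :=
    continuousOn_const.locallyIntegrableOn H.isOpen_I.measurableSet
  exact Complex.ofRealCLM.locallyIntegrableOn_comp (hH.qel_loc.add (hm.add hH.qsc_loc))

lemma IsDirac.locB (hH : H.IsDirac) : LocallyIntegrableOn H.pot.B H.I :=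
  Complex.ofRealCLM.locallyIntegrableOn_comp hH.qam_loc

lemma IsDirac.locD (hH : H.IsDirac) : LocallyIntegrableOn H.pot.D H.I := by
  have hm : LocallyIntegrableOn (fun _ : ℝ => H.pot.m) H.I :=
    continuousOn_const.locallyIntegrableOn H.isOpen_I.measurableSet
  exact Complex.ofRealCLM.locallyIntegrableOn_comp (hH.qel_loc.sub (hm.add hH.qsc_loc))

/-- Passes to the limit in the integrated equation along a sequence, with the locally integrable
potentials times the local bound as dominating functions. -/
lemma Sol.of_tendsto (hH : H.IsDirac) {F : ℂ → ℝ → C2} {z₀ : ℂ}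
    (hsol : ∀ z, z ≠ z₀ → H.Sol z (F z)) (hc : ∀ x ∈ H.I, ContinuousAt (fun z => F z x) z₀)
    (hb : ∀ x ∈ H.I, ∀ y ∈ H.I, ∃ K : ℝ, ∀ᶠ z in 𝓝[≠] z₀, ∀ t ∈ uIcc x y, ‖F z t‖ ≤ K) :
    H.Sol z₀ (F z₀) := by
  have hI := H.itv_I
  obtain ⟨s, hs⟩ := exists_seq_tendsto (𝓝[≠] z₀)
  obtain ⟨N, hN⟩ := (tendsto_nhdsWithin_iff.1 hs).2.exists_forall_of_atTop
  have hs' : Tendsto (fun n => s (n + N)) atTop (𝓝[≠] z₀) :=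
    hs.comp (tendsto_add_atTop_nat N)
  set w : ℕ → ℂ := fun n => s (n + N) with hw
  have hwne : ∀ n, w n ≠ z₀ := fun n => hN (n + N) (Nat.le_add_left _ _)
  have hw0 : Tendsto w atTop (𝓝 z₀) := (tendsto_nhdsWithin_iff.1 hs').1
  have hlim : ∀ x ∈ H.I, ∀ i, Tendsto (fun n => F (w n) x i) atTop (𝓝 (F z₀ x i)) :=
    fun x hx i => ((C2.coord i).continuous.tendsto _).comp ((hc x hx).tendsto.comp hw0)
  have bound : ∀ x ∈ H.I, ∀ y ∈ H.I, ∃ K : ℝ, 0 ≤ K ∧ ∀ᶠ n in atTop, ‖w n‖ ≤ ‖z₀‖ + 1 ∧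
      ∀ t ∈ uIcc x y, ‖F (w n) t 0‖ ≤ K ∧ ‖F (w n) t 1‖ ≤ K := by
    intro x hx y hy
    obtain ⟨K, hK⟩ := hb x hx y hy
    refine ⟨max K 0, le_max_right _ _, ?_⟩
    filter_upwards [hs'.eventually hK, hw0.norm.eventually_le_const (lt_add_one _)] with n h1 h2
    exact ⟨h2, fun t ht => ⟨((norm_apply_le _ _).trans (h1 t ht)).trans (le_max_left _ _),
      ((norm_apply_le _ _).trans (h1 t ht)).trans (le_max_left _ _)⟩⟩
  have hiq : ∀ x ∈ H.I, ∀ y ∈ H.I, ∀ {Z : ℝ → ℂ}, LocallyIntegrableOn Z H.I → ∀ K : ℝ,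
      IntegrableOn (fun t => ‖Z t‖ * K) (uIcc x y) := fun x hx y hy Z hZ K =>
    (hZ.integrableOn_compact_subset (hI.uIcc_subset hx hy) isCompact_uIcc).norm.mul_const K
  have hic : ∀ x y K : ℝ, IntegrableOn (fun _ : ℝ => K) (uIcc x y) := fun x y K =>
    continuousOn_const.integrableOn_compact isCompact_uIcc
  refine (tau_iff hI).2 ⟨?_, ?_⟩
  · refine Prim.of_tendsto hI (fun n => ((tau_iff hI).1 (hsol (w n) (hwne n))).1)
      (fun x hx => hlim x hx 0) (fun x hx => ?_) fun x hx y hy => ?_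
    · simp only [PiLp.smul_apply, smul_eq_mul]
      exact ((hw0.mul (hlim x hx 1)).sub ((hlim x hx 0).const_mul _)).sub
        ((hlim x hx 1).const_mul _)
    · obtain ⟨K, hK0, hK⟩ := bound x hx y hy
      refine ⟨fun t => (‖z₀‖ + 1) * K + ‖H.pot.B t‖ * K + ‖H.pot.D t‖ * K,
        ((hic x y _).add (hiq x hx y hy hH.locB K)).add (hiq x hx y hy hH.locD K), ?_⟩
      filter_upwards [hK] with n hn t ht
      obtain ⟨k0, k1⟩ := hn.2 t ht
      refine (norm_sub_le _ _).trans (add_le_add ((norm_sub_le _ _).trans (add_le_add ?_ ?_)) ?_)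
      · rw [PiLp.smul_apply, norm_smul]
        exact mul_le_mul hn.1 k1 (norm_nonneg _) (by positivity)
      · rw [norm_mul]; gcongr
      · rw [norm_mul]; gcongr
  · refine Prim.of_tendsto hI (fun n => ((tau_iff hI).1 (hsol (w n) (hwne n))).2)
      (fun x hx => hlim x hx 1) (fun x hx => ?_) fun x hx y hy => ?_
    · simp only [PiLp.smul_apply, smul_eq_mul]
      exact (((hlim x hx 0).const_mul _).add ((hlim x hx 1).const_mul _)).sub
        (hw0.mul (hlim x hx 0))
    · obtain ⟨K, hK0, hK⟩ := bound x hx y hy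
      refine ⟨fun t => ‖H.pot.A t‖ * K + ‖H.pot.B t‖ * K + (‖z₀‖ + 1) * K,
        ((hiq x hx y hy hH.locA K).add (hiq x hx y hy hH.locB K)).add (hic x y _), ?_⟩
      filter_upwards [hK] with n hn t ht
      obtain ⟨k0, k1⟩ := hn.2 t ht
      refine (norm_sub_le _ _).trans (add_le_add ((norm_add_le _ _).trans (add_le_add ?_ ?_)) ?_)
      · rw [norm_mul]; gcongr
      · rw [norm_mul]; gcongr
      · rw [PiLp.smul_apply, norm_smul]
        exact mul_le_mul hn.1 k0 (norm_nonneg _) (by positivity)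

/-- Solutions depending continuously on the spectral parameter are locally bounded. -/
lemma IsRealEntireSystem.exists_norm_le (hs : H.IsRealEntireSystem Θ Φ) {F : ℂ → ℝ → C2}
    (hF : ∀ z, H.Sol z (F z)) {z₀ : ℂ} {x y : ℝ} (hx : x ∈ H.I) (hy : y ∈ H.I)
    (hc : ContinuousAt (fun z => F z x) z₀) :
    ∃ K : ℝ, ∀ᶠ z in 𝓝 z₀, ∀ t ∈ uIcc x y, ‖F z t‖ ≤ K := by
  have hI := H.itv_I
  have hK := hI.uIcc_subset hx hy
  obtain ⟨k1, hk1⟩ := isCompact_uIcc.exists_bound_of_continuousOn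
    ((hs.theta.sol z₀).continuousOn.mono hK)
  obtain ⟨k2, hk2⟩ := isCompact_uIcc.exists_bound_of_continuousOn
    ((hs.phi.sol z₀).continuousOn.mono hK)
  set k := max (max k1 k2) 0 with hk
  have hk0 : 0 ≤ k := le_max_right _ _
  have hΘ : ∀ t ∈ uIcc x y, ‖Θ z₀ t‖ ≤ k := fun t ht =>
    (hk1 t ht).trans ((le_max_left _ _).trans (le_max_left _ _))
  have hΦ : ∀ t ∈ uIcc x y, ‖Φ z₀ t‖ ≤ k := fun t ht =>
    (hk2 t ht).trans ((le_max_right _ _).trans (le_max_left _ _))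
  -- Chosen so that, when `F z` is expanded in `Θ z₀, Φ z₀`, the error from `z ≠ z₀` is at most half
  -- of the maximum `M` and can be absorbed.
  set δ := 1 / (4 * k * k * |y - x| + 1) with hδ
  have hδ0 : 0 < δ := by positivity
  have e1 : ∀ᶠ z in 𝓝 z₀, ‖z - z₀‖ ≤ δ := by
    have : Tendsto (fun z => ‖z - z₀‖) (𝓝 z₀) (𝓝 ‖z₀ - z₀‖) :=
      (tendsto_id.sub_const z₀).norm
    rw [sub_self, norm_zero] at this
    exact this.eventually_le_const hδ0
  have e2 : ∀ᶠ z in 𝓝 z₀, ‖F z x‖ ≤ ‖F z₀ x‖ + 1 :=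
    hc.norm.tendsto.eventually_le_const (lt_add_one _)
  refine ⟨4 * k * k * (‖F z₀ x‖ + 1), ?_⟩
  filter_upwards [e1, e2] with z hz1 hz2
  obtain ⟨τ, hτ, hmax⟩ := isCompact_uIcc.exists_isMaxOn nonempty_uIcc
    ((hF z).continuousOn.mono hK).norm
  set M := ‖F z τ‖ with hM
  have hMt : ∀ t ∈ uIcc x y, ‖F z t‖ ≤ M := fun t ht => hmax ht
  have hM0 : 0 ≤ M := norm_nonneg _
  have main : ∀ {G : ℝ → C2}, H.Sol z₀ G → (∀ t ∈ uIcc x y, ‖G t‖ ≤ k) →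
      ‖W (F z τ) (G τ)‖ ≤ ‖F z x‖ * k + δ * (M * k) * |y - x| := by
    intro G hG hGk
    have h1 := ((hF z).tau.lagrange hI hG).sub_eq x hx τ (hK hτ)
    have h2 : ‖∫ t in x..τ, (bil (z • F z t) (G t) - bil (F z t) (z₀ • G t))‖ ≤
        δ * (M * k) * |τ - x| := by
      refine intervalIntegral.norm_integral_le_of_norm_le_const fun t ht => ?_
      have ht' : t ∈ uIcc x y := uIcc_subset_uIcc left_mem_uIcc hτ (uIoc_subset_uIcc ht)
      have e : bil (z • F z t) (G t) - bil (F z t) (z₀ • G t) =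
          (z - z₀) * bil (F z t) (G t) := by simp [bil]; ring
      rw [e, norm_mul]
      refine mul_le_mul hz1 ((norm_bil_le _ _).trans ?_) (norm_nonneg _) hδ0.le
      exact mul_le_mul (hMt t ht') (hGk t ht') (norm_nonneg _) hM0
    have h3 : |τ - x| ≤ |y - x| := abs_sub_left_of_mem_uIcc hτ
    have h4 : W (F z τ) (G τ) = W (F z x) (G x) +
        ∫ t in x..τ, (bil (z • F z t) (G t) - bil (F z t) (z₀ • G t)) := by
      rw [← h1]; ring
    rw [h4]
    refine (norm_add_le _ _).trans (add_le_add ?_ (h2.trans ?_))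
    · exact (norm_W_le _ _).trans
        (mul_le_mul_of_nonneg_left (hGk x left_mem_uIcc) (norm_nonneg _))
    · gcongr
  have m1 := main (hs.phi.sol z₀) hΦ
  have m2 := main (hs.theta.sol z₀) hΘ
  have h5 : M ≤ 2 * k * (‖F z x‖ * k + δ * (M * k) * |y - x|) := by
    rw [hM]
    nth_rewrite 1 [eq_of_W_eq_one (hs.wronskian z₀ τ (hK hτ)) (F z τ)]
    rw [W_swap (F z τ) (Θ z₀ τ)]
    refine (norm_add_le _ _).trans ?_
    rw [norm_smul, norm_smul, norm_neg]
    have n1 := mul_le_mul m1 (hΘ τ hτ) (norm_nonneg _) (by positivity)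
    have n2 := mul_le_mul m2 (hΦ τ hτ) (norm_nonneg _) (by positivity)
    linarith
  have h6 : 2 * k * (δ * (M * k) * |y - x|) ≤ M / 2 := by
    have h7 : δ * (4 * k * k * |y - x|) ≤ 1 := by
      rw [hδ, one_div, inv_mul_le_iff₀ (by positivity)]
      linarith
    nlinarith
  intro t ht
  have h8 := hMt t ht
  have h9 : 4 * k * k * ‖F z x‖ ≤ 4 * k * k * (‖F z₀ x‖ + 1) := by gcongr
  nlinarith

namespace Setup

variable {lam γ : ℝ} (P : H.Setup Θ Φ lam γ)
include P

/-- The value of `Φ_γ` at `λ`. -/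
lemma phi_lam_eq {x : ℝ} (hx : x ∈ H.I) : Φ lam x -
    (∫ y in H.leftOpen x, bil (Φ lam y) (Φ lam y)) • H.uGamma (Φ lam) γ x =
      (γ : ℂ)⁻¹ • H.uGamma (Φ lam) γ x := by
  have hc := P.dc.ne x hx
  have hg : (γ : ℂ) ≠ 0 := Complex.ofReal_ne_zero.2 P.ne
  have h := P.cGamma_eq' hx
  have e : ∫ y in H.leftOpen x, bil (Φ lam y) (Φ lam y) =
      (H.cGamma (Φ lam) γ x : ℂ) - 1 / γ := by rw [h]; ring
  rw [e, P.uGamma_eq]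
  simp only [smul_smul]
  have e2 : ((H.cGamma (Φ lam) γ x : ℂ) - 1 / γ) * (H.cGamma (Φ lam) γ x : ℂ)⁻¹ =
      1 - (γ : ℂ)⁻¹ * (H.cGamma (Φ lam) γ x : ℂ)⁻¹ := by field_simp
  rw [e2, sub_smul, one_smul]
  abel

end Setup

end DiracOp

end DiracDC

/-! ### The transformed real entire system -/

namespace DiracDC

lemma cj_eq_self_iff {v : C2} : cj v = v ↔ ∀ i, (v i).im = 0 :=
  ⟨fun h i => by rw [← Complex.conj_eq_iff_im, ← cj_apply, h], cj_eq_self⟩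

lemma W_add_left (f g h : C2) : W (f + g) h = W f h + W g h := by simp [W]; ring

lemma cj_add (f g : C2) : cj (f + g) = cj f + cj g := C2.ext (by simp) (by simp)

lemma cj_smul (c : ℂ) (f : C2) : cj (c • f) = (starRingEnd ℂ) c • cj f :=
  C2.ext (by simp) (by simp)

lemma im_eq_zero_of_forall_ne {lam : ℝ} {F : ℂ → C2} (hF : Continuous F)
    (h : ∀ r : ℝ, r ≠ lam → ∀ i, (F r i).im = 0) (r : ℝ) (i : Fin 2) : (F r i).im = 0 := by
  have hc : Continuous fun r : ℝ => (F r i).im :=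
    Complex.continuous_im.comp ((C2.coord i).continuous.comp
      (hF.comp Complex.continuous_ofReal))
  have := hc.ext_on (dense_compl_singleton lam) continuous_const (fun r hr => h r hr i)
  exact congrFun this r

namespace DiracOp

/-- The function `Φ_γ(z, x)`. -/
noncomputable def phiGamma (H : DiracOp) (Φ : ℂ → ℝ → C2) (lam γ : ℝ) (z : ℂ) (x : ℝ) : C2 :=
  Φ z x - (∫ y in H.leftOpen x, bil (Φ lam y) (Φ z y)) • H.uGamma (Φ lam) γ x

/-- The function whose difference quotient at `λ` is `Θ_γ - Θ`. -/
noncomputable def thetaNum (H : DiracOp) (Θ Φ : ℂ → ℝ → C2) (lam γ : ℝ) (z : ℂ) (x : ℝ) : C2 :=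
  W (Φ lam x) (Θ z x) • H.uGamma (Φ lam) γ x + (γ : ℂ) • H.phiGamma Φ lam γ z x

/-- The function `Θ_γ(z, x)`. -/
noncomputable def thetaGamma (H : DiracOp) (Θ Φ : ℂ → ℝ → C2) (lam γ : ℝ) (z : ℂ) (x : ℝ) : C2 :=
  Θ z x + dslope (fun z => H.thetaNum Θ Φ lam γ z x) lam z

namespace Setup

variable {H : DiracOp} {Θ Φ : ℂ → ℝ → C2} {lam γ : ℝ} (P : H.Setup Θ Φ lam γ)
include P

lemma phiGamma_eq (z : ℂ) (x : ℝ) : H.phiGamma Φ lam γ z x = Φ z x -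
    ((∫ y in H.leftOpen x, bil (Φ lam y) (Φ z y)) / (H.cGamma (Φ lam) γ x : ℂ)) • Φ lam x := by
  rw [phiGamma, P.uGamma_eq, smul_smul, div_eq_mul_inv]

lemma phiGamma_of_ne {z : ℂ} (hz : z ≠ lam) {x : ℝ} (hx : x ∈ H.I) :
    H.phiGamma Φ lam γ z x =
      Φ z x + (1 / (z - lam)) • (W (Φ lam x) (Φ z x) • H.uGamma (Φ lam) γ x) := by
  have hz' : z - lam ≠ 0 := sub_ne_zero.2 hz
  have h := P.mul_integral_eq z hx
  have e : ∫ y in H.leftOpen x, bil (Φ lam y) (Φ z y) =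
      -((1 / (z - lam)) * W (Φ lam x) (Φ z x)) := by
    field_simp
    linear_combination h
  rw [phiGamma, e, neg_smul, sub_neg_eq_add, smul_smul]

lemma phiGamma_lam {x : ℝ} (hx : x ∈ H.I) :
    H.phiGamma Φ lam γ lam x = (γ : ℂ)⁻¹ • H.uGamma (Φ lam) γ x :=
  P.phi_lam_eq hx

lemma sol_phiGamma (z : ℂ) :
    (H.doubleComm (Φ lam) γ).Sol z (H.phiGamma Φ lam γ z) := by
  rw [funext (P.phiGamma_eq z)]
  exact P.sol_phi z

lemma inDomA_phiGamma (z : ℂ) :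
    (H.doubleComm (Φ lam) γ).InDomA (H.phiGamma Φ lam γ z) := by
  rw [funext (P.phiGamma_eq z)]
  exact P.inDomA_phi z

lemma differentiable_phiGamma {x : ℝ} (hx : x ∈ H.I) :
    Differentiable ℂ (fun z => H.phiGamma Φ lam γ z x) := by
  have h := P.sys.phi.entire x hx
  refine h.sub (Differentiable.smul_const ?_ _)
  simp only [fun z => P.integral_eq_dslope z hx]
  exact (differentiable_dslope (differentiable_W h) _).neg

lemma differentiable_thetaNum {x : ℝ} (hx : x ∈ H.I) :
    Differentiable ℂ (fun z => H.thetaNum Θ Φ lam γ z x) :=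
  ((differentiable_W (P.sys.theta.entire x hx)).smul_const _).add
    ((P.differentiable_phiGamma hx).const_smul (γ : ℂ) :)

lemma differentiable_thetaGamma {x : ℝ} (hx : x ∈ H.I) :
    Differentiable ℂ (fun z => H.thetaGamma Θ Φ lam γ z x) :=
  (P.sys.theta.entire x hx).add (differentiable_dslope (P.differentiable_thetaNum hx) _)

/-- This cancellation makes the singularity of `Θ_γ` at `λ` removable and is the reason for the
summand `γΦ_γ`: `W(Φ(λ),Θ(λ)) = -1`, while `γΦ_γ(λ)` is the function multiplied by it. -/
lemma thetaNum_lam {x : ℝ} (hx : x ∈ H.I) : H.thetaNum Θ Φ lam γ lam x = 0 := by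
  have h : W (Φ lam x) (Θ lam x) = -1 := by rw [W_swap, P.sys.wronskian lam x hx]
  rw [thetaNum, P.phiGamma_lam hx, h, smul_smul,
    mul_inv_cancel₀ (Complex.ofReal_ne_zero.2 P.ne), one_smul, neg_one_smul, neg_add_cancel]

lemma thetaGamma_of_ne {z : ℂ} (hz : z ≠ lam) {x : ℝ} (hx : x ∈ H.I) :
    H.thetaGamma Θ Φ lam γ z x = Θ z x + (1 / (z - lam)) •
      (W (Φ lam x) (Θ z x) • H.uGamma (Φ lam) γ x + (γ : ℂ) • H.phiGamma Φ lam γ z x) := by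
  rw [thetaGamma, dslope_of_ne _ hz, slope, P.thetaNum_lam hx, vsub_eq_sub, sub_zero, one_div]
  rfl

lemma thetaGamma_lam {x : ℝ} (hx : x ∈ H.I) :
    H.thetaGamma Θ Φ lam γ lam x = Θ lam x +
      W (Φ lam x) (deriv (fun z => Θ z x) lam) • H.uGamma (Φ lam) γ x +
      (γ : ℂ) • deriv (fun z => H.phiGamma Φ lam γ z x) lam := by
  have h1 := (hasDerivAt_W (u := Φ lam x) (P.sys.theta.entire x hx lam).hasDerivAt).smul_const
    (H.uGamma (Φ lam) γ x)
  have h2 := (P.differentiable_phiGamma hx lam).hasDerivAt.const_smul (γ : ℂ)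
  rw [thetaGamma, dslope_same, add_assoc]
  congr 1
  exact (h1.add h2).deriv

lemma sol_thetaGamma_of_ne {z : ℂ} (hz : z ≠ lam) :
    (H.doubleComm (Φ lam) γ).Sol z (H.thetaGamma Θ Φ lam γ z) := by
  have h1 := P.sol_transform hz (P.sys.theta.sol z)
  have h2 := (P.sol_phiGamma z).smul ((1 / (z - lam)) * γ)
  refine (h1.add h2).tau.congr' H.itv_I (fun x hx => ?_) fun x hx => ?_
  · rw [P.thetaGamma_of_ne hz hx, smul_add, smul_smul _ (γ : ℂ), add_assoc]
  · rw [P.thetaGamma_of_ne hz hx, smul_add (1 / (z - lam)), smul_smul _ (γ : ℂ), add_assoc]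

/-- The explicit formula degenerates at `λ`, so it is estimated on a circle around `λ`, uniformly in
`t`, and the maximum principle carries the bound inside. -/
lemma norm_thetaGamma_le {x y : ℝ} (hx : x ∈ H.I) (hy : y ∈ H.I) :
    ∃ K : ℝ, ∀ᶠ z in 𝓝[≠] (lam : ℂ), ∀ t ∈ uIcc x y, ‖H.thetaGamma Θ Φ lam γ z t‖ ≤ K := by
  have hK := H.itv_I.uIcc_subset hx hy
  obtain ⟨k1, h1⟩ := P.sys.exists_norm_le P.sys.theta.sol hx hy
    (P.sys.theta.entire x hx (lam : ℂ)).continuousAt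
  obtain ⟨k2, h2⟩ := P.sys.exists_norm_le P.sys.phi.sol hx hy
    (P.sys.phi.entire x hx (lam : ℂ)).continuousAt
  obtain ⟨k3, h3⟩ := isCompact_uIcc.exists_bound_of_continuousOn
    ((P.sol lam).continuousOn.mono hK)
  obtain ⟨k4, h4⟩ := isCompact_uIcc.exists_bound_of_continuousOn
    (P.sol_uGamma.continuousOn.mono hK)
  obtain ⟨r, hr, hball⟩ := Metric.eventually_nhds_iff.1 (h1.and h2)
  set ρ := r / 2 with hρ
  have hρ0 : 0 < ρ := half_pos hr
  have k30 : 0 ≤ k3 := (norm_nonneg _).trans (h3 x left_mem_uIcc)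
  have k40 : 0 ≤ k4 := (norm_nonneg _).trans (h4 x left_mem_uIcc)
  set Kφ := k2 + 1 / ρ * (k3 * k2 * k4) with hKφ
  refine ⟨k1 + 1 / ρ * (k3 * k1 * k4 + |γ| * Kφ), ?_⟩
  have hsphere : ∀ z ∈ Metric.sphere (lam : ℂ) ρ, ∀ t ∈ uIcc x y,
      ‖H.thetaGamma Θ Φ lam γ z t‖ ≤ k1 + 1 / ρ * (k3 * k1 * k4 + |γ| * Kφ) := by
    intro z hz t ht
    have htI := hK ht
    have hd : ‖z - lam‖ = ρ := by rw [← dist_eq_norm]; exact hz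
    have hne : z ≠ lam := by
      rintro rfl
      simp only [sub_self, norm_zero] at hd
      linarith
    obtain ⟨b1, b2⟩ := hball (show dist z lam < r by rw [dist_eq_norm, hd]; linarith)
    have hφ : ‖H.phiGamma Φ lam γ z t‖ ≤ Kφ := by
      rw [P.phiGamma_of_ne hne htI]
      refine (norm_add_le _ _).trans (add_le_add (b2 t ht) ?_)
      rw [norm_smul, norm_smul, norm_div, norm_one, hd]
      have k20 : 0 ≤ k2 := (norm_nonneg _).trans (b2 t ht)
      gcongr
      · exact (norm_W_le _ _).trans (mul_le_mul (h3 t ht) (b2 t ht) (norm_nonneg _) k30)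
      · exact h4 t ht
    rw [P.thetaGamma_of_ne hne htI]
    refine (norm_add_le _ _).trans (add_le_add (b1 t ht) ?_)
    rw [norm_smul, norm_div, norm_one, hd]
    gcongr
    refine (norm_add_le _ _).trans (add_le_add ?_ ?_)
    · rw [norm_smul]
      have k10 : 0 ≤ k1 := (norm_nonneg _).trans (b1 t ht)
      gcongr
      · exact (norm_W_le _ _).trans (mul_le_mul (h3 t ht) (b1 t ht) (norm_nonneg _) k30)
      · exact h4 t ht
    · rw [norm_smul, Complex.norm_real, Real.norm_eq_abs]
      gcongr
  filter_upwards [nhdsWithin_le_nhds (Metric.ball_mem_nhds (lam : ℂ) hρ0)] with z hz t ht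
  refine Complex.norm_le_of_forall_mem_frontier_norm_le (U := Metric.ball (lam : ℂ) ρ)
    Metric.isBounded_ball (f := fun z => H.thetaGamma Θ Φ lam γ z t)
    (P.differentiable_thetaGamma (hK ht)).diffContOnCl (fun w hw => ?_) (subset_closure hz)
  rw [frontier_ball _ hρ0.ne'] at hw
  exact hsphere w hw t ht

lemma sol_thetaGamma (z : ℂ) :
    (H.doubleComm (Φ lam) γ).Sol z (H.thetaGamma Θ Φ lam γ z) := by
  by_cases hz : z = lam
  · rw [hz]
    exact Sol.of_tendsto (F := H.thetaGamma Θ Φ lam γ) P.isDirac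
      (fun z hz => P.sol_thetaGamma_of_ne hz)
      (fun x hx => (P.differentiable_thetaGamma hx _).continuousAt)
      fun x hx y hy => P.norm_thetaGamma_le hx hy
  · exact P.sol_thetaGamma_of_ne hz

lemma real_phiGamma (r : ℝ) {x : ℝ} (hx : x ∈ H.I) (i : Fin 2) :
    (H.phiGamma Φ lam γ r x i).im = 0 := by
  refine im_eq_zero_of_forall_ne (lam := lam) (P.differentiable_phiGamma hx).continuous
    (fun r hr => cj_eq_self_iff.1 ?_) r i
  rw [P.phiGamma_of_ne (Complex.ofReal_injective.ne hr) hx]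
  have h := cj_eq_self (P.sys.phi.real r x hx)
  simp [cj_add, cj_smul, cj_W, P.real hx, h, P.uGamma_real hx]

lemma real_thetaGamma (r : ℝ) {x : ℝ} (hx : x ∈ H.I) (i : Fin 2) :
    (H.thetaGamma Θ Φ lam γ r x i).im = 0 := by
  refine im_eq_zero_of_forall_ne (lam := lam) (P.differentiable_thetaGamma hx).continuous
    (fun r hr => cj_eq_self_iff.1 ?_) r i
  rw [P.thetaGamma_of_ne (Complex.ofReal_injective.ne hr) hx]
  have h := cj_eq_self (P.sys.theta.real r x hx)
  have h' := cj_eq_self (fun i => P.real_phiGamma r hx i)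
  simp only [cj_add, cj_smul, cj_W, P.real hx, h, h', P.uGamma_real hx, map_div₀, map_one,
    map_sub, Complex.conj_ofReal]

lemma wronskian_gamma (z : ℂ) {x : ℝ} (hx : x ∈ H.I) :
    W (H.thetaGamma Θ Φ lam γ z x) (H.phiGamma Φ lam γ z x) = 1 := by
  have hc : Continuous fun z => W (H.thetaGamma Θ Φ lam γ z x) (H.phiGamma Φ lam γ z x) :=
    continuous_iff_continuousAt.2 fun z => tendsto_W
      (P.differentiable_thetaGamma hx).continuous.continuousAt
      (P.differentiable_phiGamma hx).continuous.continuousAt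
  have := hc.ext_on (dense_compl_singleton (lam : ℂ)) continuous_const (g := fun _ => (1 : ℂ))
    fun z hz => ?_
  · exact congrFun this z
  · have h1 := P.phiGamma_of_ne hz hx
    have h2 := P.thetaGamma_of_ne hz hx
    have h3 := P.sys.wronskian z x hx
    simp only
    -- The multiple of `Φ_γ` in `Θ_γ` drops out. The remaining corrections are parallel to `Φ(λ)`,
    -- and their cross terms cancel by antisymmetry.
    rw [h2, smul_add, smul_smul _ (γ : ℂ), ← add_assoc, W_add_left, W_smul_left, W_self, mul_zero,
      add_zero, h1, P.uGamma_eq]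
    simp only [W_add_left, W_add_right, W_smul_left, W_smul_right, W_self, h3]
    rw [W_swap (Φ lam x) (Θ z x)]
    ring

lemma phiGamma_ne_zero (z : ℂ) {x : ℝ} (hx : x ∈ H.I) : H.phiGamma Φ lam γ z x ≠ 0 := fun h => by
  have := P.wronskian_gamma z hx
  simp [h, W] at this

lemma isRealEntireSystem :
    (H.doubleComm (Φ lam) γ).IsRealEntireSystem (H.thetaGamma Θ Φ lam γ)
      (H.phiGamma Φ lam γ) where
  theta := ⟨P.sol_thetaGamma, fun _ hx => P.differentiable_thetaGamma hx,
    fun r _ hx i => P.real_thetaGamma r hx i⟩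
  phi := ⟨P.sol_phiGamma, fun _ hx => P.differentiable_phiGamma hx,
    fun r _ hx i => P.real_phiGamma r hx i⟩
  phi_nontrivial z := by
    obtain ⟨x, hx⟩ := nonempty_I P.hab
    exact ⟨x, hx, P.phiGamma_ne_zero z hx⟩
  phi_dom := P.inDomA_phiGamma
  wronskian z _ hx := P.wronskian_gamma z hx

end Setup

end DiracOp

end DiracDC

/-! ### Holomorphic integrals, variation of constants and Green functions -/

namespace DiracDC

/-- Holomorphic dependence of an integral on a parameter. -/
lemma differentiable_setIntegral {F : ℂ → ℝ → ℂ} {S : Set ℝ} (hS : MeasurableSet S)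
    (hm : ∀ z, AEStronglyMeasurable (F z) (volume.restrict S))
    (hd : ∀ t ∈ S, Differentiable ℂ (fun z => F z t))
    (hb : ∀ z₀ : ℂ, ∃ κ : ℝ → ℝ, IntegrableOn κ S ∧ ∀ᶠ z in 𝓝 z₀, ∀ t ∈ S, ‖F z t‖ ≤ κ t) :
    Differentiable ℂ (fun z => ∫ t in S, F z t) := by
  intro z₀
  obtain ⟨κ, hκ, hev⟩ := hb z₀
  obtain ⟨r, hr, hball⟩ := Metric.eventually_nhds_iff.1 hev
  -- Cauchy's estimate on a circle of radius `r/4`, which stays inside the ball of radius `r` where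
  -- `κ` dominates.
  have hsub : ∀ z ∈ Metric.ball z₀ (r / 2), ∀ t ∈ S, ‖deriv (fun z => F z t) z‖ ≤ κ t / (r / 4) := by
    intro z hz t ht
    refine Complex.norm_deriv_le_of_forall_mem_sphere_norm_le (by linarith)
      (hd t ht).diffContOnCl fun w hw => hball ?_ t ht
    have h1 : dist w z = r / 4 := hw
    have h2 : dist z z₀ < r / 2 := hz
    linarith [dist_triangle w z z₀]
  obtain ⟨s, hs⟩ := exists_seq_tendsto (𝓝[≠] z₀)
  have hmeas : AEStronglyMeasurable (fun t => deriv (fun z => F z t) z₀) (volume.restrict S) := by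
    refine aestronglyMeasurable_of_tendsto_ae (u := atTop)
      (f := fun n t => (s n - z₀)⁻¹ • (F (s n) t - F z₀ t))
      (fun n => ((hm (s n)).sub (hm z₀)).const_smul (s n - z₀)⁻¹ :)
      (ae_restrict_of_forall_mem hS fun t ht => ?_)
    refine ((hasDerivAt_iff_tendsto_slope.1 (hd t ht z₀).hasDerivAt).comp hs).congr fun n => ?_
    simp [slope]
  exact (hasDerivAt_integral_of_dominated_loc_of_deriv_le
    (F := F) (F' := fun z t => deriv (fun z => F z t) z) (bound := fun t => κ t / (r / 4))
    (Metric.ball_mem_nhds z₀ (half_pos hr)) (Eventually.of_forall hm)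
    (hκ.mono' (hm z₀) (ae_restrict_of_forall_mem hS (hball (by simpa using hr)))) hmeas
    (ae_restrict_of_forall_mem hS fun t ht z hz => hsub z hz t ht) (hκ.div_const _)
    (ae_restrict_of_forall_mem hS fun t ht z _ => (hd t ht z).hasDerivAt)).2.differentiableAt

lemma Prim.integral {J : Set ℝ} (hJ : Itv J) {φ : ℝ → ℂ} (h : LocallyIntegrableOn φ J) {x₀ : ℝ}
    (hx₀ : x₀ ∈ J) : Prim J (fun x => ∫ t in x₀..x, φ t) φ :=
  ⟨h, fun _ hx _ hy => intervalIntegral.integral_interval_sub_left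
    (hJ.intervalIntegrable h hx₀ hy) (hJ.intervalIntegrable h hx₀ hx)⟩

lemma locallyIntegrableOn_of_memLp {J : Set ℝ} {h : ℝ → C2}
    (hh : MemLp h 2 (volume.restrict J)) : LocallyIntegrableOn h J :=
  locallyIntegrableOn_of_locallyIntegrable_restrict (hh.locallyIntegrable (by norm_num))

lemma locallyIntegrableOn_bil {J : Set ℝ} (hJ : Itv J) {u h : ℝ → C2} (hu : ContinuousOn u J)
    (hh : LocallyIntegrableOn h J) : LocallyIntegrableOn (fun x => bil (u x) (h x)) J := by
  obtain ⟨u0, u1⟩ := C2.continuousOn_iff.1 hu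
  have l : ∀ i : Fin 2, LocallyIntegrableOn (fun x => h x i) J := fun i x hx => by
    obtain ⟨t, ht, hti⟩ := hh x hx
    exact ⟨t, ht, (C2.coord i).integrable_comp hti⟩
  exact ((l 0).continuousOn_mul u0 hJ.lc).add ((l 1).continuousOn_mul u1 hJ.lc)

/-- Variation of constants. -/
lemma Potential.Tau.variation {q : Potential} {J : Set ℝ} (hJ : Itv J) {u v h : ℝ → C2} {z : ℂ}
    {α β : ℝ → ℂ} (hu : q.Tau J u (fun x => z • u x)) (hv : q.Tau J v (fun x => z • v x))
    (hα : Prim J α (fun x => bil (v x) (h x))) (hβ : Prim J β (fun x => - bil (u x) (h x))) :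
    q.Tau J (fun x => α x • u x + β x • v x)
      (fun x => z • (α x • u x + β x • v x) + W (u x) (v x) • h x) := by
  obtain ⟨u0, u1⟩ := (tau_iff hJ).1 hu
  obtain ⟨v0, v1⟩ := (tau_iff hJ).1 hv
  refine (tau_iff hJ).2 ⟨((hα.mul hJ u0).add hJ (hβ.mul hJ v0)).congr' hJ (fun _ _ => by simp)
    (fun _ _ => ?_), ((hα.mul hJ u1).add hJ (hβ.mul hJ v1)).congr' hJ (fun _ _ => by simp)
    (fun _ _ => ?_)⟩
  · simp [bil, W]; ring
  · simp [bil, W]; ring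

namespace DiracOp

variable {H : DiracOp} {Θ Φ : ℂ → ℝ → C2} {c : ℝ}

/-- A multiple of the solution satisfying the Dirichlet condition at `c`. -/
noncomputable def dirichletSol (Θ Φ : ℂ → ℝ → C2) (c : ℝ) (z : ℂ) (x : ℝ) : C2 :=
  Φ z c 0 • Θ z x + (-Θ z c 0) • Φ z x

lemma dirichletSol_self (z : ℂ) : dirichletSol Θ Φ c z c 0 = 0 := by
  simp [dirichletSol]; ring

/-- The solution of `τ f = z f + Φ₁(z, c) h` with the Dirichlet condition at `c` which is a multiple
of `Φ(z)` if `h` vanishes on the left of `y`. -/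
noncomputable def truncGreen (Θ Φ : ℂ → ℝ → C2) (c y : ℝ) (h : ℝ → C2) (z : ℂ) (x : ℝ) : C2 :=
  (∫ t in y..x, bil (Φ z t) (h t)) • dirichletSol Θ Φ c z x +
    (∫ t in x..c, bil (dirichletSol Θ Φ c z t) (h t)) • Φ z x

namespace IsRealEntireSystem

variable (hs : H.IsRealEntireSystem Θ Φ) (hH : H.IsDirac) (hc : c ∈ H.I)
include hs

lemma sol_dirichletSol (z : ℂ) : H.Sol z (dirichletSol Θ Φ c z) :=
  ((hs.theta.sol z).smul _).add ((hs.phi.sol z).smul _)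

lemma W_dirichletSol (z : ℂ) {x : ℝ} (hx : x ∈ H.I) :
    W (dirichletSol Θ Φ c z x) (Φ z x) = Φ z c 0 := by
  rw [dirichletSol, W_add_left, W_smul_left, W_smul_left, W_self, hs.wronskian z x hx]
  ring

lemma differentiable_apply {x : ℝ} (hx : x ∈ H.I) (i : Fin 2) :
    Differentiable ℂ (fun z => Φ z x i) :=
  fun z => ((C2.coord i).hasFDerivAt.comp_hasDerivAt z
    (hs.phi.entire x hx z).hasDerivAt).differentiableAt

include hc

lemma differentiable_dirichletSol {x : ℝ} (hx : x ∈ H.I) :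
    Differentiable ℂ (fun z => dirichletSol Θ Φ c z x) :=
  ((hs.differentiable_apply hc 0).smul (hs.theta.entire x hx)).add
    (Differentiable.smul (fun z => ((C2.coord 0).hasFDerivAt.comp_hasDerivAt z
      (hs.theta.entire c hc z).hasDerivAt).neg.differentiableAt) (hs.phi.entire x hx))

section Compact

variable {h : ℝ → C2} (hh : MemLp h 2 (volume.restrict (H.leftClosed c)))
include hh

lemma locallyIntegrableOn_bil_phi (z : ℂ) :
    LocallyIntegrableOn (fun x => bil (Φ z x) (h x)) (H.leftClosed c) :=
  locallyIntegrableOn_bil (H.itv_leftClosed hc)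
    ((hs.phi.sol z).continuousOn.mono (H.leftClosed_subset hc))
    (locallyIntegrableOn_of_memLp hh)

lemma locallyIntegrableOn_bil_dirichletSol (z : ℂ) :
    LocallyIntegrableOn (fun x => bil (dirichletSol Θ Φ c z x) (h x)) (H.leftClosed c) :=
  locallyIntegrableOn_bil (H.itv_leftClosed hc)
    ((hs.sol_dirichletSol z).continuousOn.mono (H.leftClosed_subset hc))
    (locallyIntegrableOn_of_memLp hh)

lemma prim_right (z : ℂ) : Prim (H.leftClosed c)
    (fun x => ∫ t in x..c, bil (dirichletSol Θ Φ c z t) (h t))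
    (fun x => - bil (dirichletSol Θ Φ c z x) (h x)) := by
  have hJ := H.itv_leftClosed hc
  refine ((Prim.integral hJ (hs.locallyIntegrableOn_bil_dirichletSol hc hh z)
    (x₀ := c) ⟨hc.1, le_rfl⟩).neg hJ).congr' hJ (fun x _ => ?_) fun _ _ => rfl
  rw [intervalIntegral.integral_symm]

/-- The solution `α V + β Φ`, `V` being the solution with the Dirichlet condition at `c`. -/
lemma tau_green (z : ℂ) {α : ℝ → ℂ}
    (hα : Prim (H.leftClosed c) α (fun x => bil (Φ z x) (h x))) :
    H.pot.Tau (H.leftClosed c)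
      (fun x => α x • dirichletSol Θ Φ c z x +
        (∫ t in x..c, bil (dirichletSol Θ Φ c z t) (h t)) • Φ z x)
      (fun x => z • (α x • dirichletSol Θ Φ c z x +
        (∫ t in x..c, bil (dirichletSol Θ Φ c z t) (h t)) • Φ z x) + Φ z c 0 • h x) := by
  have hJ := H.itv_leftClosed hc
  have hsub := H.leftClosed_subset hc
  refine (Potential.Tau.variation hJ ((hs.sol_dirichletSol z).tau.mono hsub)
    ((hs.phi.sol z).tau.mono hsub) hα (hs.prim_right hc hh z)).congr' hJ (fun _ _ => rfl)
    fun x hx => ?_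
  rw [hs.W_dirichletSol z (hsub hx)]

end Compact

end IsRealEntireSystem

end DiracOp

end DiracDC

/-! ### Resolvent estimate off the real axis -/

namespace DiracDC

namespace DiracOp

variable {H : DiracOp} {Θ Φ : ℂ → ℝ → C2} {c : ℝ}

lemma Ioc_subset_leftClosed {y : ℝ} (hy : y ∈ H.leftOpen c) : Ioc y c ⊆ H.leftClosed c :=
  fun _ ht => ⟨hy.1.trans (EReal.coe_lt_coe_iff.2 ht.1), ht.2⟩

lemma Icc_subset_leftClosed {y : ℝ} (hy : y ∈ H.leftOpen c) : Icc y c ⊆ H.leftClosed c :=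
  fun _ ht => ⟨hy.1.trans_le (EReal.coe_le_coe_iff.2 ht.1), ht.2⟩

lemma memLp_Ioc {f : ℝ → C2} (hf : ContinuousOn f (H.leftClosed c)) {y : ℝ}
    (hy : y ∈ H.leftOpen c) : MemLp f 2 (volume.restrict (Ioc y c)) :=
  (memLp_two_of_continuousOn_isCompact isCompact_Icc
    (hf.mono (Icc_subset_leftClosed hy))).mono_measure
    (Measure.restrict_mono Ioc_subset_Icc_self le_rfl)

lemma truncGreen_right {h : ℝ → C2} {y : ℝ} {z : ℂ} : truncGreen Θ Φ c y h z c 0 = 0 := by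
  simp [truncGreen, dirichletSol_self]

namespace IsRealEntireSystem

variable (hs : H.IsRealEntireSystem Θ Φ) (hH : H.IsDirac) (hc : c ∈ H.I)
  {h : ℝ → C2} (hh : MemLp h 2 (volume.restrict (H.leftClosed c)))
include hs hc hh

lemma tau_truncGreen (z : ℂ) {y : ℝ} (hy : y ∈ H.leftOpen c) :
    H.pot.Tau (H.leftClosed c) (truncGreen Θ Φ c y h z)
      (fun x => z • truncGreen Θ Φ c y h z x + Φ z c 0 • h x) :=
  hs.tau_green hc hh z (Prim.integral (H.itv_leftClosed hc)
    (hs.locallyIntegrableOn_bil_phi hc hh z) ⟨hy.1, hy.2.le⟩)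

lemma memLp_truncGreen (z : ℂ) {y : ℝ} (hy : y ∈ H.leftOpen c) :
    MemLp (truncGreen Θ Φ c y h z) 2 (volume.restrict (Ioc y c)) :=
  memLp_Ioc ((hs.tau_truncGreen hc hh z hy).continuousOn (H.itv_leftClosed hc)) hy

include hH

/-- The resolvent estimate at a non-real point. -/
lemma energy_truncGreen (z : ℂ) {y : ℝ} (hy : y ∈ H.leftOpen c) :
    z.im ^ 2 * ∫ t in Ioc y c, ‖truncGreen Θ Φ c y h z t‖ ^ 2 ≤
      ‖Φ z c 0‖ ^ 2 * ∫ t in Ioc y c, ‖h t‖ ^ 2 := by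
  have hJ := H.itv_leftClosed hc
  have hyI := H.leftClosed_subset hc ⟨hy.1, hy.2.le⟩
  have hL := hs.memLp_truncGreen hc hh z hy
  have hhL := hh.mono_measure (Measure.restrict_mono (Ioc_subset_leftClosed hy) le_rfl)
  have hN := hs.tau_truncGreen hc hh z hy
  have hNc : truncGreen Θ Φ c y h z c 0 = 0 := truncGreen_right
  have hNy : truncGreen Θ Φ c y h z y =
      (∫ t in y..c, bil (dirichletSol Θ Φ c z t) (h t)) • Φ z y := by simp [truncGreen]
  set N := truncGreen Θ Φ c y h z with hNdef
  set d := Φ z c 0 with hd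
  set β := ∫ t in y..c, bil (dirichletSol Θ Φ c z t) (h t) with hβ
  set n := ∫ t in Ioc y c, ‖N t‖ ^ 2 with hn
  set s := ∫ t in Ioc y c, bil (cj (h t)) (N t) with hsdef
  set A := ∫ t in H.leftOpen y, ‖Φ z t‖ ^ 2 with hA
  have hn0 : 0 ≤ n := integral_nonneg fun _ => sq_nonneg _
  have hA0 : 0 ≤ A := integral_nonneg fun _ => sq_nonneg _
  have i1 : IntegrableOn (fun t => ((‖N t‖ ^ 2 : ℝ) : ℂ)) (Ioc y c) :=
    ((memLp_two_iff_integrable_sq_norm hL.1).1 hL).ofReal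
  have i2 : IntegrableOn (fun t => bil (cj (h t)) (N t)) (Ioc y c) :=
    integrable_bil (memLp_cj hhL) hL
  have i3 : IntegrableOn (fun t => (starRingEnd ℂ) (bil (cj (h t)) (N t))) (Ioc y c) :=
    (Complex.conjLIE.integrable_comp_iff).2 i2
  have hlag := ((hN.conj hJ).lagrange hJ hN).sub_eq y ⟨hy.1, hy.2.le⟩ c ⟨hc.1, le_rfl⟩
  rw [intervalIntegral.integral_of_le hy.2.le] at hlag
  have e1 : ∀ t, bil (cj (z • N t + d • h t)) (N t) - bil (cj (N t)) (z • N t + d • h t) =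
      ((starRingEnd ℂ) z - z) * ((‖N t‖ ^ 2 : ℝ) : ℂ) +
        ((starRingEnd ℂ) d * bil (cj (h t)) (N t) -
          d * (starRingEnd ℂ) (bil (cj (h t)) (N t))) := fun t => by
    rw [cj_bil, cj_cj, ← bil_self_cj]
    simp [bil]
    ring
  simp only [e1] at hlag
  have i4 : IntegrableOn (fun t => (starRingEnd ℂ) d * bil (cj (h t)) (N t) -
      d * (starRingEnd ℂ) (bil (cj (h t)) (N t))) (Ioc y c) := (i2.const_mul _).sub (i3.const_mul _)
  rw [integral_add (i1.const_mul _) i4,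
    integral_sub (i2.const_mul _) (i3.const_mul _), integral_const_mul, integral_const_mul,
    integral_const_mul, integral_conj, integral_complex_ofReal, ← hn, ← hsdef] at hlag
  -- The Dirichlet condition removes the boundary term at `c`. At `y` the function is `βΦ(z)`, so
  -- its boundary term is a multiple of the norm of `Φ(z)` on the left of `y`; it has the same sign
  -- as `Im z` times the norm of `N` and may be dropped. This makes the bound uniform in `y`.
  have w1 : W (cj (N c)) (N c) = 0 := by simp [W, hNc]
  have w2 : W (cj (N y)) (N y) = ((‖β‖ ^ 2 * A : ℝ) : ℂ) * ((starRingEnd ℂ) z - z) := by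
    rw [hNy, cj_smul, W_smul_left, W_smul_right, hs.W_conj_eq hH z hyI, ← hA, ← mul_assoc,
      ← Complex.normSq_eq_conj_mul_self, Complex.normSq_eq_norm_sq]
    push_cast
    ring
  rw [w1, w2] at hlag
  have him := congrArg Complex.im hlag
  have him2 : z.im * (n + ‖β‖ ^ 2 * A) = ((starRingEnd ℂ) d * s).im := by
    have e2 : d * (starRingEnd ℂ) s = (starRingEnd ℂ) ((starRingEnd ℂ) d * s) := by simp
    rw [e2] at him
    simp only [Complex.sub_im, Complex.zero_im, Complex.add_im, Complex.conj_im,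
      Complex.im_ofReal_mul, Complex.im_mul_ofReal] at him
    linarith
  have h1 : |z.im| * n ≤ ‖d‖ * ‖s‖ := by
    have h2 : |z.im| * (n + ‖β‖ ^ 2 * A) ≤ ‖d‖ * ‖s‖ := by
      rw [← abs_of_nonneg (show 0 ≤ n + ‖β‖ ^ 2 * A by positivity), ← abs_mul, him2]
      refine (Complex.abs_im_le_norm _).trans_eq ?_
      rw [norm_mul, RCLike.norm_conj]
    have h3 : 0 ≤ |z.im| * (‖β‖ ^ 2 * A) := by positivity
    linarith
  have hcs := norm_integral_bil_sq_le (memLp_cj hhL) hL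
  simp only [norm_cj] at hcs
  rw [← hsdef, ← hn] at hcs
  have hh0 : 0 ≤ ∫ t in Ioc y c, ‖h t‖ ^ 2 := integral_nonneg fun _ => sq_nonneg _
  rcases hn0.eq_or_lt with h0 | h0
  · rw [← h0, mul_zero]
    positivity
  · refine le_of_mul_le_mul_right ?_ h0
    have h4 := pow_le_pow_left₀ (by positivity) h1 2
    rw [mul_pow, mul_pow, sq_abs] at h4
    calc z.im ^ 2 * n * n = z.im ^ 2 * n ^ 2 := by ring
      _ ≤ ‖d‖ ^ 2 * ‖s‖ ^ 2 := h4
      _ ≤ ‖d‖ ^ 2 * ((∫ t in Ioc y c, ‖h t‖ ^ 2) * n) := by gcongr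
      _ = _ := by ring

end IsRealEntireSystem

end DiracOp

end DiracDC

/-! ### Resolvent estimate on the real axis -/

namespace DiracDC

namespace DiracOp

variable {H : DiracOp} {Θ Φ : ℂ → ℝ → C2} {c : ℝ}

namespace IsRealEntireSystem

variable (hs : H.IsRealEntireSystem Θ Φ) (hH : H.IsDirac) (hc : c ∈ H.I)
  {h : ℝ → C2} (hh : MemLp h 2 (volume.restrict (H.leftClosed c)))
include hs hc

include hh in
lemma differentiable_integral_bil {F : ℂ → ℝ → C2} (hF : ∀ z, H.Sol z (F z))
    (hd : ∀ x ∈ H.I, Differentiable ℂ (fun z => F z x)) {a b : ℝ} (ha : a ∈ H.leftClosed c)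
    (hb : b ∈ H.leftClosed c) (hab : a ≤ b) :
    Differentiable ℂ (fun z => ∫ t in a..b, bil (F z t) (h t)) := by
  have hJ := H.itv_leftClosed hc
  have hsub := H.leftClosed_subset hc
  simp only [intervalIntegral.integral_of_le hab]
  have hIcc : Icc a b ⊆ H.leftClosed c := by
    rw [← uIcc_of_le hab]; exact hJ.uIcc_subset ha hb
  have hIoc : Ioc a b ⊆ H.leftClosed c := Ioc_subset_Icc_self.trans hIcc
  have hhi : IntegrableOn h (Ioc a b) :=
    ((locallyIntegrableOn_of_memLp hh).integrableOn_compact_subset hIcc isCompact_Icc).mono_set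
      Ioc_subset_Icc_self
  refine differentiable_setIntegral measurableSet_Ioc (fun z => ?_) (fun t ht z => ?_)
    fun z₀ => ?_
  · exact ((locallyIntegrableOn_bil hJ ((hF z).continuousOn.mono hsub)
      (locallyIntegrableOn_of_memLp hh)).integrableOn_compact_subset hIcc
        isCompact_Icc).1.mono_measure (Measure.restrict_mono Ioc_subset_Icc_self le_rfl)
  · have h1 : ∀ i : Fin 2, DifferentiableAt ℂ (fun z => F z t i) z := fun i =>
      ((C2.coord i).hasFDerivAt.comp_hasDerivAt z
        (hd t (hsub (hIoc ht)) z).hasDerivAt).differentiableAt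
    exact ((h1 0).mul_const _).add ((h1 1).mul_const _)
  · obtain ⟨K, hK⟩ := hs.exists_norm_le hF (hsub ha) (hsub hb)
      ((hd a (hsub ha)) z₀).continuousAt
    refine ⟨fun t => K * ‖h t‖, hhi.norm.const_mul K, hK.mono fun z hz t ht => ?_⟩
    refine (norm_bil_le _ _).trans (mul_le_mul_of_nonneg_right (hz t ?_) (norm_nonneg _))
    rw [uIcc_of_le hab]
    exact Ioc_subset_Icc_self ht

include hh in
lemma differentiable_truncGreen {y x : ℝ} (hy : y ∈ H.leftOpen c) (hx : x ∈ Ioc y c) :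
    Differentiable ℂ (fun z => truncGreen Θ Φ c y h z x) := by
  have hxJ := Ioc_subset_leftClosed hy hx
  have hxI := H.leftClosed_subset hc hxJ
  exact ((hs.differentiable_integral_bil hc hh hs.phi.sol hs.phi.entire
    ⟨hy.1, hy.2.le⟩ hxJ hx.1.le).smul (hs.differentiable_dirichletSol hc hxI)).add
    ((hs.differentiable_integral_bil hc hh hs.sol_dirichletSol
      (fun _ h => hs.differentiable_dirichletSol hc h) hxJ ⟨hc.1, le_rfl⟩ hx.2).smul
      (hs.phi.entire x hxI))

include hh in
lemma exists_norm_truncGreen_le {y : ℝ} (hy : y ∈ H.leftOpen c) (z₀ : ℂ) :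
    ∃ K : ℝ, ∀ᶠ z in 𝓝 z₀, ∀ x ∈ Ioc y c, ‖truncGreen Θ Φ c y h z x‖ ≤ K := by
  have hsub := H.leftClosed_subset hc
  have hyI := hsub ⟨hy.1, hy.2.le⟩
  obtain ⟨K, hK⟩ := hs.exists_norm_le hs.phi.sol hyI hc (hs.phi.entire y hyI z₀).continuousAt
  obtain ⟨K', hK'⟩ := hs.exists_norm_le hs.sol_dirichletSol hyI hc
    (hs.differentiable_dirichletSol hc hyI z₀).continuousAt
  rw [uIcc_of_le hy.2.le] at hK hK'
  have hhi : IntegrableOn h (Ioc y c) :=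
    ((locallyIntegrableOn_of_memLp hh).integrableOn_compact_subset (Icc_subset_leftClosed hy)
      isCompact_Icc).mono_set Ioc_subset_Icc_self
  set N := ∫ t in Ioc y c, ‖h t‖ with hN
  have key : ∀ (u : ℝ → C2) (k a b : ℝ), y ≤ a → a ≤ b → b ≤ c → (∀ t ∈ Icc y c, ‖u t‖ ≤ k) →
      ‖∫ t in a..b, bil (u t) (h t)‖ ≤ k * N := by
    intro u k a b h1 h2 h3 hu
    have hk : 0 ≤ k := (norm_nonneg _).trans (hu y ⟨le_rfl, hy.2.le⟩)
    have hsub : Ioc a b ⊆ Ioc y c := Ioc_subset_Ioc h1 h3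
    rw [intervalIntegral.integral_of_le h2]
    refine (norm_integral_le_of_norm_le ((hhi.mono_set hsub).norm.const_mul k)
      (ae_restrict_of_forall_mem measurableSet_Ioc fun t ht => ?_)).trans ?_
    · exact (norm_bil_le _ _).trans (mul_le_mul_of_nonneg_right
        (hu t (Ioc_subset_Icc_self (hsub ht))) (norm_nonneg _))
    · rw [integral_const_mul]
      exact mul_le_mul_of_nonneg_left (setIntegral_mono_set hhi.norm
        (Eventually.of_forall fun _ => norm_nonneg _) hsub.eventuallyLE) hk
  refine ⟨K * N * K' + K' * N * K, ?_⟩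
  filter_upwards [hK, hK'] with z h1 h2 x hx
  have k0 : 0 ≤ K := (norm_nonneg _).trans (h1 y ⟨le_rfl, hy.2.le⟩)
  have k0' : 0 ≤ K' := (norm_nonneg _).trans (h2 y ⟨le_rfl, hy.2.le⟩)
  have hN0 : 0 ≤ N := integral_nonneg fun _ => norm_nonneg _
  refine (norm_add_le _ _).trans ?_
  rw [norm_smul, norm_smul]
  exact add_le_add
    (mul_le_mul (key _ K y x le_rfl hx.1.le hx.2 h1) (h2 x (Ioc_subset_Icc_self hx))
      (norm_nonneg _) (by positivity))
    (mul_le_mul (key _ K' x c hx.1.le hx.2 le_rfl h2) (h1 x (Ioc_subset_Icc_self hx))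
      (norm_nonneg _) (by positivity))

include hh in
lemma differentiable_integral_truncGreen {y : ℝ} (hy : y ∈ H.leftOpen c) {k : ℝ → C2}
    (hk : MemLp k 2 (volume.restrict (Ioc y c))) :
    Differentiable ℂ (fun z => ∫ t in Ioc y c, bil (k t) (truncGreen Θ Φ c y h z t)) := by
  refine differentiable_setIntegral measurableSet_Ioc
    (fun z => (integrable_bil hk (hs.memLp_truncGreen hc hh z hy)).1) (fun t ht z => ?_)
    fun z₀ => ?_
  · have h1 : ∀ i : Fin 2, DifferentiableAt ℂ (fun z => truncGreen Θ Φ c y h z t i) z := fun i =>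
      ((C2.coord i).hasFDerivAt.comp_hasDerivAt z
        (hs.differentiable_truncGreen hc hh hy ht z).hasDerivAt).differentiableAt
    exact ((h1 0).const_mul _).add ((h1 1).const_mul _)
  · obtain ⟨K, hK⟩ := hs.exists_norm_truncGreen_le hc hh hy z₀
    refine ⟨fun t => ‖k t‖ * K, (hk.norm.integrable (by norm_num)).mul_const K,
      hK.mono fun z hz t ht => ?_⟩
    exact (norm_bil_le _ _).trans (mul_le_mul_of_nonneg_left (hz t ht) (norm_nonneg _))

include hH in
/-- The resolvent estimate at a real point, by the maximum principle. -/
lemma integral_truncGreen_le_of_real {x₀ r : ℝ} (hr : 0 < r)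
    (hd : ∀ z ∈ Metric.closedBall (x₀ : ℂ) r, Φ z c 0 ≠ 0)
    (hh : MemLp h 2 (volume.restrict (H.leftClosed c))) {y : ℝ} (hy : y ∈ H.leftOpen c) :
    r ^ 2 * ∫ t in Ioc y c, ‖truncGreen Θ Φ c y h x₀ t‖ ^ 2 ≤
      4 * ‖Φ x₀ c 0‖ ^ 2 * ∫ t in Ioc y c, ‖h t‖ ^ 2 := by
  have hL := hs.memLp_truncGreen hc hh x₀ hy
  set k : ℝ → C2 := fun t => cj (truncGreen Θ Φ c y h x₀ t) with hk
  set n := ∫ t in Ioc y c, ‖truncGreen Θ Φ c y h x₀ t‖ ^ 2 with hn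
  set η := ∫ t in Ioc y c, ‖h t‖ ^ 2 with hη
  have hn0 : 0 ≤ n := integral_nonneg fun _ => sq_nonneg _
  have hη0 : 0 ≤ η := integral_nonneg fun _ => sq_nonneg _
  have hkL : MemLp k 2 (volume.restrict (Ioc y c)) := memLp_cj hL
  -- Testing against the conjugate of the solution at `x₀` gives an entire function whose value at
  -- `x₀` is the squared norm to be estimated.
  set G : ℂ → ℂ := fun z => ∫ t in Ioc y c, bil (k t) (truncGreen Θ Φ c y h z t) with hG
  have hGd : Differentiable ℂ G := hs.differentiable_integral_truncGreen hc hh hy hkL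
  have hG0 : G x₀ = n := by
    simp only [hG, hk, bil_comm, bil_self_cj, integral_complex_ofReal, hn]
  -- On the circle the quadratic factor has modulus `2r|Im z|`, which cancels the blow-up `1/|Im z|`
  -- of the non-real estimate; at the centre it has modulus `r²`.
  set m : ℂ → ℂ := fun z => ((z - x₀) ^ 2 - r ^ 2) * G z / Φ z c 0 with hm
  have hmd : DiffContOnCl ℂ m (Metric.ball (x₀ : ℂ) r) := by
    refine DifferentiableOn.diffContOnCl fun z hz => ?_
    rw [closure_ball _ hr.ne'] at hz
    refine DifferentiableAt.differentiableWithinAt ?_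
    exact DifferentiableAt.div (by fun_prop) (hs.differentiable_apply hc 0 z) (hd z hz)
  have hsphere : ∀ z ∈ frontier (Metric.ball (x₀ : ℂ) r), ‖m z‖ ≤ 2 * r * √(n * η) := by
    intro z hz
    rw [frontier_ball _ hr.ne'] at hz
    have hdz := hd z (Metric.sphere_subset_closedBall hz)
    have hnz : ‖z - x₀‖ = r := by rw [← dist_eq_norm]; exact hz
    have hP : ‖(z - x₀) ^ 2 - (r : ℂ) ^ 2‖ = 2 * r * |z.im| := by
      have e1 : (r : ℂ) ^ 2 = (z - x₀) * (starRingEnd ℂ) (z - x₀) := by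
        rw [Complex.mul_conj, Complex.normSq_eq_norm_sq, hnz]; push_cast; rfl
      have e2 : (z - x₀) ^ 2 - (r : ℂ) ^ 2 = (z - x₀) * ((z - x₀) - (starRingEnd ℂ) (z - x₀)) := by
        rw [e1]; ring
      rw [e2, Complex.sub_conj, norm_mul, hnz, norm_mul, Complex.norm_real, Complex.norm_I]
      simp
      ring
    have hen := hs.energy_truncGreen hH hc hh z hy
    have hcs := norm_integral_bil_sq_le hkL (hs.memLp_truncGreen hc hh z hy)
    simp only [hk, norm_cj] at hcs
    rw [← hn] at hcs
    refine abs_le_of_sq_le_sq' ?_ (by positivity) |>.2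
    rw [mul_pow, Real.sq_sqrt (by positivity), hm, norm_div, norm_mul, hP, div_pow,
      div_le_iff₀ (by positivity), mul_pow, mul_pow (2 * r) |z.im|, sq_abs]
    calc (2 * r) ^ 2 * z.im ^ 2 * ‖G z‖ ^ 2
        ≤ (2 * r) ^ 2 * z.im ^ 2 * (n * ∫ t in Ioc y c, ‖truncGreen Θ Φ c y h z t‖ ^ 2) := by
          gcongr
      _ = (2 * r) ^ 2 * n * (z.im ^ 2 * ∫ t in Ioc y c, ‖truncGreen Θ Φ c y h z t‖ ^ 2) := by ring
      _ ≤ (2 * r) ^ 2 * n * (‖Φ z c 0‖ ^ 2 * η) := by gcongr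
      _ = _ := by ring
  have hmax := Complex.norm_le_of_forall_mem_frontier_norm_le Metric.isBounded_ball hmd hsphere
    (subset_closure (Metric.mem_ball_self hr))
  have hd0 := norm_pos_iff.2 (hd x₀ (Metric.mem_closedBall_self hr.le))
  simp only [hm, sub_self, hG0] at hmax
  rw [norm_div, norm_mul, div_le_iff₀ hd0] at hmax
  simp only [ne_eq, OfNat.ofNat_ne_zero, not_false_eq_true, zero_pow, zero_sub, norm_neg, norm_pow,
    Complex.norm_real, Real.norm_of_nonneg hr.le, Real.norm_of_nonneg hn0] at hmax
  rcases hn0.eq_or_lt with h0 | h0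
  · rw [← h0, mul_zero]; positivity
  · have h4 := pow_le_pow_left₀ (by positivity) hmax 2
    rw [mul_pow (2 * r * _), mul_pow (2 * r), Real.sq_sqrt (by positivity)] at h4
    have h5 : 0 < r ^ 2 * n := by positivity
    refine le_of_mul_le_mul_right ?_ h5
    nlinarith

end IsRealEntireSystem

end DiracOp

end DiracDC

/-! ### The Green function up to the left endpoint -/

namespace DiracDC

lemma norm_sq_L2 {α : Type*} [MeasurableSpace α] {μ : Measure α} (F : Lp C2 2 μ) :
    ‖F‖ ^ 2 = ∫ x, ‖F x‖ ^ 2 ∂μ := by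
  have h : ((‖F‖ ^ 2 : ℝ) : ℂ) = ((∫ x, ‖F x‖ ^ 2 ∂μ : ℝ) : ℂ) := by
    rw [← integral_complex_ofReal]
    have := L2.inner_def (𝕜 := ℂ) F F
    rw [inner_self_eq_norm_sq_to_K] at this
    push_cast
    rw [← Complex.coe_algebraMap, this]
    refine integral_congr_ae (Eventually.of_forall fun x => ?_)
    simp [inner_self_eq_norm_sq_to_K]
  exact_mod_cast h

lemma lintegral_enorm_sq {μ : Measure ℝ} {f : ℝ → C2} (hf : MemLp f 2 μ) :
    ∫⁻ x, ‖f x‖ₑ ^ 2 ∂μ = ENNReal.ofReal (∫ x, ‖f x‖ ^ 2 ∂μ) := by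
  rw [ofReal_integral_eq_lintegral_ofReal ((memLp_two_iff_integrable_sq_norm hf.1).1 hf)
    (Eventually.of_forall fun _ => sq_nonneg _)]
  refine lintegral_congr fun t => ?_
  rw [ENNReal.ofReal_pow (norm_nonneg _), ofReal_norm]

lemma memLp_two_of_lintegral_le {μ : Measure ℝ} {f : ℝ → C2} (hf : AEStronglyMeasurable f μ)
    {K : ℝ} (hK : 0 ≤ K) (h : ∫⁻ x, ‖f x‖ₑ ^ 2 ∂μ ≤ ENNReal.ofReal K) :
    MemLp f 2 μ ∧ ∫ x, ‖f x‖ ^ 2 ∂μ ≤ K := by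
  have hL : MemLp f 2 μ := by
    refine (memLp_two_iff_integrable_sq_norm hf).2 ⟨hf.norm.pow 2, ?_⟩
    refine lt_of_le_of_lt (le_trans (le_of_eq (lintegral_congr fun x => ?_)) h)
      ENNReal.ofReal_lt_top
    rw [enorm_pow, enorm_norm]
  refine ⟨hL, ?_⟩
  rw [lintegral_enorm_sq hL] at h
  exact (ENNReal.ofReal_le_ofReal_iff hK).1 h

namespace DiracOp

variable {H : DiracOp} {Θ Φ : ℂ → ℝ → C2} {c : ℝ}

lemma restrict_leftOpen (hc : c ∈ H.I) :
    volume.restrict (H.leftOpen c) = volume.restrict (H.leftClosed c) := by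
  have h : H.leftOpen c = H.I ∩ Iio c := Subset.antisymm
    (fun t ht => ⟨H.leftClosed_subset hc ⟨ht.1, ht.2.le⟩, ht.2⟩) fun t ht => ⟨ht.1.1, ht.2⟩
  rw [H.leftClosed_eq hc, h]
  exact Measure.restrict_congr_set ((ae_eq_refl _).inter Iio_ae_eq_Iic)

lemma leftOpen_subset_leftClosed {x : ℝ} (hx : x ∈ H.leftClosed c) :
    H.leftOpen x ⊆ H.leftClosed c := fun _ ht => ⟨ht.1, (ht.2.trans_le hx.2).le⟩

/-- The solution of `τ f = z f + Φ₁(z, c) h` in the domain of the Dirichlet restriction. -/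
noncomputable def green (H : DiracOp) (Θ Φ : ℂ → ℝ → C2) (c : ℝ) (h : ℝ → C2) (z : ℂ) (x : ℝ) :
    C2 :=
  (∫ t in H.leftOpen x, bil (Φ z t) (h t)) • dirichletSol Θ Φ c z x +
    (∫ t in x..c, bil (dirichletSol Θ Φ c z t) (h t)) • Φ z x

lemma green_right {h : ℝ → C2} {z : ℂ} : H.green Θ Φ c h z c 0 = 0 := by
  simp [green, dirichletSol_self]

namespace IsRealEntireSystem

variable (hs : H.IsRealEntireSystem Θ Φ) (hH : H.IsDirac) (hc : c ∈ H.I)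
  {h : ℝ → C2} (hh : MemLp h 2 (volume.restrict (H.leftClosed c)))
include hs hH hc

lemma memLp_leftClosed (z : ℂ) : MemLp (Φ z) 2 (volume.restrict (H.leftClosed c)) := by
  rw [← restrict_leftOpen hc]
  exact hs.memLp_left hH z hc

section

include hh

lemma integrableOn_leftClosed (z : ℂ) :
    IntegrableOn (fun x => bil (Φ z x) (h x)) (H.leftClosed c) :=
  integrable_bil (hs.memLp_leftClosed hH hc z) hh

lemma prim_leftOpen (z : ℂ) : Prim (H.leftClosed c)
    (fun x => ∫ t in H.leftOpen x, bil (Φ z t) (h t)) (fun x => bil (Φ z x) (h x)) := by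
  have hJ := H.itv_leftClosed hc
  have hi : Integrable ((H.leftClosed c).indicator fun x => bil (Φ z x) (h x)) :=
    (integrable_indicator_iff hJ.measurableSet).2 (hs.integrableOn_leftClosed hH hc hh z)
  refine ((prim_integral_leftOpen hH.lt (hi.locallyIntegrable.locallyIntegrableOn _)
    fun _ _ => hi.integrableOn).mono (H.leftClosed_subset hc)).congr' hJ (fun x hx => ?_)
    fun x hx => (indicator_of_mem hx (fun x => bil (Φ z x) (h x))).symm
  exact setIntegral_congr_fun ((isEnd_atA hH.lt).measS (H.leftClosed_subset hc hx))
    fun t ht => (indicator_of_mem (leftOpen_subset_leftClosed hx ht)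
      (fun x => bil (Φ z x) (h x))).symm

lemma tendsto_leftOpen (z : ℂ) :
    Tendsto (fun x => ∫ t in H.leftOpen x, bil (Φ z t) (h t)) H.atA (𝓝 0) := by
  refine tendsto_integral_leftOpen hH.lt hc ?_
  have := hs.integrableOn_leftClosed hH hc hh z
  rwa [IntegrableOn, ← restrict_leftOpen hc] at this

lemma tau_green' (z : ℂ) : H.pot.Tau (H.leftClosed c) (H.green Θ Φ c h z)
    (fun x => z • H.green Θ Φ c h z x + Φ z c 0 • h x) :=
  hs.tau_green hc hh z (hs.prim_leftOpen hH hc hh z)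

lemma green_sub (z : ℂ) {x y : ℝ} (hy : y ∈ H.leftOpen c) (hx : x ∈ H.leftClosed c) :
    H.green Θ Φ c h z x -
      (∫ t in H.leftOpen y, bil (Φ z t) (h t)) • dirichletSol Θ Φ c z x =
      truncGreen Θ Φ c y h z x := by
  rw [truncGreen, ← (hs.prim_leftOpen hH hc hh z).sub_eq y ⟨hy.1, hy.2.le⟩ x hx, green, sub_smul]
  abel

/-- By `green_sub` the truncated function differs from the full one by a multiple of the Dirichlet
solution whose coefficient tends to zero as `y → a`. The convergence is pointwise, so Fatou's lemma
transfers the uniform bound. -/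
lemma memLp_green (z : ℂ) {K : ℝ} (hK : 0 ≤ K) (hb : ∀ y ∈ H.leftOpen c,
    ∫ t in Ioc y c, ‖truncGreen Θ Φ c y h z t‖ ^ 2 ≤ K) :
    MemLp (H.green Θ Φ c h z) 2 (volume.restrict (H.leftClosed c)) ∧
      ∫ t in H.leftClosed c, ‖H.green Θ Φ c h z t‖ ^ 2 ≤ K := by
  have hJ := H.itv_leftClosed hc
  have hE := isEnd_atA hH.lt
  have := hE.cg
  have := hE.neBot
  have hg := (hs.tau_green' hH hc hh z).continuousOn hJ
  have hV := (hs.sol_dirichletSol (c := c) z).continuousOn.mono (H.leftClosed_subset hc)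
  refine memLp_two_of_lintegral_le (hg.aestronglyMeasurable hJ.measurableSet) hK ?_
  set α : ℝ → ℂ := fun y => ∫ t in H.leftOpen y, bil (Φ z t) (h t) with hα
  set u : ℝ → ℝ → ℝ≥0∞ := fun y => (Ioc y c).indicator fun x =>
    ‖H.green Θ Φ c h z x - α y • dirichletSol Θ Φ c z x‖ₑ ^ 2 with hu
  have hm : ∀ y, AEMeasurable (u y) (volume.restrict (H.leftClosed c)) := fun y =>
    (((hg.sub (hV.const_smul (α y))).aestronglyMeasurable
      hJ.measurableSet).enorm.pow_const 2).indicator measurableSet_Ioc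
  have hlim : ∀ x ∈ H.leftClosed c, liminf (fun y => u y x) H.atA =
      ‖H.green Θ Φ c h z x‖ₑ ^ 2 := by
    intro x hx
    have h1 : Tendsto (fun y => H.green Θ Φ c h z x - α y • dirichletSol Θ Φ c z x) H.atA
        (𝓝 (H.green Θ Φ c h z x)) := by
      have := ((hs.tendsto_leftOpen hH hc hh z).smul_const
        (dirichletSol Θ Φ c z x)).const_sub (H.green Θ Φ c h z x)
      rwa [zero_smul, sub_zero] at this
    refine (Tendsto.congr' ?_ (((ENNReal.continuous_pow 2).tendsto _).comp h1.enorm)).liminf_eq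
    filter_upwards [hE.mem x (H.leftClosed_subset hc hx)] with y hy
    simp only [hu, Function.comp]
    rw [indicator_of_mem (show x ∈ Ioc y c from ⟨hy.2, hx.2⟩)]
  have hle : ∀ y ∈ H.leftOpen c, ∫⁻ x in H.leftClosed c, u y x ≤ ENNReal.ofReal K := by
    intro y hy
    have hsub := Ioc_subset_leftClosed hy
    rw [lintegral_indicator measurableSet_Ioc, Measure.restrict_restrict measurableSet_Ioc,
      inter_eq_left.2 hsub,
      setLIntegral_congr_fun measurableSet_Ioc (g := fun x => ‖truncGreen Θ Φ c y h z x‖ₑ ^ 2)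
      fun x hx => by simp only [hα]; rw [hs.green_sub hH hc hh z hy (hsub hx)],
      lintegral_enorm_sq (hs.memLp_truncGreen hc hh z hy)]
    exact ENNReal.ofReal_le_ofReal (hb y hy)
  calc ∫⁻ x in H.leftClosed c, ‖H.green Θ Φ c h z x‖ₑ ^ 2
      = ∫⁻ x in H.leftClosed c, liminf (fun y => u y x) H.atA :=
        setLIntegral_congr_fun hJ.measurableSet fun x hx => (hlim x hx).symm
    _ ≤ liminf (fun y => ∫⁻ x in H.leftClosed c, u y x) H.atA := lintegral_liminf_le' hm
    _ ≤ liminf (fun _ => ENNReal.ofReal K) H.atA :=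
        liminf_le_liminf (by filter_upwards [hE.mem c hc] with y hy using hle y hy)
    _ = _ := liminf_const _

/-- In the limit circle case the coefficient of the Dirichlet solution tends to zero while its
Wronskian with the boundary function converges; the coefficient of `Φ` is bounded while its
Wronskian tends to zero. -/
lemma bcA_green (z : ℂ) : H.BCA (H.green Θ Φ c h z) := fun lc => by
  have hE := isEnd_atA hH.lt
  have hJ := H.itv_leftClosed hc
  obtain ⟨⟨μ, hμ⟩, -, -⟩ := hH.bcA lc
  have hVs := hs.sol_dirichletSol (c := c) z
  have hVL := IsEnd.L2Near.memLp hE hVs.continuousOn (lc z _ hVs) hc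
  have hwL := IsEnd.L2Near.memLp hE hμ.continuousOn (lc μ _ hμ) hc
  obtain ⟨ω, hω⟩ := hE.exists_tendsto_W hc hμ hVs.tau hwL (hwL.const_smul (μ : ℂ)) hVL
    (hVL.const_smul z)
  obtain ⟨g, -, -, -, hΦ⟩ := hs.phi_dom z
  have h1 := (hs.tendsto_leftOpen hH hc hh z).mul hω
  have hi : IntegrableOn (fun t => bil (dirichletSol Θ Φ c z t) (h t)) (H.leftOpen c) :=
    integrable_bil hVL (by rwa [restrict_leftOpen hc])
  have h2 : Tendsto (fun x => (∫ t in x..c, bil (dirichletSol Θ Φ c z t) (h t)) *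
      W (H.bcA x) (Φ z x)) H.atA (𝓝 0) := by
    refine squeeze_zero_norm' (a := fun x =>
      (∫ t in H.leftOpen c, ‖bil (dirichletSol Θ Φ c z t) (h t)‖) * ‖W (H.bcA x) (Φ z x)‖) ?_ ?_
    · filter_upwards [hE.mem c hc] with x hx
      rw [norm_mul]
      refine mul_le_mul_of_nonneg_right ?_ (norm_nonneg _)
      rw [intervalIntegral.integral_of_le hx.2.le, integral_Ioc_eq_integral_Ioo]
      exact (norm_integral_le_integral_norm _).trans (setIntegral_mono_set hi.norm
        (Eventually.of_forall fun _ => norm_nonneg _) (show Ioo x c ⊆ H.leftOpen c from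
          fun t ht => ⟨hx.1.trans (EReal.coe_lt_coe_iff.2 ht.1), ht.2⟩).eventuallyLE)
    · have := (hΦ lc).norm.const_mul
        (∫ t in H.leftOpen c, ‖bil (dirichletSol Θ Φ c z t) (h t)‖)
      rwa [norm_zero, mul_zero] at this
  have h3 := h1.add h2
  rw [zero_mul, zero_add] at h3
  refine h3.congr fun x => ?_
  rw [green, W_add_right, W_smul_right, W_smul_right]

end

/-- Solutions on `(a, c]` in the domain near `a` are multiples of `Φ(z)`. -/
lemma eq_smul_phi_leftClosed {z : ℂ} {v : ℝ → C2}
    (hv : H.pot.Tau (H.leftClosed c) v (fun x => z • v x))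
    (hL : MemLp v 2 (volume.restrict (H.leftClosed c))) (hb : H.BCA v) :
    ∃ α : ℂ, ∀ x ∈ H.leftClosed c, v x = α • Φ z x := by
  have hJ := H.itv_leftClosed hc
  have hsub := H.leftClosed_subset hc
  have hcJ : c ∈ H.leftClosed c := ⟨hc.1, le_rfl⟩
  have hconst : ∀ {F : ℝ → C2}, H.Sol z F → ∀ x ∈ H.leftClosed c, W (v x) (F x) = W (v c) (F c) := by
    intro F hF x hx
    have h := (hv.lagrange hJ (hF.tau.mono hsub)).sub_eq c hcJ x hx
    have e : ∀ t, bil (z • v t) (F t) - bil (v t) (z • F t) = 0 := fun t => by simp [bil]; ring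
    simp only [e, intervalIntegral.integral_zero] at h
    exact sub_eq_zero.1 h
  -- The continuation of `v` to a solution on all of `I`, to which the uniqueness statement near `a`
  -- applies.
  set w : ℝ → C2 := fun x => W (v c) (Φ z c) • Θ z x + W (Θ z c) (v c) • Φ z x with hw
  have hsol : H.Sol z w := ((hs.theta.sol z).smul _).add ((hs.phi.sol z).smul _)
  have hvw : ∀ x ∈ H.leftClosed c, w x = v x := fun x hx => by
    have e := eq_of_W_eq_one (hs.wronskian z x (hsub hx)) (v x)
    rw [W_swap (v x), hconst (hs.phi.sol z) x hx, hconst (hs.theta.sol z) x hx] at e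
    rw [hw, e, W_swap (v c) (Θ z c)]
  have hsub' : H.leftOpen c ⊆ H.leftClosed c := fun t ht => ⟨ht.1, ht.2.le⟩
  have hLw : MemLp w 2 (volume.restrict (H.leftOpen c)) := by
    rw [restrict_leftOpen hc]
    exact hL.ae_eq (ae_restrict_of_forall_mem hJ.measurableSet fun x hx => (hvw x hx).symm)
  obtain ⟨α, hα⟩ := hs.eq_smul_phi hH hsol ⟨_, hsol, ⟨c, hc, hLw⟩, ⟨c, hc, hLw.const_smul z⟩,
    hb.congr hH hc fun x hx => hvw x (hsub' hx)⟩
  exact ⟨α, fun x hx => by rw [← hvw x hx, hα x (hsub hx)]⟩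

/-- The resolvent estimate. -/
lemma exists_truncGreen_le {z : ℂ} (hd : Φ z c 0 ≠ 0) : ∃ K, 0 ≤ K ∧ ∀ h : ℝ → C2,
    MemLp h 2 (volume.restrict (H.leftClosed c)) → ∀ y ∈ H.leftOpen c,
    ∫ t in Ioc y c, ‖truncGreen Θ Φ c y h z t‖ ^ 2 ≤ K * ∫ t in H.leftClosed c, ‖h t‖ ^ 2 := by
  have key : ∀ K₁ K₂ : ℝ, 0 < K₁ → 0 ≤ K₂ → (∀ h : ℝ → C2,
      MemLp h 2 (volume.restrict (H.leftClosed c)) → ∀ y ∈ H.leftOpen c,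
      K₁ * ∫ t in Ioc y c, ‖truncGreen Θ Φ c y h z t‖ ^ 2 ≤ K₂ * ∫ t in Ioc y c, ‖h t‖ ^ 2) →
      ∃ K, 0 ≤ K ∧ ∀ h : ℝ → C2,
      MemLp h 2 (volume.restrict (H.leftClosed c)) → ∀ y ∈ H.leftOpen c,
      ∫ t in Ioc y c, ‖truncGreen Θ Φ c y h z t‖ ^ 2 ≤
        K * ∫ t in H.leftClosed c, ‖h t‖ ^ 2 := by
    intro K₁ K₂ h1 h2 hK
    refine ⟨K₂ / K₁, by positivity, fun h hh y hy => ?_⟩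
    rw [div_mul_eq_mul_div, le_div_iff₀ h1, mul_comm]
    refine (hK h hh y hy).trans (mul_le_mul_of_nonneg_left ?_ h2)
    exact setIntegral_mono_set ((memLp_two_iff_integrable_sq_norm hh.1).1 hh)
      (Eventually.of_forall fun _ => sq_nonneg _) (Ioc_subset_leftClosed hy).eventuallyLE
  by_cases him : z.im = 0
  · obtain ⟨x₀, rfl⟩ : ∃ x₀ : ℝ, (x₀ : ℂ) = z := ⟨z.re, Complex.ext rfl him.symm⟩
    -- By continuity `Φ₁(·,c)` has no zero in a disc; half the radius keeps the closed disc inside.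
    obtain ⟨r, hr, hball⟩ := Metric.eventually_nhds_iff.1
      ((hs.differentiable_apply hc 0).continuous.continuousAt.eventually_ne hd)
    refine key ((r / 2) ^ 2) _ (by positivity) (by positivity) fun h hh y hy =>
      hs.integral_truncGreen_le_of_real hH hc (half_pos hr) (fun w hw => hball ?_) hh hy
    exact lt_of_le_of_lt hw (half_lt_self hr)
  · exact key (z.im ^ 2) _ (by positivity) (by positivity) fun h hh y hy =>
      hs.energy_truncGreen hH hc hh z hy

end IsRealEntireSystem

end DiracOp

end DiracDC

/-! ### The resolvent and purely discrete spectrum of the Dirichlet restrictions -/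

namespace DiracDC

namespace DiracOp

variable {H : DiracOp} {Θ Φ : ℂ → ℝ → C2} {c : ℝ}

namespace IsRealEntireSystem

variable (hs : H.IsRealEntireSystem Θ Φ) (hH : H.IsDirac) (hc : c ∈ H.I)
include hs hH hc

omit hs hH hc in
lemma green_congr {h k : ℝ → C2} (hk : h =ᵐ[volume.restrict (H.leftClosed c)] k) (z : ℂ) {x : ℝ}
    (hx : x ∈ H.leftClosed c) : H.green Θ Φ c h z x = H.green Θ Φ c k z x := by
  have hIoc : Ioc x c ⊆ H.leftClosed c := fun t ht =>
    ⟨hx.1.trans (EReal.coe_lt_coe_iff.2 ht.1), ht.2⟩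
  have h1 := ae_mono (Measure.restrict_mono (μ := volume) (leftOpen_subset_leftClosed hx) le_rfl) hk
  have h2 := ae_mono (Measure.restrict_mono (μ := volume) hIoc le_rfl) hk
  rw [green, green, intervalIntegral.integral_of_le hx.2, intervalIntegral.integral_of_le hx.2]
  congr 2
  · exact integral_congr_ae (by filter_upwards [h1] with t ht; simp only [ht])
  · exact integral_congr_ae (by filter_upwards [h2] with t ht; simp only [ht])

lemma green_add {h k : ℝ → C2} (hh : MemLp h 2 (volume.restrict (H.leftClosed c)))
    (hk : MemLp k 2 (volume.restrict (H.leftClosed c))) (z : ℂ) {x : ℝ}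
    (hx : x ∈ H.leftClosed c) :
    H.green Θ Φ c (fun t => h t + k t) z x = H.green Θ Φ c h z x + H.green Θ Φ c k z x := by
  have hJ := H.itv_leftClosed hc
  have hcJ : c ∈ H.leftClosed c := ⟨hc.1, le_rfl⟩
  have e : ∀ u v w : C2, bil u (v + w) = bil u v + bil u w := fun u v w => by simp [bil]; ring
  have hsub := leftOpen_subset_leftClosed hx
  simp only [green, e]
  rw [integral_add ((hs.integrableOn_leftClosed hH hc hh z).mono_set hsub)
      ((hs.integrableOn_leftClosed hH hc hk z).mono_set hsub),
    intervalIntegral.integral_add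
      (hJ.intervalIntegrable (hs.locallyIntegrableOn_bil_dirichletSol hc hh z) hx hcJ)
      (hJ.intervalIntegrable (hs.locallyIntegrableOn_bil_dirichletSol hc hk z) hx hcJ),
    add_smul, add_smul]
  abel

omit hs hH hc in
lemma green_smul (h : ℝ → C2) (α z : ℂ) (x : ℝ) :
    H.green Θ Φ c (fun t => α • h t) z x = α • H.green Θ Φ c h z x := by
  have e : ∀ u v : C2, bil u (α • v) = α * bil u v := fun u v => by simp [bil]; ring
  simp only [green, e, integral_const_mul, intervalIntegral.integral_const_mul, mul_smul, smul_add]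

/-- The resolvent of the Dirichlet restriction. -/
lemma exists_resolvent {z : ℂ} (hd : Φ z c 0 ≠ 0) :
    ∃ R : L2 (H.leftClosed c) →L[ℂ] L2 (H.leftClosed c), ∀ K,
      R K =ᵐ[volume.restrict (H.leftClosed c)] fun x => (Φ z c 0)⁻¹ • H.green Θ Φ c K z x := by
  have hJ := H.itv_leftClosed hc
  obtain ⟨C, hC0, hC⟩ := hs.exists_truncGreen_le hH hc hd
  have hI0 : ∀ h : ℝ → C2, 0 ≤ ∫ t in H.leftClosed c, ‖h t‖ ^ 2 :=
    fun h => integral_nonneg fun _ => sq_nonneg _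
  have hL := fun K : L2 (H.leftClosed c) => hs.memLp_green hH hc (Lp.memLp K) z
    (mul_nonneg hC0 (hI0 K)) (hC K (Lp.memLp K))
  have hcoe := fun K : L2 (H.leftClosed c) => MemLp.coeFn_toLp ((hL K).1.const_smul (Φ z c 0)⁻¹)
  let T : L2 (H.leftClosed c) →ₗ[ℂ] L2 (H.leftClosed c) :=
    { toFun := fun K => ((hL K).1.const_smul (Φ z c 0)⁻¹).toLp _
      map_add' := fun K L => by
        refine Lp.ext ((hcoe (K + L)).trans (EventuallyEq.trans ?_ (Lp.coeFn_add _ _).symm))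
        filter_upwards [hcoe K, hcoe L, self_mem_ae_restrict hJ.measurableSet] with x h1 h2 hx
        rw [Pi.add_apply, h1, h2]
        simp only [Pi.smul_apply]
        rw [← smul_add, ← hs.green_add hH hc (Lp.memLp K) (Lp.memLp L) z hx,
          green_congr (Lp.coeFn_add K L) z hx]
        rfl
      map_smul' := fun α K => by
        refine Lp.ext ((hcoe (α • K)).trans (EventuallyEq.trans ?_ (Lp.coeFn_smul _ _).symm))
        filter_upwards [hcoe K, self_mem_ae_restrict hJ.measurableSet] with x h1 hx
        simp only [RingHom.id_apply, Pi.smul_apply, h1]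
        rw [green_congr (Lp.coeFn_smul α K) z hx, smul_comm α]
        exact congrArg _ (green_smul _ _ _ _) }
  refine ⟨T.mkContinuous (‖(Φ z c 0)⁻¹‖ * √C) fun K => ?_, fun K => hcoe K⟩
  have h1 : ‖T K‖ ^ 2 ≤ (‖(Φ z c 0)⁻¹‖ * √C * ‖K‖) ^ 2 := by
    rw [norm_sq_L2 (T K), mul_pow, mul_pow, Real.sq_sqrt hC0, norm_sq_L2 K, mul_assoc]
    calc _ = ∫ x in H.leftClosed c, ‖(Φ z c 0)⁻¹‖ ^ 2 * ‖H.green Θ Φ c K z x‖ ^ 2 := by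
          refine integral_congr_ae ?_
          filter_upwards [hcoe K] with x hx
          have : (T K : ℝ → C2) x = (Φ z c 0)⁻¹ • H.green Θ Φ c K z x := hx
          rw [this, norm_smul, mul_pow]
      _ ≤ _ := by
          rw [integral_const_mul]
          exact mul_le_mul_of_nonneg_left (hL K).2 (sq_nonneg _)
  exact (abs_le_of_sq_le_sq' h1 (by positivity)).2

/-- The Green function divided by `Φ₁(z,c)` provides a solution. Uniqueness: a difference of
solutions is `αΦ(z)`, and the Dirichlet condition with `Φ₁(z,c) ≠ 0` gives `α = 0`. -/
lemma isResolventPoint {z : ℂ} (hd : Φ z c 0 ≠ 0) :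
    IsResolventPoint (H.graphDirichlet c) z := by
  have hJ := H.itv_leftClosed hc
  have hcJ : c ∈ H.leftClosed c := ⟨hc.1, le_rfl⟩
  obtain ⟨R, hR⟩ := hs.exists_resolvent hH hc hd
  have hG : ∀ K : L2 (H.leftClosed c), H.pot.Tau (H.leftClosed c)
      (fun x => (Φ z c 0)⁻¹ • H.green Θ Φ c K z x)
      (fun x => z • ((Φ z c 0)⁻¹ • H.green Θ Φ c K z x) + K x) := fun K =>
    ((hs.tau_green' hH hc (Lp.memLp K) z).const_smul hJ (Φ z c 0)⁻¹).congr' hJ (fun _ _ => rfl)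
      fun x _ => by
        rw [smul_add, smul_smul _ (Φ z c 0), inv_mul_cancel₀ hd, one_smul, smul_comm z]
  have hB : ∀ K : L2 (H.leftClosed c), H.BCA (fun x => (Φ z c 0)⁻¹ • H.green Θ Φ c K z x) :=
    fun K => (hs.bcA_green hH hc (Lp.memLp K) z).smul _
  have hadd : ∀ K F : L2 (H.leftClosed c), ((K + z • F : L2 (H.leftClosed c)) : ℝ → C2)
      =ᵐ[volume.restrict (H.leftClosed c)] fun x => z • F x + K x := fun K F => by
    filter_upwards [Lp.coeFn_add K (z • F), Lp.coeFn_smul z F] with x h1 h2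
    rw [h1, Pi.add_apply, h2, Pi.smul_apply, add_comm]
  refine ⟨R, fun F K => ⟨?_, ?_⟩⟩
  · rintro ⟨f, g, hfg, hA, hfc, hF, hK⟩
    simp only at hF hK
    have hg : g =ᵐ[volume.restrict (H.leftClosed c)] fun x => z • f x + K x := by
      filter_upwards [hF, hK, hadd K F] with x h1 h2 h3
      rw [← h2, h3, h1]
    set r : ℝ → C2 := fun x => (Φ z c 0)⁻¹ • H.green Θ Φ c K z x with hr
    have hv : H.pot.Tau (H.leftClosed c) (fun x => f x - r x) (fun x => z • (f x - r x)) := by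
      refine (hfg.sub hJ (hG K)).congr hJ (fun _ _ => rfl) ?_
      filter_upwards [hg] with x hx
      rw [hx, smul_sub]
      simp only [hr]
      abel
    have hvL : MemLp (fun x => f x - r x) 2 (volume.restrict (H.leftClosed c)) :=
      ((Lp.memLp F).ae_eq hF).sub ((Lp.memLp (R K)).ae_eq (hR K))
    have hvB : H.BCA (fun x => f x - r x) := by
      have := hA.add ((hB K).smul (-1))
      simpa [sub_eq_add_neg] using this
    obtain ⟨α, hα⟩ := hs.eq_smul_phi_leftClosed hH hc hv hvL hvB
    have hα0 : α = 0 := by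
      have h1 := congrArg (fun v : C2 => v 0) (hα c hcJ)
      simp only [PiLp.sub_apply, hfc, hr, PiLp.smul_apply, green_right, mul_zero,
        sub_zero, smul_eq_mul] at h1
      exact (mul_eq_zero.1 h1.symm).resolve_right hd
    refine Lp.ext ?_
    filter_upwards [hF, hR K, self_mem_ae_restrict hJ.measurableSet] with x h1 h2 hx
    have := hα x hx
    rw [hα0, zero_smul] at this
    rw [h1, h2]
    exact sub_eq_zero.1 this
  · rintro rfl
    refine ⟨_, _, hG K, hB K, ?_, hR K, ?_⟩
    · simp [green_right]
    · refine (hadd K (R K)).trans ?_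
      filter_upwards [hR K] with x hx
      rw [hx]

/-- A zero would make `W(Φ^*, Φ)` vanish at `c`; for non-real `z` this forces the norm of `Φ(z)` on
`(a, c)` to be zero. -/
lemma apply_ne_zero {z : ℂ} (hz : z.im ≠ 0) : Φ z c 0 ≠ 0 := fun h0 => by
  have h1 := hs.W_conj_eq hH z hc
  have h2 : W (cj (Φ z c)) (Φ z c) = 0 := by simp [W, h0]
  have h3 : (starRingEnd ℂ) z - z ≠ 0 := fun h => hz (Complex.conj_eq_iff_im.1 (sub_eq_zero.1 h))
  rw [h2, eq_comm, mul_eq_zero, or_iff_right h3, Complex.ofReal_eq_zero] at h1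
  have hL := hs.memLp_left hH z hc
  rw [integral_eq_zero_iff_of_nonneg (fun _ => sq_nonneg _)
    ((memLp_two_iff_integrable_sq_norm hL.1).1 hL)] at h1
  have hE := isEnd_atA hH.lt
  obtain ⟨y, hy, -⟩ := hE.exists_mem hE.mem_I hc
  have hsub : Ioo y c ⊆ H.leftOpen c := fun t ht =>
    ⟨hy.1.trans (EReal.coe_lt_coe_iff.2 ht.1), ht.2⟩
  have h4 := ae_mono (Measure.restrict_mono (μ := volume) hsub le_rfl) h1
  have h5 : ∀ᵐ t ∂(volume.restrict (Ioo y c)), False := by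
    filter_upwards [h4, self_mem_ae_restrict measurableSet_Ioo] with t h6 h7
    exact hs.phi_ne_zero (hE.sub c hc (hsub h7)) (norm_eq_zero.1 (pow_eq_zero_iff two_ne_zero |>.1 h6))
  rw [eventually_false_iff_eq_bot, ae_eq_bot, Measure.restrict_eq_zero, Real.volume_Ioo,
    ENNReal.ofReal_eq_zero] at h5
  linarith [hy.2]

/-- If there is a real entire system, the spectrum of the Dirichlet restrictions to the left is
purely discrete. -/
lemma discreteLeft : H.DiscreteLeft c := by
  have hJ := H.itv_leftClosed hc
  have hspec : ∀ w ∈ spec (H.graphDirichlet c), Φ w c 0 = 0 := fun w hw => by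
    by_contra h
    exact hw (hs.isResolventPoint hH hc h)
  have hcoe := fun z => MemLp.coeFn_toLp (hs.memLp_leftClosed hH hc z)
  intro z hz
  refine ⟨?_, ⟨(hs.memLp_leftClosed hH hc z).toLp _, ?_, ?_⟩, ?_⟩
  -- The spectrum lies in the zero set of the entire function `Φ₁(·,c)`, which does not vanish at
  -- `I` and so has isolated zeros.
  · have han : AnalyticOnNhd ℂ (fun z => Φ z c 0) univ := fun w _ =>
      (hs.differentiable_apply hc 0).analyticAt w
    have hne : ∀ᶠ w in 𝓝[≠] z, Φ w c 0 ≠ 0 := by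
      refine (han z (mem_univ z)).eventually_eq_zero_or_eventually_ne_zero.resolve_left fun h => ?_
      have := han.eqOn_zero_of_preconnected_of_eventuallyEq_zero isPreconnected_univ
        (mem_univ z) h (mem_univ Complex.I)
      exact hs.apply_ne_zero hH hc (by simp) this
    obtain ⟨r, hr, hball⟩ := Metric.eventually_nhds_iff.1 (eventually_nhdsWithin_iff.1 hne)
    refine ⟨r, hr, fun w hw hwz => ?_⟩
    by_contra h
    exact hball hwz h (hspec w hw)
  · intro h0
    have h1 := (hcoe z).symm.trans (h0 ▸ Lp.coeFn_zero C2 2 _)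
    have hE := isEnd_atA hH.lt
    obtain ⟨y, hy, -⟩ := hE.exists_mem hE.mem_I hc
    have h4 := ae_mono (Measure.restrict_mono (μ := volume) (Ioc_subset_leftClosed hy) le_rfl) h1
    have h5 : ∀ᵐ t ∂(volume.restrict (Ioc y c)), False := by
      filter_upwards [h4, self_mem_ae_restrict measurableSet_Ioc] with t h6 h7
      exact hs.phi_ne_zero (H.leftClosed_subset hc (Ioc_subset_leftClosed hy h7)) h6
    rw [eventually_false_iff_eq_bot, ae_eq_bot, Measure.restrict_eq_zero, Real.volume_Ioc,
      ENNReal.ofReal_eq_zero] at h5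
    linarith [hy.2]
  · obtain ⟨g, -, -, -, hB⟩ := hs.phi_dom z
    refine ⟨Φ z, _, (hs.phi.sol z).tau.mono (H.leftClosed_subset hc), hB, hspec z hz, hcoe z, ?_⟩
    filter_upwards [Lp.coeFn_smul z ((hs.memLp_leftClosed hH hc z).toLp _), hcoe z] with x h1 h2
    rw [h1, Pi.smul_apply, h2]
  · have hsub : Submodule.span ℂ {F | (F, z • F) ∈ H.graphDirichlet c} ≤
        Submodule.span ℂ {(hs.memLp_leftClosed hH hc z).toLp _} := by
      refine Submodule.span_le.2 ?_
      rintro F ⟨f, g, hfg, hA, -, hF, hK⟩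
      simp only at hF hK
      have hv : H.pot.Tau (H.leftClosed c) f (fun x => z • f x) := by
        refine hfg.congr_ae ?_
        filter_upwards [hF, hK, Lp.coeFn_smul z F] with x h1 h2 h3
        rw [← h2, h3, Pi.smul_apply, h1]
      obtain ⟨α, hα⟩ := hs.eq_smul_phi_leftClosed hH hc hv ((Lp.memLp F).ae_eq hF) hA
      refine Submodule.mem_span_singleton.2 ⟨α, Lp.ext ?_⟩
      filter_upwards [hF, hcoe z, Lp.coeFn_smul α ((hs.memLp_leftClosed hH hc z).toLp _),
        self_mem_ae_restrict hJ.measurableSet] with x h1 h2 h3 hx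
      rw [h3, Pi.smul_apply, h2, h1, hα x hx]
    exact Submodule.finiteDimensional_of_le hsub

end IsRealEntireSystem

end DiracOp

end DiracDC

/-! ### Transformation of the singular Weyl function -/

namespace DiracDC

namespace DiracOp

variable {H : DiracOp} {Θ Φ : ℂ → ℝ → C2}

/-- `M` is the value of the singular Weyl function at `z` if and only if `Θ(z) + M Φ(z)` is a Weyl
solution. -/
lemma IsRealEntireSystem.isWeylValue_iff (hs : H.IsRealEntireSystem Θ Φ) (hH : H.IsDirac)
    {z M : ℂ} : H.IsWeylValue Θ Φ z M ↔ H.IsWeylSolB z (fun x => Θ z x + M • Φ z x) := by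
  have hsol : H.Sol z (fun x => Θ z x + M • Φ z x) := (hs.theta.sol z).add ((hs.phi.sol z).smul M)
  obtain ⟨x₀, hx₀⟩ := nonempty_I hH.lt
  have hΦΨ : ∀ x ∈ H.I, W (Φ z x) (Θ z x + M • Φ z x) = -1 := fun x hx => by
    rw [W_add_right, W_smul_right, W_self, W_swap, hs.wronskian z x hx]
    ring
  have hΘΨ : ∀ x ∈ H.I, W (Θ z x) (Θ z x + M • Φ z x) = M := fun x hx => by
    rw [W_add_right, W_smul_right, W_self, hs.wronskian z x hx]
    ring
  constructor
  · rintro ⟨u, ⟨hu, hB, -⟩, h⟩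
    obtain ⟨hw, hM⟩ := h x₀ hx₀
    -- The normalisation making the coefficient of `Θ` equal to one: in the basis `Θ, Φ` that
    -- coefficient of `u` is `W(u,Φ) = -W(Φ,u)`.
    refine ⟨hsol, (hB.smul (-(W (Φ z x₀) (u x₀))⁻¹)).congr hH fun x hx => ?_, x₀, hx₀, fun h0 => ?_⟩
    · have h1 := hs.sol_eq hu hx₀ hx
      have h2 : W (Θ z x₀) (u x₀) = - M * W (Φ z x₀) (u x₀) := by
        rw [hM, neg_div, neg_neg, div_mul_cancel₀ _ hw]
      rw [h1, h2, W_swap (Φ z x₀) (u x₀), smul_add, smul_smul, smul_smul]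
      congr 1
      · rw [neg_mul_neg, inv_mul_cancel₀ hw, one_smul]
      · congr 1
        field_simp
    · have := hΦΨ x₀ hx₀
      rw [show Θ z x₀ + M • Φ z x₀ = 0 from h0] at this
      simp [W] at this
  · refine fun h => ⟨_, h, fun x hx => ⟨?_, ?_⟩⟩
    · rw [hΦΨ x hx]
      exact neg_ne_zero.2 one_ne_zero
    · rw [hΦΨ x hx, hΘΨ x hx, div_neg, neg_div, neg_neg, div_one]

namespace Setup

variable {lam γ : ℝ} (P : H.Setup Θ Φ lam γ)
include P

/-- The transformed Weyl solution in terms of the transformed system. -/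
lemma weyl_transform_eq {z : ℂ} (hz : z ≠ lam) (M : ℂ) {x : ℝ} (hx : x ∈ H.I) :
    Θ z x + M • Φ z x +
      (1 / (z - lam)) • (W (Φ lam x) (Θ z x + M • Φ z x) • H.uGamma (Φ lam) γ x) =
      H.thetaGamma Θ Φ lam γ z x + (M - γ / (z - lam)) • H.phiGamma Φ lam γ z x := by
  have h : H.thetaGamma Θ Φ lam γ z x + (M - γ / (z - lam)) • H.phiGamma Φ lam γ z x =
      Θ z x + (1 / (z - lam)) • (W (Φ lam x) (Θ z x) • H.uGamma (Φ lam) γ x) +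
        M • H.phiGamma Φ lam γ z x := by
    rw [P.thetaGamma_of_ne hz hx, smul_add, smul_smul _ (γ : ℂ), sub_smul,
      one_div_mul_eq_div]
    abel
  rw [h, P.phiGamma_of_ne hz hx, W_add_right, W_smul_right]
  module

/-- `Φ_γ̃ = Φ(λ)/c_γ` is parallel to `Φ(λ)`, so the correction is invisible to its Wronskian, and
the factor `1/c_γ` may be moved from the vector into the Wronskian. -/
lemma inv_transform_transform (z : ℂ) (v : C2) {x : ℝ} :
    v + (1 / (z - lam)) • (W (Φ lam x) v • H.uGamma (Φ lam) γ x) -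
      (1 / (z - lam)) • (W (H.uGamma (Φ lam) γ x)
        (v + (1 / (z - lam)) • (W (Φ lam x) v • H.uGamma (Φ lam) γ x)) • Φ lam x) = v := by
  have h : W (H.uGamma (Φ lam) γ x)
      (v + (1 / (z - lam)) • (W (Φ lam x) v • H.uGamma (Φ lam) γ x)) • Φ lam x =
      W (Φ lam x) v • H.uGamma (Φ lam) γ x := by
    rw [W_add_right, W_smul_right, W_smul_right, W_self, mul_zero, mul_zero, add_zero, P.uGamma_eq,
      W_smul_left]
    simp only [smul_smul]
    rw [mul_comm]
  rw [h, add_sub_cancel_right]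

lemma isWeylSolB_transform {z : ℂ} (hz : z ≠ lam) {M : ℂ}
    (h : H.IsWeylSolB z (fun x => Θ z x + M • Φ z x)) :
    (H.doubleComm (Φ lam) γ).IsWeylSolB z (fun x => Θ z x + M • Φ z x +
      (1 / (z - lam)) • (W (Φ lam x) (Θ z x + M • Φ z x) • H.uGamma (Φ lam) γ x)) := by
  refine ⟨P.sol_transform hz h.1, P.inDomB_transform hz h.1 h.2.1, ?_⟩
  obtain ⟨x, hx⟩ := nonempty_I P.hab
  refine ⟨x, hx, fun h0 => ?_⟩
  simp only [P.weyl_transform_eq hz M hx] at h0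
  have h1 := P.wronskian_gamma z hx
  rw [eq_neg_of_add_eq_zero_left h0, ← neg_smul, W_smul_left, W_self, mul_zero] at h1
  exact zero_ne_one h1

/-- Both sides say that a normalised combination is a Weyl solution; the transformation exchanges
the two combinations, and the energy estimates in both directions preserve the domain near `b`. -/
lemma isWeylValue_iff {z : ℂ} (hz : z ≠ lam) {M : ℂ} : H.IsWeylValue Θ Φ z M ↔
    (H.doubleComm (Φ lam) γ).IsWeylValue (H.thetaGamma Θ Φ lam γ) (H.phiGamma Φ lam γ) z
      (M - γ / (z - lam)) := by
  rw [P.sys.isWeylValue_iff P.dirac, P.isRealEntireSystem.isWeylValue_iff P.isDirac]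
  constructor
  · intro h
    obtain ⟨h1, h2, x, hx, h3⟩ := P.isWeylSolB_transform hz h
    refine ⟨h1.tau.congr' H.itv_I (fun x hx => (P.weyl_transform_eq hz M hx).symm) fun x hx => ?_,
      h2.congr P.isDirac fun x hx => (P.weyl_transform_eq hz M hx).symm, x, hx, ?_⟩
    · rw [P.weyl_transform_eq hz M hx]
    · simpa only [← P.weyl_transform_eq hz M hx] using h3
  · rintro ⟨h1, h2, -⟩
    obtain ⟨-, h4⟩ := P.inDomB_inv_transform P.isRealEntireSystem hz h1 h2
    have hsol : H.Sol z (fun x => Θ z x + M • Φ z x) :=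
      (P.sys.theta.sol z).add ((P.sol z).smul M)
    obtain ⟨x, hx⟩ := nonempty_I P.hab
    refine ⟨hsol, h4.congr P.dirac fun x hx => ?_, x, hx, fun h0 => ?_⟩
    · simp only [← P.weyl_transform_eq hz M hx]
      exact (P.inv_transform_transform z _).symm
    · have h5 := P.sys.wronskian z x hx
      rw [eq_neg_of_add_eq_zero_left h0, ← neg_smul, W_smul_left, W_self, mul_zero] at h5
      exact zero_ne_one h5

end Setup

lemma doubleComm_zero (H : DiracOp) (u : ℝ → C2) : H.doubleComm u 0 = H := by
  simp [doubleComm, cGammaInv]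

lemma uGamma_zero (H : DiracOp) (u : ℝ → C2) (x : ℝ) : H.uGamma u 0 x = 0 := by
  simp [uGamma, cGammaInv]

end DiracOp

end DiracDC
-- Assembly of the theorem
theorem mainTheorem4 (H : DiracDC.DiracOp) (hH : H.IsDirac)
    (hdisc : ∃ c ∈ H.I, H.DiscreteLeft c)
    (Θ Φ : ℂ → ℝ → DiracDC.C2) (hsys : H.IsRealEntireSystem Θ Φ)
    (lam γ : ℝ)
    (hγ : -((H.normSq (Φ lam))⁻¹).toReal ≤ γ)
    (hlam : MemLp (Φ lam) 2 (volume.restrict H.I) → DiracDC.IsEigenvalue H.graph lam) :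
    let Hγ := H.doubleComm (Φ lam) γ
    let Φt : ℝ → DiracDC.C2 := H.uGamma (Φ lam) γ
    ∃ Θγ Φγ : ℂ → ℝ → DiracDC.C2,
      Hγ.IsDirac ∧
      -- a real entire system of solutions with Wronskian one, given explicitly
      Hγ.IsRealEntireSystem Θγ Φγ ∧
      (∀ z : ℂ, ∀ x ∈ H.I,
        IntegrableOn (fun y => DiracDC.bil (Φ lam y) (Φ z y)) (H.leftOpen x) ∧
        Φγ z x = Φ z x - (∫ y in H.leftOpen x, DiracDC.bil (Φ lam y) (Φ z y)) • Φt x) ∧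
      (∀ z : ℂ, z ≠ lam → ∀ x ∈ H.I,
        Φγ z x = Φ z x + (1 / (z - lam)) • (DiracDC.W (Φ lam x) (Φ z x) • Φt x)) ∧
      (∀ z : ℂ, z ≠ lam → ∀ x ∈ H.I,
        Θγ z x = Θ z x + (1 / (z - lam)) •
          (DiracDC.W (Φ lam x) (Θ z x) • Φt x + (γ : ℂ) • Φγ z x)) ∧
      (γ ≠ 0 → ∀ x ∈ H.I, Φγ lam x = (γ : ℂ)⁻¹ • Φt x) ∧
      (∀ x ∈ H.I,
        Θγ lam x = Θ lam x +
          DiracDC.W (Φ lam x) (deriv (fun z => Θ z x) lam) • Φt x +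
          (γ : ℂ) • deriv (fun z => Φγ z x) lam) ∧
      -- discreteness of the spectrum of the Dirichlet restrictions of the new operator
      (∀ c ∈ Hγ.I, Hγ.DiscreteLeft c) ∧
      -- the new Weyl solution and the new singular Weyl function
      (∀ z M : ℂ, z ≠ lam → H.IsWeylValue Θ Φ z M →
        let Ψ : ℝ → DiracDC.C2 := fun x => Θ z x + M • Φ z x
        let Ψγ : ℝ → DiracDC.C2 := fun x =>
          Ψ x + (1 / (z - lam)) • (DiracDC.W (Φ lam x) (Ψ x) • Φt x)
        Hγ.IsWeylSolB z Ψγ ∧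
          ∀ x ∈ H.I, Ψγ x = Θγ z x + (M - γ / (z - lam)) • Φγ z x) ∧
      (∀ z M : ℂ, z ≠ lam →
        (H.IsWeylValue Θ Φ z M ↔ Hγ.IsWeylValue Θγ Φγ z (M - γ / (z - lam)))) := by

  intro Hγ Φt
  -- For `γ = 0` the convention `1/c_γ = 0` makes the transformation the identity; all other cases
  -- are covered by `Setup`.
  by_cases h0 : γ = 0
  · subst h0
    have hHγ : Hγ = H := H.doubleComm_zero _
    have hΦt : ∀ x, Φt x = 0 := H.uGamma_zero _
    rw [hHγ]
    have hint : ∀ z : ℂ, ∀ x ∈ H.I,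
        IntegrableOn (fun y => DiracDC.bil (Φ (lam : ℝ) y) (Φ z y)) (H.leftOpen x) := fun z x hx =>
      DiracDC.integrable_bil (hsys.memLp_left hH lam hx) (hsys.memLp_left hH z hx)
    refine ⟨Θ, Φ, hH, hsys, fun z x hx => ⟨hint z x hx, ?_⟩, fun z hz x hx => ?_,
      fun z hz x hx => ?_, fun h => absurd rfl h, fun x hx => ?_,
      fun c hc => hsys.discreteLeft hH hc, fun z M hz hM => ?_, fun z M hz => ?_⟩
    · rw [hΦt, smul_zero, sub_zero]
    · rw [hΦt, smul_zero, smul_zero, add_zero]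
    · simp [hΦt]
    · simp [hΦt]
    · simpa [hΦt] using (hsys.isWeylValue_iff hH).1 hM
    · simp
  · have P : H.Setup Θ Φ lam γ := ⟨hH, hsys, hγ, hlam, h0⟩
    refine ⟨H.thetaGamma Θ Φ lam γ, H.phiGamma Φ lam γ, P.isDirac, P.isRealEntireSystem,
      fun z x hx => ⟨P.integrableOn_bil hx (P.memLp_left z hx), rfl⟩,
      fun z hz x hx => P.phiGamma_of_ne hz hx, fun z hz x hx => P.thetaGamma_of_ne hz hx,
      fun _ x hx => P.phiGamma_lam hx, fun x hx => P.thetaGamma_lam hx,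
      fun c hc => P.isRealEntireSystem.discreteLeft P.isDirac hc, fun z M hz hM => ⟨?_, ?_⟩,
      fun z M hz => P.isWeylValue_iff hz⟩
    · exact P.isWeylSolB_transform hz ((hsys.isWeylValue_iff hH).1 hM)
    · exact fun x hx => P.weyl_transform_eq hz M hx
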